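/- Let $R$ be a commutative ring and $d \in \mathbb{N}$. All categories and functors are $R$-linear. A \emph{tensor category} is a (locally small) symmetric monoidal closed $R$-linear category $\mathcal{C}$, with $R$-bilinear tensor product $\otimes$ and unit object $\mathbb{1}$, which has all small colimits. A \emph{tensor functor} is an $R$-linear symmetric strong monoidal functor which has a right adjoint, and $\mathrm{Fun}_{c,\otimes}(\mathcal{A},\mathcal{C})$ denotes the category of tensor functors $\mathcal{A} \to \mathcal{C}$ and symmetric monoidal natural transformations. One says that $\mathcal{C}$ has exact filtered colimits if small filtered colimits in $\mathcal{C}$ commute with finite limits. A commutative algebra $B$ in $\mathcal{C}$ is \emph{faithfully flat} if $B \otimes - \colon \mathcal{C} \to \mathcal{C}$ preserves all finite limits that exist in $\mathcal{C}$ and reflects isomorphisms. An object $M \in \mathcal{C}$ is \emph{locally free of rank $d$} if it has a dual and there is a faithfully flat commutative algebra $B$ in $\mathcal{C}$ such that $B \otimes M \cong B^{\oplus d}$ as $B$-modules. Let $\mathrm{LF}^{\mathrm{rk}\,d}_{\mathrm{iso}}(\mathcal{C})$ be the groupoid of locally free objects of rank $d$ in $\mathcal{C}$ and isomorphisms between them.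 Let $H_d = R[x_{ij} \mid i,j = 1,\ldots,d]_{\det}$ be the Hopf algebra of regular functions on $\mathrm{GL}_d$ over $R$, with $\delta(x_{ij}) = \sum_k x_{ik} \otimes x_{kj}$ and $\varepsilon(x_{ij}) = \delta_{ij}$. Let $\mathrm{Rep}(\mathrm{GL}_d) = \mathrm{Comod}(H_d)$ be the symmetric monoidal category of left $H_d$-comodules in $R$-modules (with the tensor product over $R$ as tensor product), and let $\underline{R}^d$ be the standard representation, that is, $R^d$ with the coaction $e_i \mapsto \sum_j x_{ij} \otimes e_j$. \textbf{Theorem.} Let $\mathcal{C}$ be a tensor category over $R$ with equalizers and exact filtered colimits. Then for every tensor functor $F \colon \mathrm{Comod}(H_d) \to \mathcal{C}$ the object $F(\underline{R}^d)$ is locally free of rank $d$, every morphism $\alpha \colon F \to G$ of tensor functors has an invertible component $\alpha_{\underline{R}^d}$, and the functor $$\mathrm{Fun}_{c,\otimes}\bigl(\mathrm{Comod}(H_d), \mathcal{C}\bigr) \longrightarrow \mathrm{LF}^{\mathrm{rk}\,d}_{\mathrm{iso}}(\mathcal{C}), \qquad F \mapsto F(\underline{R}^d), \quad \alpha \mapsto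 \alpha_{\underline{R}^d},$$ is an equivalence of categories. -/

import Mathlib

open CategoryTheory CategoryTheory.Limits MonoidalCategory
open scoped TensorProduct MonObj

universe w u

namespace RepGL

noncomputable section

/-! ## Comodules over a commutative bialgebra -/

section Comodules

variable (R : Type u) [CommRing R] (H : Type u) [CommRing H] [Bialgebra R H]

/-- A (left) comodule over the `R`-bialgebra `H`: an `R`-module `M` with a coassociative and
counital coaction `M → H ⊗ M`. -/
structure Comod where
  /-- the underlying `R`-module -/
  carrier : ModuleCat.{u} R
  /-- the coaction -/
  coact : carrier →ₗ[R] H ⊗[R] carrier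
  coassoc : (TensorProduct.assoc R H H carrier).toLinearMap ∘ₗ
    (Coalgebra.comul (R := R) (A := H)).rTensor carrier ∘ₗ coact = coact.lTensor H ∘ₗ coact
  counit_coact : (TensorProduct.lid R carrier).toLinearMap ∘ₗ
    (Coalgebra.counit (R := R) (A := H)).rTensor carrier ∘ₗ coact = LinearMap.id

namespace Comod

variable {R H}

/-- A morphism of comodules: a linear map which commutes with the coactions. -/
@[ext]
structure Hom (M N : Comod R H) where
  /-- the underlying map of `R`-modules -/
  hom : M.carrier ⟶ N.carrier
  comm : hom.hom.lTensor H ∘ₗ M.coact = N.coact ∘ₗ hom.hom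

instance : Category (Comod R H) where
  Hom := Hom
  id M := ⟨𝟙 _, by simp⟩
  comp f g := ⟨f.hom ≫ g.hom, by
    rw [ModuleCat.hom_comp, LinearMap.lTensor_comp, LinearMap.comp_assoc, f.comm,
      ← LinearMap.comp_assoc, g.comm, LinearMap.comp_assoc]⟩

@[ext]
theorem hom_ext {M N : Comod R H} {f g : M ⟶ N} (h : f.hom = g.hom) : f = g := Hom.ext h

@[simp]
theorem id_hom (M : Comod R H) : Hom.hom (𝟙 M) = 𝟙 M.carrier := rfl

@[simp]
theorem comp_hom {M N P : Comod R H} (f : M ⟶ N) (g : N ⟶ P) :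
    (f ≫ g).hom = f.hom ≫ g.hom := rfl

/-- An isomorphism of underlying modules which commutes with the coactions is an isomorphism of
comodules. -/
def mkIso {M N : Comod R H} (e : M.carrier ≅ N.carrier)
    (h : e.hom.hom.lTensor H ∘ₗ M.coact = N.coact ∘ₗ e.hom.hom) : M ≅ N where
  hom := ⟨e.hom, h⟩
  inv := ⟨e.inv, by
    have h1 : e.inv.hom.lTensor H ∘ₗ e.hom.hom.lTensor H = LinearMap.id := by
      rw [← LinearMap.lTensor_comp, ← ModuleCat.hom_comp, e.hom_inv_id, ModuleCat.hom_id,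
        LinearMap.lTensor_id]
    have h2 : e.hom.hom ∘ₗ e.inv.hom = LinearMap.id := by
      rw [← ModuleCat.hom_comp, e.inv_hom_id, ModuleCat.hom_id]
    calc e.inv.hom.lTensor H ∘ₗ N.coact
        = e.inv.hom.lTensor H ∘ₗ (N.coact ∘ₗ e.hom.hom) ∘ₗ e.inv.hom := by
          rw [LinearMap.comp_assoc, h2, LinearMap.comp_id]
      _ = (e.inv.hom.lTensor H ∘ₗ e.hom.hom.lTensor H) ∘ₗ M.coact ∘ₗ e.inv.hom := by
          rw [← h]; rfl
      _ = M.coact ∘ₗ e.inv.hom := by rw [h1, LinearMap.id_comp]⟩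
  hom_inv_id := hom_ext e.hom_inv_id
  inv_hom_id := hom_ext e.inv_hom_id

/-! ### The linear structure -/

section Linear

variable (M N : Comod R H)

instance : Zero (M ⟶ N) := ⟨⟨0, by simp⟩⟩
instance : Add (M ⟶ N) := ⟨fun f g => ⟨f.hom + g.hom, by
  rw [ModuleCat.hom_add, LinearMap.lTensor_add, LinearMap.add_comp, f.comm, g.comm,
    LinearMap.comp_add]⟩⟩
instance : Neg (M ⟶ N) := ⟨fun f => ⟨-f.hom, by
  rw [ModuleCat.hom_neg, LinearMap.lTensor_neg, LinearMap.neg_comp, f.comm, LinearMap.comp_neg]⟩⟩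
instance : Sub (M ⟶ N) := ⟨fun f g => ⟨f.hom - g.hom, by
  rw [ModuleCat.hom_sub, LinearMap.lTensor_sub, LinearMap.sub_comp, f.comm, g.comm,
    LinearMap.comp_sub]⟩⟩
instance : SMul R (M ⟶ N) := ⟨fun r f => ⟨r • f.hom, by
  rw [ModuleCat.hom_smul, LinearMap.lTensor_smul, LinearMap.smul_comp, f.comm,
    LinearMap.comp_smul]⟩⟩
instance : SMul ℕ (M ⟶ N) := ⟨fun n f => ⟨n • f.hom, by
  rw [← Nat.cast_smul_eq_nsmul R n f.hom, ModuleCat.hom_smul, LinearMap.lTensor_smul,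
    LinearMap.smul_comp, f.comm, LinearMap.comp_smul]⟩⟩
instance : SMul ℤ (M ⟶ N) := ⟨fun n f => ⟨n • f.hom, by
  rw [← Int.cast_smul_eq_zsmul R n f.hom, ModuleCat.hom_smul, LinearMap.lTensor_smul,
    LinearMap.smul_comp, f.comm, LinearMap.comp_smul]⟩⟩

variable {M N}

@[simp] theorem zero_hom : Hom.hom (0 : M ⟶ N) = 0 := rfl
@[simp] theorem add_hom (f g : M ⟶ N) : Hom.hom (f + g : M ⟶ N) = f.hom + g.hom := rfl
@[simp] theorem neg_hom (f : M ⟶ N) : Hom.hom (-f : M ⟶ N) = -f.hom := rfl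
@[simp] theorem sub_hom (f g : M ⟶ N) : Hom.hom (f - g : M ⟶ N) = f.hom - g.hom := rfl
@[simp] theorem smul_hom (r : R) (f : M ⟶ N) : Hom.hom (r • f : M ⟶ N) = r • f.hom := rfl

theorem hom_injective : 
    Function.Injective (α := M ⟶ N) (β := M.carrier ⟶ N.carrier) Hom.hom :=
  fun _ _ h => hom_ext h

variable (M N)

instance : AddCommGroup (M ⟶ N) :=
  hom_injective.addCommGroup _ rfl (fun _ _ => rfl) (fun _ => rfl) (fun _ _ => rfl)
    (fun _ _ => rfl) (fun _ _ => rfl)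

/-- The additive map which sends a morphism of comodules to the underlying map of modules. -/
def homAddHom : (M ⟶ N) →+ (M.carrier ⟶ N.carrier) where
  toFun := Hom.hom
  map_zero' := rfl
  map_add' _ _ := rfl

instance : Module R (M ⟶ N) :=
  hom_injective.module R (homAddHom M N) (fun _ _ => rfl)

end Linear

instance : Preadditive (Comod R H) where
  add_comp _ _ _ _ _ _ := hom_ext (Preadditive.add_comp _ _ _ _ _ _)
  comp_add _ _ _ _ _ _ := hom_ext (Preadditive.comp_add _ _ _ _ _ _)

instance : Linear R (Comod R H) where
  smul_comp _ _ _ _ _ _ := hom_ext (Linear.smul_comp _ _ _ _ _ _)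
  comp_smul _ _ _ _ _ _ := hom_ext (Linear.comp_smul _ _ _ _ _ _)

variable (R H) in
/-- The forgetful functor from comodules to modules. -/
def forget : Comod R H ⥤ ModuleCat.{u} R where
  obj M := M.carrier
  map f := f.hom

instance : (forget R H).Faithful where
  map_injective h := hom_ext h

instance : (forget R H).Additive where

instance : (forget R H).Linear R where

/-! ### The tensor product of comodules -/

/-- The map `(H ⊗ M) ⊗ (H ⊗ N) → H ⊗ (M ⊗ N)`, `(a ⊗ m) ⊗ (b ⊗ n) ↦ a b ⊗ (m ⊗ n)`. -/
def mulShuffle (M N : Type u) [AddCommGroup M] [Module R M] [AddCommGroup N] [Module R N] :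
    (H ⊗[R] M) ⊗[R] (H ⊗[R] N) →ₗ[R] H ⊗[R] (M ⊗[R] N) :=
  (LinearMap.mul' R H).rTensor (M ⊗[R] N) ∘ₗ
    (TensorProduct.tensorTensorTensorComm R H M H N).toLinearMap

@[simp]
theorem mulShuffle_tmul (M N : Type u) [AddCommGroup M] [Module R M] [AddCommGroup N] [Module R N]
    (a b : H) (m : M) (n : N) :
    mulShuffle (R := R) M N ((a ⊗ₜ m) ⊗ₜ (b ⊗ₜ n)) = (a * b) ⊗ₜ (m ⊗ₜ n) := by
  simp [mulShuffle]

/-- The coaction on a tensor product: `m ⊗ n ↦ ∑ m₍₋₁₎ n₍₋₁₎ ⊗ (m₍₀₎ ⊗ n₍₀₎)`. -/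
def tensorCoact (M N : Comod R H) :
    M.carrier ⊗[R] N.carrier →ₗ[R] H ⊗[R] (M.carrier ⊗[R] N.carrier) :=
  mulShuffle M.carrier N.carrier ∘ₗ TensorProduct.map M.coact N.coact

@[simp]
theorem tensorCoact_tmul (M N : Comod R H) (m : M.carrier) (n : N.carrier) :
    tensorCoact M N (m ⊗ₜ n) = mulShuffle M.carrier N.carrier (M.coact m ⊗ₜ N.coact n) := rfl

theorem mulShuffle_map {M M' N N' : Type u} [AddCommGroup M] [Module R M] [AddCommGroup N]
    [Module R N] [AddCommGroup M'] [Module R M'] [AddCommGroup N'] [Module R N']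
    (f : M →ₗ[R] M') (g : N →ₗ[R] N') (x : H ⊗[R] M) (y : H ⊗[R] N) :
    mulShuffle M' N' (f.lTensor H x ⊗ₜ[R] g.lTensor H y) =
      (TensorProduct.map f g).lTensor H (mulShuffle M N (x ⊗ₜ[R] y)) := by
  induction x with
  | zero => simp
  | add x x' hx hx' => simp only [map_add, TensorProduct.add_tmul, hx, hx']
  | tmul a m =>
    induction y with
    | zero => simp
    | add y y' hy hy' => simp only [map_add, TensorProduct.tmul_add, hy, hy']
    | tmul b n => simp

theorem tensorCoact_coassoc (M N : Comod R H) :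
    (TensorProduct.assoc R H H (M.carrier ⊗[R] N.carrier)).toLinearMap ∘ₗ
      (Coalgebra.comul (R := R) (A := H)).rTensor (M.carrier ⊗[R] N.carrier) ∘ₗ tensorCoact M N =
    (tensorCoact M N).lTensor H ∘ₗ tensorCoact M N := by
  have key1 : ∀ (x : H ⊗[R] M.carrier) (y : H ⊗[R] N.carrier),
      (tensorCoact M N).lTensor H (mulShuffle _ _ (x ⊗ₜ[R] y)) =
      (mulShuffle M.carrier N.carrier).lTensor H
        (mulShuffle _ _ ((M.coact.lTensor H x) ⊗ₜ[R] (N.coact.lTensor H y))) := by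
    intro x y
    rw [mulShuffle_map, tensorCoact, LinearMap.lTensor_comp]
    rfl
  have key3 : ∀ (c d : H ⊗[R] H) (m : M.carrier) (n : N.carrier),
      TensorProduct.assoc R H H (M.carrier ⊗[R] N.carrier) ((c * d) ⊗ₜ (m ⊗ₜ n)) =
      (mulShuffle M.carrier N.carrier).lTensor H
        (mulShuffle _ _ ((TensorProduct.assoc R H H M.carrier (c ⊗ₜ m)) ⊗ₜ[R]
          (TensorProduct.assoc R H H N.carrier (d ⊗ₜ n)))) := by
    intro c d m n
    induction c with
    | zero => simp
    | add x x' hx hx' => simp only [map_add, TensorProduct.add_tmul, hx, hx', add_mul]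
    | tmul a a' =>
      induction d with
      | zero => simp
      | add y y' hy hy' =>
        simp only [map_add, TensorProduct.add_tmul, TensorProduct.tmul_add, hy, hy', mul_add]
      | tmul b b' => simp
  have key2 : ∀ (x : H ⊗[R] M.carrier) (y : H ⊗[R] N.carrier),
      TensorProduct.assoc R H H (M.carrier ⊗[R] N.carrier)
        ((Coalgebra.comul (R := R) (A := H)).rTensor (M.carrier ⊗[R] N.carrier)
          (mulShuffle _ _ (x ⊗ₜ[R] y))) =
      (mulShuffle M.carrier N.carrier).lTensor H
        (mulShuffle _ _
          ((TensorProduct.assoc R H H M.carrier ((Coalgebra.comul (R := R)).rTensor _ x)) ⊗ₜ[R]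
          (TensorProduct.assoc R H H N.carrier ((Coalgebra.comul (R := R)).rTensor _ y)))) := by
    intro x y
    induction x with
    | zero => simp
    | add x x' hx hx' => simp only [map_add, TensorProduct.add_tmul, hx, hx']
    | tmul a m =>
      induction y with
      | zero => simp
      | add y y' hy hy' => simp only [map_add, TensorProduct.tmul_add, hy, hy']
      | tmul b n =>
        rw [mulShuffle_tmul, LinearMap.rTensor_tmul, LinearMap.rTensor_tmul,
          LinearMap.rTensor_tmul, Bialgebra.comul_mul, key3]
  have hM := fun m => LinearMap.congr_fun M.coassoc m
  have hN := fun n => LinearMap.congr_fun N.coassoc n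
  simp only [LinearMap.comp_apply, LinearEquiv.coe_coe] at hM hN
  refine TensorProduct.ext' fun m n => ?_
  simp only [LinearMap.comp_apply, LinearEquiv.coe_coe, tensorCoact_tmul]
  rw [key1, key2, hM, hN]

theorem tensorCoact_counit (M N : Comod R H) :
    (TensorProduct.lid R (M.carrier ⊗[R] N.carrier)).toLinearMap ∘ₗ
      (Coalgebra.counit (R := R) (A := H)).rTensor (M.carrier ⊗[R] N.carrier) ∘ₗ
        tensorCoact M N = LinearMap.id := by
  have key : ∀ (x : H ⊗[R] M.carrier) (y : H ⊗[R] N.carrier),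
      TensorProduct.lid R (M.carrier ⊗[R] N.carrier)
        ((Coalgebra.counit (R := R) (A := H)).rTensor (M.carrier ⊗[R] N.carrier)
          (mulShuffle _ _ (x ⊗ₜ[R] y))) =
      (TensorProduct.lid R M.carrier ((Coalgebra.counit (R := R)).rTensor _ x)) ⊗ₜ[R]
        (TensorProduct.lid R N.carrier ((Coalgebra.counit (R := R)).rTensor _ y)) := by
    intro x y
    induction x with
    | zero => simp
    | add x x' hx hx' => simp only [map_add, TensorProduct.add_tmul, hx, hx']
    | tmul a m =>
      induction y with
      | zero => simp
      | add y y' hy hy' => simp only [map_add, TensorProduct.tmul_add, hy, hy']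
      | tmul b n =>
        simp only [mulShuffle_tmul, LinearMap.rTensor_tmul, TensorProduct.lid_tmul,
          Bialgebra.counit_mul]
        rw [← TensorProduct.smul_tmul', TensorProduct.tmul_smul, smul_smul]
  have hM := fun m => LinearMap.congr_fun M.counit_coact m
  have hN := fun n => LinearMap.congr_fun N.counit_coact n
  simp only [LinearMap.comp_apply, LinearEquiv.coe_coe] at hM hN
  refine TensorProduct.ext' fun m n => ?_
  simp only [LinearMap.comp_apply, LinearEquiv.coe_coe, tensorCoact_tmul]
  rw [key, hM, hN]
  rfl

/-- The tensor product of two comodules. -/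
def tensorObj (M N : Comod R H) : Comod R H where
  carrier := M.carrier ⊗ N.carrier
  coact := tensorCoact M N
  coassoc := tensorCoact_coassoc M N
  counit_coact := tensorCoact_counit M N

variable (R H) in
/-- The trivial comodule `R`, with coaction `r ↦ 1 ⊗ r`. -/
def unit : Comod R H where
  carrier := 𝟙_ (ModuleCat.{u} R)
  coact := TensorProduct.mk R H R 1
  coassoc := by
    refine LinearMap.ext fun r => ?_
    change TensorProduct.assoc R H H R ((Coalgebra.comul (R := R)).rTensor R ((1 : H) ⊗ₜ[R] r)) =
      (TensorProduct.mk R H R 1).lTensor H ((1 : H) ⊗ₜ[R] r)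
    simp [Algebra.TensorProduct.one_def]
  counit_coact := by
    refine LinearMap.ext fun r => ?_
    change TensorProduct.lid R R ((Coalgebra.counit (R := R)).rTensor R ((1 : H) ⊗ₜ[R] r)) = r
    simp

/-- The tensor product of two morphisms of comodules. -/
def tensorHom {M M' N N' : Comod R H} (f : M ⟶ M') (g : N ⟶ N') :
    tensorObj M N ⟶ tensorObj M' N' where
  hom := f.hom ⊗ₘ g.hom
  comm := by
    have hf := fun m => LinearMap.congr_fun f.comm m
    have hg := fun n => LinearMap.congr_fun g.comm n
    simp only [LinearMap.comp_apply] at hf hg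
    refine TensorProduct.ext' fun m n => ?_
    change (TensorProduct.map f.hom.hom g.hom.hom).lTensor H
      (mulShuffle _ _ (M.coact m ⊗ₜ[R] N.coact n)) =
        mulShuffle _ _ (M'.coact (f.hom.hom m) ⊗ₜ[R] N'.coact (g.hom.hom n))
    rw [← mulShuffle_map, hf, hg]

theorem associator_comm (M N P : Comod R H) (x : H ⊗[R] M.carrier) (y : H ⊗[R] N.carrier)
    (z : H ⊗[R] P.carrier) :
    (TensorProduct.assoc R M.carrier N.carrier P.carrier).toLinearMap.lTensor H
      (mulShuffle _ _ (mulShuffle _ _ (x ⊗ₜ[R] y) ⊗ₜ[R] z)) =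
    mulShuffle _ _ (x ⊗ₜ[R] mulShuffle _ _ (y ⊗ₜ[R] z)) := by
  induction x with
  | zero => simp
  | add x x' hx hx' => simp only [map_add, TensorProduct.add_tmul, hx, hx']
  | tmul a m =>
    induction y with
    | zero => simp
    | add y y' hy hy' => simp only [map_add, TensorProduct.add_tmul, TensorProduct.tmul_add, hy, hy']
    | tmul b n =>
      induction z with
      | zero => simp
      | add z z' hz hz' => simp only [map_add, TensorProduct.tmul_add, hz, hz']
      | tmul c p => simp [mul_assoc]

theorem braiding_comm (M N : Comod R H) (x : H ⊗[R] M.carrier) (y : H ⊗[R] N.carrier) :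
    (TensorProduct.comm R M.carrier N.carrier).toLinearMap.lTensor H
      (mulShuffle _ _ (x ⊗ₜ[R] y)) = mulShuffle _ _ (y ⊗ₜ[R] x) := by
  induction x with
  | zero => simp
  | add x x' hx hx' => simp only [map_add, TensorProduct.add_tmul, TensorProduct.tmul_add, hx, hx']
  | tmul a m =>
    induction y with
    | zero => simp
    | add y y' hy hy' => simp only [map_add, TensorProduct.add_tmul, TensorProduct.tmul_add, hy, hy']
    | tmul b n => simp [mul_comm]

theorem leftUnitor_comm (M : Comod R H) (r : R) (y : H ⊗[R] M.carrier) :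
    (TensorProduct.lid R M.carrier).toLinearMap.lTensor H
      (mulShuffle R M.carrier (((1 : H) ⊗ₜ[R] r) ⊗ₜ[R] y)) = r • y := by
  induction y with
  | zero => simp
  | add y y' hy hy' => simp only [map_add, TensorProduct.tmul_add, hy, hy', smul_add]
  | tmul b n => simp

theorem rightUnitor_comm (M : Comod R H) (r : R) (x : H ⊗[R] M.carrier) :
    (TensorProduct.rid R M.carrier).toLinearMap.lTensor H
      (mulShuffle M.carrier R (x ⊗ₜ[R] ((1 : H) ⊗ₜ[R] r))) = r • x := by
  induction x with
  | zero => simp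
  | add y y' hy hy' => simp only [map_add, TensorProduct.add_tmul, hy, hy', smul_add]
  | tmul b n => simp

instance : MonoidalCategoryStruct (Comod R H) where
  tensorObj := tensorObj
  tensorHom := tensorHom
  whiskerLeft M _ _ g := tensorHom (𝟙 M) g
  whiskerRight f N := tensorHom f (𝟙 N)
  tensorUnit := unit R H
  associator M N P := mkIso (α_ M.carrier N.carrier P.carrier) (by
    refine TensorProduct.ext_threefold fun m n p => ?_
    exact associator_comm M N P (M.coact m) (N.coact n) (P.coact p))
  leftUnitor M := mkIso (λ_ M.carrier) (by
    refine TensorProduct.ext' fun r m => ?_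
    refine (leftUnitor_comm M (show R from r) (M.coact m)).trans ?_
    exact (map_smul M.coact (show R from r) m).symm)
  rightUnitor M := mkIso (ρ_ M.carrier) (by
    refine TensorProduct.ext' fun m r => ?_
    refine (rightUnitor_comm M (show R from r) (M.coact m)).trans ?_
    exact (map_smul M.coact (show R from r) m).symm)

/-- The forgetful functor to modules preserves the tensor product, the unit and the coherence
isomorphisms on the nose. -/
def inducingData : Monoidal.InducingFunctorData (forget R H) where
  μIso _ _ := Iso.refl _
  εIso := Iso.refl _
  whiskerLeft_eq X _ _ f := by
    change 𝟙 X.carrier ⊗ₘ f.hom = 𝟙 _ ≫ (X.carrier ◁ f.hom) ≫ 𝟙 _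
    simp
  whiskerRight_eq f Y := by
    change f.hom ⊗ₘ 𝟙 Y.carrier = 𝟙 _ ≫ (f.hom ▷ Y.carrier) ≫ 𝟙 _
    simp
  tensorHom_eq f g := by
    change f.hom ⊗ₘ g.hom = 𝟙 _ ≫ (f.hom ⊗ₘ g.hom) ≫ 𝟙 _
    simp
  associator_eq X Y Z := by
    change (α_ X.carrier Y.carrier Z.carrier).hom =
      (𝟙 _ ≫ (𝟙 _ ⊗ₘ 𝟙 _)) ≫ (α_ X.carrier Y.carrier Z.carrier).hom ≫ ((𝟙 _ ⊗ₘ 𝟙 _) ≫ 𝟙 _)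
    simp
  leftUnitor_eq X := by
    change (λ_ X.carrier).hom = (𝟙 _ ≫ (𝟙 _ ⊗ₘ 𝟙 _)) ≫ (λ_ X.carrier).hom
    simp
  rightUnitor_eq X := by
    change (ρ_ X.carrier).hom = (𝟙 _ ≫ (𝟙 _ ⊗ₘ 𝟙 _)) ≫ (ρ_ X.carrier).hom
    simp

/-- The monoidal category of comodules. -/
instance : MonoidalCategory (Comod R H) := Monoidal.induced (forget R H) inducingData

instance : (forget R H).Monoidal := Monoidal.fromInducedMonoidal (forget R H) inducingData

/-- The symmetry of the tensor product of comodules. -/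
def braidingIso (M N : Comod R H) : M ⊗ N ≅ N ⊗ M :=
  mkIso (β_ M.carrier N.carrier) (by
    refine TensorProduct.ext' fun m n => ?_
    exact braiding_comm M N (M.coact m) (N.coact n))

instance : BraidedCategory (Comod R H) :=
  BraidedCategory.ofFaithful (forget R H) braidingIso (fun M N => by
    change 𝟙 _ ≫ (β_ M.carrier N.carrier).hom = (β_ M.carrier N.carrier).hom ≫ 𝟙 _
    rw [Category.comp_id, Category.id_comp])

/-- The symmetric monoidal category of comodules. -/
instance : SymmetricCategory (Comod R H) where
  symmetry M N := hom_ext (SymmetricCategory.symmetry M.carrier N.carrier)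

instance : MonoidalPreadditive (Comod R H) :=
  monoidalPreadditive_of_faithful (forget R H)

instance : MonoidalLinear R (Comod R H) := MonoidalLinear.ofFaithful R (forget R H)

end Comod

end Comodules

/-! ## The Hopf algebra of regular functions on the general linear group -/

section GeneralLinear

variable (R : Type u) [CommRing R] (d : ℕ)

/-- The `R`-algebra `R[x_ij | i, j = 1, …, d]_det` of regular functions on `GL_d`. -/
def GLRing : Type u :=
  Localization.Away (Matrix.mvPolynomialX (Fin d) (Fin d) R).det

namespace GLRing

instance : CommRing (GLRing R d) :=
  inferInstanceAs (CommRing (Localization.Away (Matrix.mvPolynomialX (Fin d) (Fin d) R).det))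

instance : Algebra (MvPolynomial (Fin d × Fin d) R) (GLRing R d) :=
  inferInstanceAs (Algebra (MvPolynomial (Fin d × Fin d) R)
    (Localization.Away (Matrix.mvPolynomialX (Fin d) (Fin d) R).det))

instance : Algebra R (GLRing R d) :=
  inferInstanceAs (Algebra R (Localization.Away (Matrix.mvPolynomialX (Fin d) (Fin d) R).det))

instance : IsScalarTower R (MvPolynomial (Fin d × Fin d) R) (GLRing R d) :=
  inferInstanceAs (IsScalarTower R (MvPolynomial (Fin d × Fin d) R)
    (Localization.Away (Matrix.mvPolynomialX (Fin d) (Fin d) R).det))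

instance : IsLocalization.Away (Matrix.mvPolynomialX (Fin d) (Fin d) R).det (GLRing R d) :=
  inferInstanceAs (IsLocalization.Away (Matrix.mvPolynomialX (Fin d) (Fin d) R).det
    (Localization.Away (Matrix.mvPolynomialX (Fin d) (Fin d) R).det))

/-- The generic invertible matrix `(x_ij)`. -/
def gen : Matrix (Fin d) (Fin d) (GLRing R d) :=
  (algebraMap (MvPolynomial (Fin d × Fin d) R) (GLRing R d)).mapMatrix
    (Matrix.mvPolynomialX (Fin d) (Fin d) R)

theorem isUnit_det_gen : IsUnit (gen R d).det := by
  rw [gen, ← RingHom.map_det]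
  exact IsLocalization.Away.algebraMap_isUnit (S := GLRing R d) (Matrix.mvPolynomialX _ _ R).det

variable {R d}

/-- The algebra map `GLRing R d → B` which sends the generic matrix to the given invertible
matrix. -/
def lift {B : Type u} [CommRing B] [Algebra R B] (A : Matrix (Fin d) (Fin d) B)
    (hA : IsUnit A.det) : GLRing R d →ₐ[R] B :=
  IsLocalization.Away.liftAlgHom (Matrix.mvPolynomialX (Fin d) (Fin d) R).det
    (f := MvPolynomial.aeval fun p : Fin d × Fin d => A p.1 p.2) (by
      rw [AlgHom.map_det, Matrix.mvPolynomialX_mapMatrix_aeval]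
      exact hA)

@[simp]
theorem lift_gen {B : Type u} [CommRing B] [Algebra R B] (A : Matrix (Fin d) (Fin d) B)
    (hA : IsUnit A.det) (i j : Fin d) : lift (R := R) A hA (gen R d i j) = A i j := by
  simp [lift, gen, IsLocalization.Away.liftAlgHom_apply]

@[ext]
theorem algHom_ext {B : Type u} [CommRing B] [Algebra R B] {f g : GLRing R d →ₐ[R] B}
    (h : ∀ i j, f (gen R d i j) = g (gen R d i j)) : f = g := by
  refine IsLocalization.algHom_ext
    (Submonoid.powers (Matrix.mvPolynomialX (Fin d) (Fin d) R).det) ?_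
  refine MvPolynomial.algHom_ext fun p => ?_
  exact h p.1 p.2

/-- The comultiplication, `x_ij ↦ ∑ k, x_ik ⊗ x_kj`. -/
def comulHom : GLRing R d →ₐ[R] GLRing R d ⊗[R] GLRing R d :=
  lift ((Algebra.TensorProduct.includeLeft (R := R) (S := R) (A := GLRing R d)
        (B := GLRing R d)).mapMatrix (gen R d) *
      (Algebra.TensorProduct.includeRight (R := R) (A := GLRing R d)
        (B := GLRing R d)).mapMatrix (gen R d)) (by
    rw [Matrix.det_mul, ← AlgHom.map_det, ← AlgHom.map_det]
    exact ((isUnit_det_gen R d).map _).mul ((isUnit_det_gen R d).map _))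

/-- The counit, `x_ij ↦ δ_ij`. -/
def counitHom : GLRing R d →ₐ[R] R := lift 1 (by simp)

/-- The antipode, which sends the generic matrix to its inverse. -/
def antipodeHom : GLRing R d →ₐ[R] GLRing R d :=
  lift (gen R d)⁻¹ (Matrix.isUnit_nonsing_inv_det _ (isUnit_det_gen R d))

theorem comulHom_gen (i j : Fin d) :
    comulHom (gen R d i j) = ∑ k, gen R d i k ⊗ₜ[R] gen R d k j := by
  simp [comulHom, Matrix.mul_apply]

theorem counitHom_gen (i j : Fin d) :
    counitHom (gen R d i j) = (1 : Matrix (Fin d) (Fin d) R) i j := by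
  simp [counitHom]

theorem antipodeHom_gen (i j : Fin d) : antipodeHom (gen R d i j) = (gen R d)⁻¹ i j := by
  simp [antipodeHom]

instance : Bialgebra R (GLRing R d) :=
  Bialgebra.ofAlgHom comulHom counitHom
    (by
      refine algHom_ext fun i j => ?_
      simp only [AlgHom.comp_apply, comulHom_gen, map_sum, Algebra.TensorProduct.map_tmul,
        TensorProduct.sum_tmul, TensorProduct.tmul_sum, AlgHom.id_apply]
      rw [Finset.sum_comm]
      rfl)
    (by
      refine algHom_ext fun i j => ?_
      simp only [AlgHom.comp_apply, comulHom_gen, map_sum, Algebra.TensorProduct.map_tmul,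
        counitHom_gen, AlgHom.id_apply]
      simp [Matrix.one_apply, TensorProduct.ite_tmul])
    (by
      refine algHom_ext fun i j => ?_
      simp only [AlgHom.comp_apply, comulHom_gen, map_sum, Algebra.TensorProduct.map_tmul,
        counitHom_gen, AlgHom.id_apply]
      simp [Matrix.one_apply, TensorProduct.tmul_ite])

theorem comul_gen (i j : Fin d) :
    Coalgebra.comul (R := R) (gen R d i j) = ∑ k, gen R d i k ⊗ₜ[R] gen R d k j :=
  comulHom_gen i j

theorem counit_gen (i j : Fin d) :
    Coalgebra.counit (R := R) (gen R d i j) = (1 : Matrix (Fin d) (Fin d) R) i j :=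
  counitHom_gen i j

/-- The Hopf algebra `H_d` of regular functions on `GL_d`. -/
instance : HopfAlgebra R (GLRing R d) :=
  HopfAlgebra.ofAlgHom antipodeHom
    (by
      refine algHom_ext fun i j => ?_
      simp only [AlgHom.comp_apply, Bialgebra.comulAlgHom_apply, Bialgebra.counitAlgHom_apply,
        comul_gen, counit_gen, map_sum]
      change ∑ k, antipodeHom (gen R d i k) * gen R d k j = _
      simp only [antipodeHom_gen]
      rw [← Matrix.mul_apply, Matrix.nonsing_inv_mul _ (isUnit_det_gen R d)]
      by_cases h : i = j <;> simp [Matrix.one_apply, h])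
    (by
      refine algHom_ext fun i j => ?_
      simp only [AlgHom.comp_apply, Bialgebra.comulAlgHom_apply, Bialgebra.counitAlgHom_apply,
        comul_gen, counit_gen, map_sum, Algebra.TensorProduct.lift_tmul, antipodeHom_gen,
        AlgHom.id_apply]
      rw [← Matrix.mul_apply, Matrix.mul_nonsing_inv _ (isUnit_det_gen R d)]
      by_cases h : i = j <;> simp [Matrix.one_apply, h])

end GLRing

/-- The category `Rep(GL_d) = Comod(H_d)` of algebraic representations of `GL_d` over `R`. -/
abbrev Rep : Type (u + 1) := Comod R (GLRing R d)

/-- The coaction of the standard representation, `e_i ↦ ∑ j, x_ij ⊗ e_j`. -/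
def stdCoact : (Fin d → R) →ₗ[R] GLRing R d ⊗[R] (Fin d → R) :=
  (Pi.basisFun R (Fin d)).constr R fun i =>
    ∑ j, GLRing.gen R d i j ⊗ₜ[R] Pi.basisFun R (Fin d) j

@[simp]
theorem stdCoact_basis (i : Fin d) : stdCoact R d (Pi.basisFun R (Fin d) i) =
    ∑ j, GLRing.gen R d i j ⊗ₜ[R] Pi.basisFun R (Fin d) j := by
  simp only [stdCoact, Module.Basis.constr_basis]

/-- The standard representation `R^d` of `GL_d`. -/
def std : Rep R d where
  carrier := ModuleCat.of R (Fin d → R)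
  coact := stdCoact R d
  coassoc := by
    refine (Pi.basisFun R (Fin d)).ext fun i => ?_
    change TensorProduct.assoc R _ _ _ ((Coalgebra.comul (R := R)).rTensor (Fin d → R)
      (stdCoact R d (Pi.basisFun R (Fin d) i))) =
        (stdCoact R d).lTensor _ (stdCoact R d (Pi.basisFun R (Fin d) i))
    simp only [stdCoact_basis, map_sum, LinearMap.rTensor_tmul, LinearMap.lTensor_tmul,
      GLRing.comul_gen, TensorProduct.sum_tmul, TensorProduct.tmul_sum, TensorProduct.assoc_tmul]
    rw [Finset.sum_comm]
  counit_coact := by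
    refine (Pi.basisFun R (Fin d)).ext fun i => ?_
    change TensorProduct.lid R _ ((Coalgebra.counit (R := R)).rTensor (Fin d → R)
      (stdCoact R d (Pi.basisFun R (Fin d) i))) = Pi.basisFun R (Fin d) i
    simp only [stdCoact_basis, map_sum, LinearMap.rTensor_tmul, GLRing.counit_gen,
      TensorProduct.lid_tmul, Matrix.one_apply, ite_smul, one_smul, zero_smul]
    simp

end GeneralLinear

/-! ## Tensor functors -/

section TensorFunctors

variable (R : Type u) [CommRing R]
  (A : Type*) [Category* A] [Preadditive A] [Linear R A] [MonoidalCategory A] [BraidedCategory A]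
  (C : Type*) [Category* C] [Preadditive C] [Linear R C] [MonoidalCategory C] [BraidedCategory C]

/-- A tensor functor: an `R`-linear symmetric strong monoidal functor which has a right
adjoint. -/
structure TensorFunctor where
  /-- the underlying functor -/
  functor : A ⥤ C
  [braided : functor.Braided]
  [additive : functor.Additive]
  [linear : functor.Linear R]
  [isLeftAdjoint : functor.IsLeftAdjoint]

namespace TensorFunctor

attribute [instance] braided additive linear isLeftAdjoint

variable {R A C}

/-- A morphism of tensor functors: a symmetric monoidal natural transformation. -/
@[ext]
structure Hom (F G : TensorFunctor R A C) where
  /-- the underlying natural transformation -/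
  hom : F.functor ⟶ G.functor
  [isMonoidal : NatTrans.IsMonoidal hom]

attribute [instance] Hom.isMonoidal

/-- The category of tensor functors and symmetric monoidal natural transformations. -/
instance : Category (TensorFunctor R A C) where
  Hom := Hom
  id F := ⟨𝟙 F.functor⟩
  comp f g := ⟨f.hom ≫ g.hom⟩

/-- Evaluation of tensor functors and of their morphisms at the object `X`. -/
def eval (X : A) : TensorFunctor R A C ⥤ C where
  obj F := F.functor.obj X
  map f := f.hom.app X

end TensorFunctor

end TensorFunctors

/-! ## Locally free objects -/

section LocallyFree

variable {C : Type w} [Category.{u} C] [MonoidalCategory C]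

/-- A commutative algebra `B` is faithfully flat if `B ⊗ -` preserves all the finite limits that
exist and reflects isomorphisms. -/
structure IsFaithfullyFlat (B : C) [MonObj B] : Prop where
  preservesFiniteLimits : PreservesFiniteLimits (tensorLeft B)
  reflectsIsomorphisms : (tensorLeft B).ReflectsIsomorphisms

/-- The free `B`-module `B ⊗ M` on an object `M`. -/
def freeModule (B : C) [MonObj B] (M : C) : Mod C B where
  X := B ⊗ M
  mod :=
    { smul := (α_ B B M).inv ≫ μ[B] ▷ M
      one_smul := by
        change η[B] ▷ (B ⊗ M) ≫ (α_ B B M).inv ≫ μ[B] ▷ M = (λ_ (B ⊗ M)).hom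
        rw [associator_inv_naturality_left_assoc, ← comp_whiskerRight, MonObj.one_mul]
        simp
      mul_smul := by
        change μ[B] ▷ (B ⊗ M) ≫ (α_ B B M).inv ≫ μ[B] ▷ M =
          (α_ B B (B ⊗ M)).hom ≫ B ◁ ((α_ B B M).inv ≫ μ[B] ▷ M) ≫ (α_ B B M).inv ≫ μ[B] ▷ M
        rw [associator_inv_naturality_left_assoc, ← comp_whiskerRight, MonObj.mul_assoc]
        simp }

variable [Preadditive C] [HasColimits C]

/-- A cocomplete preadditive category has finite direct sums. -/
instance : HasFiniteBiproducts C := HasFiniteBiproducts.of_hasFiniteCoproducts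

/-- The direct sum `B^d` of `d` copies of `B`, with the componentwise `B`-action. -/
def powModule (B : C) [MonObj B] (d : ℕ) : Mod C B where
  X := ⨁ fun _ : Fin d => B
  mod :=
    { smul := biproduct.lift fun i => B ◁ biproduct.π (fun _ : Fin d => B) i ≫ μ[B]
      one_smul := by
        change η[B] ▷ (⨁ fun _ : Fin d => B) ≫
          biproduct.lift (fun i => B ◁ biproduct.π (fun _ : Fin d => B) i ≫ μ[B]) = (λ_ _).hom
        refine biproduct.hom_ext _ _ fun i => ?_
        rw [Category.assoc, biproduct.lift_π, ← whisker_exchange_assoc, MonObj.one_mul,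
          leftUnitor_naturality]
      mul_smul := by
        change μ[B] ▷ (⨁ fun _ : Fin d => B) ≫
            biproduct.lift (fun i => B ◁ biproduct.π (fun _ : Fin d => B) i ≫ μ[B]) =
          (α_ _ _ _).hom ≫
            B ◁ biproduct.lift (fun i => B ◁ biproduct.π (fun _ : Fin d => B) i ≫ μ[B]) ≫
            biproduct.lift (fun i => B ◁ biproduct.π (fun _ : Fin d => B) i ≫ μ[B])
        refine biproduct.hom_ext _ _ fun i => ?_
        simp only [Category.assoc, biproduct.lift_π]
        rw [← whisker_exchange_assoc, MonObj.mul_assoc, ← whiskerLeft_comp_assoc,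
          biproduct.lift_π]
        simp }

variable [BraidedCategory C]

/-- An object `M` is locally free of rank `d` if it has a dual and there is a faithfully flat
commutative algebra `B` such that `B ⊗ M ≅ B^d` as `B`-modules. -/
structure IsLocallyFree (d : ℕ) (M : C) : Prop where
  hasDual : ∃ N : C, Nonempty (ExactPairing M N)
  locallyTrivial : ∃ B : CommMon C, IsFaithfullyFlat B.X ∧
    Nonempty (freeModule B.X M ≅ powModule B.X d)

variable (C) in
/-- The groupoid of locally free objects of rank `d` and isomorphisms between them. -/
abbrev LFIso (d : ℕ) : Type w :=
  Core (ObjectProperty.FullSubcategory (fun M : C => IsLocallyFree d M))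

variable (C) in
/-- The inclusion of the groupoid of locally free objects of rank `d` into `C`. -/
abbrev LFIso.incl (d : ℕ) : LFIso C d ⥤ C :=
  Core.inclusion _ ⋙ ObjectProperty.ι (fun M : C => IsLocallyFree d M)

end LocallyFree

end

end RepGL

/-! Let `H` be the regular comodule, a commutative algebra in `Rep(GL_d)`, and let `W₀` be the
module underlying a representation `W`, with trivial coaction. The coaction `W ⟶ H ⊗ W₀` is a
comodule map, natural and monoidal in `W`, and by the antipode its `H`-linear extension `H ⊗ W ⟶ H ⊗
W₀` is invertible. On trivial comodules a tensor functor `F` agrees with the only cocontinuous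
monoidal functor `free` from modules to `C`. Hence `F W` and `free W₀` become isomorphic over the
algebra `F H`. Morphisms of free `A`-modules are handled as Kleisli morphisms `X ⟶ A ⊗ Y`, and
`KlIso` says that such a morphism is invertible over `A`.

Two facts about `F H` carry the proof. It is faithfully flat (`isFaithfullyFlat_map_regular`): `H`
is a union of subcomodules that are finite free over `R`, hence dualizable, and contain `1`. The
duals of these points present the unit object as a coequalizer, `F` preserves all of this, and
exactness of filtered colimits passes the resulting descent property to the union. Secondly, algebra
maps `F H ⟶ A` are the same as trivializations of `F(std)` over `A` (`exists_glTwist`,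
`glTwist_ext`). Through the right adjoint of `F` this is the universal property of `R[x_ij]_det`.

It follows that `F(std)` is locally free, with `F H` as trivializing algebra. A morphism `α` is
invertible at the standard representation because it matches two trivializations over `G H`. It is
determined by that component because `W` embeds in `H ⊗ W₀` (`natTrans_ext`).

Conversely, let `M` be trivialized over a faithfully flat `B`. The two trivializations over `B ⊗ B`
differ by a point of `GL_d`, which acts on the whole functor `B ⊗ free(W₀)` by a monoidal
transformation. The descent conditions are identities between points of `GL_d`, so they can be
tested on the standard representation, where the transition matrix is a coboundary. The equalizer of
the two resulting maps is a tensor functor `E` with `E(std) ≅ M`: it is strong monoidal because this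
can be tested over `B`, and it has a right adjoint because `B ⊗ -` is comonadic. The same comparison
gives, for each tensor functor `F` and each isomorphism `F(std) ≅ M`, an isomorphism `F ≅ E`
inducing it (`exists_tensorFunctor`), and this yields essential surjectivity and fullness. -/

set_option linter.unusedSectionVars false

namespace RepGL

noncomputable section

open Functor.LaxMonoidal

/-! ### The free module monad `A ⊗ -` as a lax symmetric monoidal monad. -/

section FreeModules

universe v₁ u₁

variable {C : Type u₁} [Category.{v₁} C] [MonoidalCategory C]

section Braided

variable [BraidedCategory C]

/-- The structure map `(A ⊗ X) ⊗ (A ⊗ Y) ⟶ A ⊗ (X ⊗ Y)` of the lax monoidal functor `A ⊗ -`. -/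
def freeμ (A : C) [MonObj A] (X Y : C) : (A ⊗ X) ⊗ (A ⊗ Y) ⟶ A ⊗ (X ⊗ Y) :=
  tensorμ A X A Y ≫ (μ[A] ⊗ₘ 𝟙 (X ⊗ Y))

theorem freeμ_natural (A : C) [MonObj A] {X X' Y Y' : C} (f : X ⟶ X') (g : Y ⟶ Y') :
    (A ◁ f ⊗ₘ A ◁ g) ≫ freeμ A X' Y' = freeμ A X Y ≫ A ◁ (f ⊗ₘ g) := by
  rw [freeμ, ← id_tensorHom, ← id_tensorHom, tensorμ_natural_assoc]
  simp only [freeμ, ← id_tensorHom, Category.assoc, tensorHom_comp_tensorHom, Category.id_comp,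
    Category.comp_id, id_tensorHom_id]

theorem freeμ_hom {A A' : C} [MonObj A] [MonObj A'] (h : A ⟶ A') [IsMonHom h] (X Y : C) :
    freeμ A X Y ≫ h ▷ (X ⊗ Y) = (h ▷ X ⊗ₘ h ▷ Y) ≫ freeμ A' X Y := by
  rw [freeμ, freeμ, ← tensorHom_id, ← tensorHom_id, ← tensorHom_id, tensorμ_natural_assoc]
  simp only [Category.assoc, tensorHom_comp_tensorHom, IsMonHom.mul_hom,
    id_tensorHom_id, Category.comp_id]

/-- Coherence of the shuffle `tensorμ` together with associativity and unitality of `A`.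
Commutativity of `A` enters only when the action and the braiding have to be compatible with this
structure. -/
instance freeLaxMonoidal (A : C) [MonObj A] : (tensorLeft A).LaxMonoidal := by
  refine ⟨(λ_ (𝟙_ C)).inv ≫ η[A] ▷ 𝟙_ C, fun X Y => freeμ A X Y, ?_, ?_, ?_, ?_, ?_⟩
  · intro X Y f Z
    have := freeμ_natural A f (𝟙 Z)
    rw [whiskerLeft_id, tensorHom_id, tensorHom_id] at this
    exact this
  · intro X Y Z f
    have := freeμ_natural A (𝟙 Z) f
    rw [whiskerLeft_id, id_tensorHom, id_tensorHom] at this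
    exact this
  · intro X Y Z
    change (freeμ A X Y ▷ (A ⊗ Z)) ≫ freeμ A (X ⊗ Y) Z ≫ A ◁ (α_ X Y Z).hom =
      (α_ (A ⊗ X) (A ⊗ Y) (A ⊗ Z)).hom ≫ ((A ⊗ X) ◁ freeμ A Y Z) ≫ freeμ A X (Y ⊗ Z)
    simp only [freeμ, comp_whiskerRight, MonoidalCategory.whiskerLeft_comp, Category.assoc]
    rw [tensorμ_natural_left_assoc, tensorμ_natural_right_assoc, ← tensor_associativity_assoc]
    simp only [← id_tensorHom, ← tensorHom_id, tensorHom_comp_tensorHom, id_tensorHom_id,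
      Category.id_comp, Category.comp_id]
    simp only [tensorHom_id, id_tensorHom, MonObj.mul_assoc]
  · intro X
    change (λ_ (A ⊗ X)).hom = ((λ_ (𝟙_ C)).inv ≫ η[A] ▷ 𝟙_ C) ▷ (A ⊗ X) ≫ freeμ A (𝟙_ C) X ≫
      A ◁ (λ_ X).hom
    rw [tensor_left_unitality, freeμ, comp_whiskerRight, ← tensorHom_id (η[A]), Category.assoc,
      Category.assoc, tensorμ_natural_left_assoc]
    simp only [← id_tensorHom, tensorHom_comp_tensorHom, Category.id_comp, Category.comp_id,
      MonObj.one_mul, id_whiskerRight]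
  · intro X
    change (ρ_ (A ⊗ X)).hom = (A ⊗ X) ◁ ((λ_ (𝟙_ C)).inv ≫ η[A] ▷ 𝟙_ C) ≫ freeμ A X (𝟙_ C) ≫
      A ◁ (ρ_ X).hom
    rw [tensor_right_unitality, freeμ, MonoidalCategory.whiskerLeft_comp, ← tensorHom_id (η[A]),
      Category.assoc, Category.assoc, tensorμ_natural_right_assoc]
    simp only [← id_tensorHom, tensorHom_comp_tensorHom, Category.id_comp, Category.comp_id]
    simp only [id_tensorHom, MonObj.mul_one, whiskerLeft_id, Category.id_comp]

theorem free_ε (A : C) [MonObj A] :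
    ε (tensorLeft A) = (λ_ (𝟙_ C)).inv ≫ η[A] ▷ 𝟙_ C := rfl

/-- A morphism of algebras `A ⟶ A'` induces a morphism `A ⊗ - ⟶ A' ⊗ -`. -/
def freeMap {A A' : C} (h : A ⟶ A') : tensorLeft A ⟶ tensorLeft A' where
  app X := h ▷ X
  naturality _ _ f := by simp [whisker_exchange]

instance {A A' : C} [MonObj A] [MonObj A'] (h : A ⟶ A') [IsMonHom h] :
    NatTrans.IsMonoidal (freeMap h) where
  unit := by
    change ((λ_ (𝟙_ C)).inv ≫ η[A] ▷ 𝟙_ C) ≫ h ▷ 𝟙_ C = (λ_ (𝟙_ C)).inv ≫ η[A'] ▷ 𝟙_ C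
    rw [Category.assoc, ← comp_whiskerRight, IsMonHom.one_hom]
  tensor X Y := freeμ_hom h X Y

/-- The unit `X ⟶ A ⊗ X`. -/
def freeUnitApp (A : C) [MonObj A] (X : C) : X ⟶ A ⊗ X := (λ_ X).inv ≫ η[A] ▷ X

/-- The action `A ⊗ (A ⊗ X) ⟶ A ⊗ X`. -/
def freeActApp (A : C) [MonObj A] (X : C) : A ⊗ A ⊗ X ⟶ A ⊗ X := (α_ A A X).inv ≫ μ[A] ▷ X

/-- The multiplication of the monad `A ⊗ -`. -/
def freeAct (A : C) [MonObj A] : tensorLeft A ⋙ tensorLeft A ⟶ tensorLeft A where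
  app X := freeActApp A X
  naturality X Y f := by
    change A ◁ A ◁ f ≫ (α_ A A Y).inv ≫ μ[A] ▷ Y = ((α_ A A X).inv ≫ μ[A] ▷ X) ≫ A ◁ f
    rw [associator_inv_naturality_right_assoc, whisker_exchange, Category.assoc]

theorem freeUnitApp_tensor (A : C) [MonObj A] (X Y : C) :
    (freeUnitApp A X ⊗ₘ freeUnitApp A Y) ≫ freeμ A X Y = freeUnitApp A (X ⊗ Y) := by
  have h := (leftUnitor_monoidal X Y)
  rw [freeUnitApp, freeUnitApp, freeμ, ← tensorHom_id, ← tensorHom_id,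
    ← tensorHom_comp_tensorHom, Category.assoc, tensorμ_natural_assoc]
  have h2 : ((λ_ X).inv ⊗ₘ (λ_ Y).inv) ≫ tensorμ (𝟙_ C) X (𝟙_ C) Y =
      (λ_ (X ⊗ Y)).inv ≫ (λ_ (𝟙_ C)).inv ▷ (X ⊗ Y) := by
    rw [← cancel_mono ((λ_ (𝟙_ C)).hom ▷ (X ⊗ Y) ≫ (λ_ (X ⊗ Y)).hom), Category.assoc, ← h]
    simp
  rw [reassoc_of% h2]
  simp only [freeUnitApp, ← tensorHom_id, tensorHom_comp_tensorHom, id_tensorHom_id,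
    Category.comp_id, MonObj.one_mul_hom, Iso.inv_hom_id_assoc]

theorem mul_mul_mul_comm_tensor (A : C) [MonObj A] [IsCommMonObj A] :
    tensorμ A A A A ≫ (μ[A] ⊗ₘ μ[A]) ≫ μ[A] = (μ[A] ⊗ₘ μ[A]) ≫ μ[A] :=
  MonObj.mul_mul_mul_comm A

/-- This is the place where commutativity matters: the multiplication `A ⊗ A ⟶ A` is an algebra map
only for commutative `A`. It makes the multiplication of the monad a monoidal transformation, so
that Kleisli morphisms can be tensored. -/
theorem freeActApp_tensor (A : C) [MonObj A] [IsCommMonObj A] (X Y : C) :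
    freeμ A (A ⊗ X) (A ⊗ Y) ≫ A ◁ freeμ A X Y ≫ freeActApp A (X ⊗ Y) =
      (freeActApp A X ⊗ₘ freeActApp A Y) ≫ freeμ A X Y := by
  have h := associator_monoidal A A X A A Y
  -- All shuffling is collected here; the four copies of `A` end up adjacent, permuted by one
  -- `tensorμ A A A A`, which commutativity then absorbs into the product.
  have h2 : tensorμ A (A ⊗ X) A (A ⊗ Y) ≫ (A ⊗ A) ◁ tensorμ A X A Y =
      ((α_ A A X).inv ⊗ₘ (α_ A A Y).inv) ≫ tensorμ (A ⊗ A) X (A ⊗ A) Y ≫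
        tensorμ A A A A ▷ (X ⊗ Y) ≫ (α_ (A ⊗ A) (A ⊗ A) (X ⊗ Y)).hom := by
    rw [h, tensorHom_comp_tensorHom_assoc]
    simp
  have h3 : freeμ A (A ⊗ X) (A ⊗ Y) ≫ A ◁ freeμ A X Y =
      (tensorμ A (A ⊗ X) A (A ⊗ Y) ≫ (A ⊗ A) ◁ tensorμ A X A Y) ≫
        (μ[A] ⊗ₘ (μ[A] ⊗ₘ 𝟙 (X ⊗ Y))) := by
    simp only [freeμ, Category.assoc, ← id_tensorHom, tensorHom_comp_tensorHom, Category.id_comp,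
      Category.comp_id]
  rw [← Category.assoc, h3, h2, freeActApp, freeActApp, freeActApp, ← tensorHom_comp_tensorHom]
  simp only [Category.assoc, freeμ]
  rw [← tensorHom_id, ← tensorHom_id, ← tensorHom_id, ← tensorHom_id, tensorμ_natural_assoc,
    associator_inv_naturality_assoc, Iso.hom_inv_id_assoc]
  simp only [tensorHom_comp_tensorHom, Category.comp_id, id_tensorHom_id]
  rw [mul_mul_mul_comm_tensor]

instance (A : C) [MonObj A] [IsCommMonObj A] : NatTrans.IsMonoidal (freeAct A) where
  unit := by
    change (ε (tensorLeft A) ≫ A ◁ ε (tensorLeft A)) ≫ freeActApp A (𝟙_ C) = ε (tensorLeft A)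
    simp only [free_ε, freeActApp, Category.assoc, MonoidalCategory.whiskerLeft_comp]
    rw [associator_inv_naturality_middle_assoc, ← comp_whiskerRight, MonObj.mul_one]
    simp
  tensor X Y := by
    change (freeμ A (A ⊗ X) (A ⊗ Y) ≫ A ◁ freeμ A X Y) ≫ freeActApp A (X ⊗ Y) =
      (freeActApp A X ⊗ₘ freeActApp A Y) ≫ freeμ A X Y
    rw [← freeActApp_tensor, Category.assoc]

end Braided

section Symmetric

variable [SymmetricCategory C]

/-- Here a symmetry is used and not merely a braiding: the crossing of `Y` and `A` inside the
shuffle has to cancel against its opposite. -/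
theorem braiding_tensorμ (A X B Y : C) :
    (β_ (A ⊗ X) (B ⊗ Y)).hom ≫ tensorμ B Y A X =
      tensorμ A X B Y ≫ ((β_ A B).hom ⊗ₘ (β_ X Y).hom) := by
  simp [tensorμ, SymmetricCategory.braiding_swap_eq_inv_braiding Y A,
    MonoidalCategory.tensorHom_def]

instance (A : C) [MonObj A] [IsCommMonObj A] : (tensorLeft A).LaxBraided where
  braided X Y := by
    change freeμ A X Y ≫ A ◁ (β_ X Y).hom = (β_ (A ⊗ X) (A ⊗ Y)).hom ≫ freeμ A Y X
    simp only [freeμ, reassoc_of% braiding_tensorμ A X A Y, Category.assoc, ← id_tensorHom,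
      tensorHom_comp_tensorHom, IsCommMonObj.mul_comm, Category.id_comp, Category.comp_id]

end Symmetric

end FreeModules

/-! ### Kleisli morphisms and isomorphisms over an algebra. -/

section Kleisli

universe v₁ u₁

variable {C : Type u₁} [Category.{v₁} C] [MonoidalCategory C] (A : C) [MonObj A]

theorem freeUnitApp_naturality {X Y : C} (f : X ⟶ Y) :
    f ≫ freeUnitApp A Y = freeUnitApp A X ≫ A ◁ f := by
  rw [freeUnitApp, freeUnitApp, leftUnitor_inv_naturality_assoc, whisker_exchange, Category.assoc]

theorem freeActApp_naturality {X Y : C} (f : X ⟶ Y) :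
    A ◁ A ◁ f ≫ freeActApp A Y = freeActApp A X ≫ A ◁ f := by
  rw [freeActApp, freeActApp, associator_inv_naturality_right_assoc, whisker_exchange,
    Category.assoc]

theorem freeUnitApp_freeActApp (X : C) :
    freeUnitApp A (A ⊗ X) ≫ freeActApp A X = 𝟙 _ := by
  simp only [freeUnitApp, freeActApp, Category.assoc]
  rw [associator_inv_naturality_left_assoc, ← comp_whiskerRight, MonObj.one_mul]
  simp

theorem whiskerLeft_freeUnitApp_freeActApp (X : C) :
    A ◁ freeUnitApp A X ≫ freeActApp A X = 𝟙 _ := by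
  simp only [freeUnitApp, freeActApp, Category.assoc, MonoidalCategory.whiskerLeft_comp]
  rw [associator_inv_naturality_middle_assoc, ← comp_whiskerRight, MonObj.mul_one]
  simp

theorem freeActApp_assoc (X : C) :
    freeActApp A (A ⊗ X) ≫ freeActApp A X = A ◁ freeActApp A X ≫ freeActApp A X := by
  simp only [freeActApp, MonoidalCategory.whiskerLeft_comp, Category.assoc]
  rw [associator_inv_naturality_left_assoc, ← comp_whiskerRight, MonObj.mul_assoc,
    associator_inv_naturality_middle_assoc]
  simp

/-- The composition of `f : X ⟶ A ⊗ Y` and `g : Y ⟶ A ⊗ Z` in the Kleisli category of the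
monad `A ⊗ -`. -/
def kl {X Y Z : C} (f : X ⟶ A ⊗ Y) (g : Y ⟶ A ⊗ Z) : X ⟶ A ⊗ Z :=
  f ≫ A ◁ g ≫ freeActApp A Z

variable {A}

theorem comp_kl {W X Y Z : C} (a : W ⟶ X) (f : X ⟶ A ⊗ Y) (g : Y ⟶ A ⊗ Z) :
    kl A (a ≫ f) g = a ≫ kl A f g := by simp [kl]

theorem kl_comp {X Y Z Z' : C} (f : X ⟶ A ⊗ Y) (g : Y ⟶ A ⊗ Z) (c : Z ⟶ Z') :
    kl A f (g ≫ A ◁ c) = kl A f g ≫ A ◁ c := by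
  simp only [kl, MonoidalCategory.whiskerLeft_comp, Category.assoc, freeActApp_naturality]

theorem kl_comp_mid {X Y Y' Z : C} (f : X ⟶ A ⊗ Y) (b : Y ⟶ Y') (g : Y' ⟶ A ⊗ Z) :
    kl A (f ≫ A ◁ b) g = kl A f (b ≫ g) := by simp [kl]

theorem unit_kl {Y Z : C} (g : Y ⟶ A ⊗ Z) : kl A (freeUnitApp A Y) g = g := by
  rw [kl, ← reassoc_of% freeUnitApp_naturality, freeUnitApp_freeActApp, Category.comp_id]

theorem comp_unit_kl {X Y Z : C} (a : X ⟶ Y) (g : Y ⟶ A ⊗ Z) :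
    kl A (a ≫ freeUnitApp A Y) g = a ≫ g := by
  rw [comp_kl, unit_kl]

theorem kl_unit {X Y : C} (f : X ⟶ A ⊗ Y) : kl A f (freeUnitApp A Y) = f := by
  rw [kl, whiskerLeft_freeUnitApp_freeActApp, Category.comp_id]

theorem kl_comp_unit {X Y Z : C} (f : X ⟶ A ⊗ Y) (b : Y ⟶ Z) :
    kl A f (b ≫ freeUnitApp A Z) = f ≫ A ◁ b := by
  rw [freeUnitApp_naturality, kl_comp, kl_unit]

theorem kl_assoc {W X Y Z : C} (f : W ⟶ A ⊗ X) (g : X ⟶ A ⊗ Y) (h : Y ⟶ A ⊗ Z) :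
    kl A (kl A f g) h = kl A f (kl A g h) := by
  simp only [kl, Category.assoc, MonoidalCategory.whiskerLeft_comp]
  rw [← reassoc_of% freeActApp_naturality, freeActApp_assoc]

theorem freeActApp_hom {A' : C} [MonObj A'] (h : A ⟶ A') [IsMonHom h] (X : C) :
    freeActApp A X ≫ h ▷ X = A ◁ (h ▷ X) ≫ h ▷ _ ≫ freeActApp A' X := by
  simp only [freeActApp, Category.assoc]
  rw [← comp_whiskerRight, IsMonHom.mul_hom, MonoidalCategory.tensorHom_def', comp_whiskerRight,
    comp_whiskerRight, associator_inv_naturality_left_assoc,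
    associator_inv_naturality_middle_assoc, Category.assoc]

theorem freeUnitApp_hom {A' : C} [MonObj A'] (h : A ⟶ A') [IsMonHom h] (X : C) :
    freeUnitApp A X ≫ h ▷ X = freeUnitApp A' X := by
  simp only [freeUnitApp, Category.assoc, ← comp_whiskerRight, IsMonHom.one_hom]

theorem kl_hom {A' : C} [MonObj A'] (h : A ⟶ A') [IsMonHom h] {X Y Z : C}
    (f : X ⟶ A ⊗ Y) (g : Y ⟶ A ⊗ Z) :
    kl A f g ≫ h ▷ Z = kl A' (f ≫ h ▷ Y) (g ≫ h ▷ Z) := by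
  simp only [kl, Category.assoc, freeActApp_hom]
  rw [whisker_exchange_assoc, MonoidalCategory.whiskerLeft_comp_assoc, whisker_exchange_assoc]

/-- A morphism `f : X ⟶ A ⊗ Y` is a Kleisli isomorphism if it is an isomorphism in the Kleisli
category of the monad `A ⊗ -`. -/
def KlIso {X Y : C} (f : X ⟶ A ⊗ Y) : Prop :=
  ∃ g : Y ⟶ A ⊗ X, kl A f g = freeUnitApp A X ∧ kl A g f = freeUnitApp A Y

theorem KlIso.of_iso {X Y : C} (a : X ⟶ Y) [IsIso a] : KlIso (a ≫ freeUnitApp A Y) :=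
  ⟨inv a ≫ freeUnitApp A X, by simp [comp_unit_kl], by simp [comp_unit_kl]⟩

theorem KlIso.kl {X Y Z : C} {f : X ⟶ A ⊗ Y} {g : Y ⟶ A ⊗ Z} (hf : KlIso f) (hg : KlIso g) :
    KlIso (kl A f g) := by
  obtain ⟨f', h1, h2⟩ := hf
  obtain ⟨g', h3, h4⟩ := hg
  refine ⟨RepGL.kl A g' f', ?_, ?_⟩
  · rw [kl_assoc, ← kl_assoc g, h3, unit_kl, h1]
  · rw [kl_assoc, ← kl_assoc f', h2, unit_kl, h4]

/-- Two out of three for Kleisli isomorphisms; the inverse of `g` cancels it on the right. -/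
theorem KlIso.of_kl {X Y Z : C} {f : X ⟶ A ⊗ Y} {g : Y ⟶ A ⊗ Z} (hg : KlIso g)
    (h : KlIso (RepGL.kl A f g)) : KlIso f := by
  have hg' := hg
  obtain ⟨g', h3, h4⟩ := hg
  have := KlIso.kl h ⟨g, h4, h3⟩
  rwa [kl_assoc, h3, kl_unit] at this

theorem KlIso.of_comp {X Y Z : C} {a : X ⟶ Y} {g : Y ⟶ A ⊗ Z} (hg : KlIso g)
    (h : KlIso (a ≫ g)) : KlIso (a ≫ freeUnitApp A Y) :=
  KlIso.of_kl hg (by rwa [comp_unit_kl])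

theorem KlIso.iso_comp {X Y Z : C} (a : X ⟶ Y) [IsIso a] {g : Y ⟶ A ⊗ Z} (hg : KlIso g) :
    KlIso (a ≫ g) := by
  have := KlIso.kl (KlIso.of_iso (A := A) a) hg
  rwa [comp_unit_kl] at this

theorem KlIso.comp_iso {X Y Z : C} {f : X ⟶ A ⊗ Y} (hf : KlIso f) (b : Y ⟶ Z) [IsIso b] :
    KlIso (f ≫ A ◁ b) := by
  have := KlIso.kl hf (KlIso.of_iso (A := A) b)
  rwa [kl_comp_unit] at this

theorem KlIso.hom {A' : C} [MonObj A'] (h : A ⟶ A') [IsMonHom h] {X Y : C} {f : X ⟶ A ⊗ Y}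
    (hf : KlIso f) : KlIso (f ≫ h ▷ Y) := by
  obtain ⟨g, h1, h2⟩ := hf
  exact ⟨g ≫ h ▷ X, by rw [← kl_hom, h1, freeUnitApp_hom], by rw [← kl_hom, h2, freeUnitApp_hom]⟩

/-- The `A`-linear extension `A ⊗ X ⟶ A ⊗ Y` of a Kleisli isomorphism is an isomorphism. -/
theorem KlIso.isIso {X Y : C} {f : X ⟶ A ⊗ Y} (hf : KlIso f) :
    IsIso (A ◁ f ≫ freeActApp A Y) := by
  obtain ⟨g, h1, h2⟩ := hf
  have key : ∀ {X Y : C} (f : X ⟶ A ⊗ Y) (g : Y ⟶ A ⊗ X), RepGL.kl A f g = freeUnitApp A X →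
      (A ◁ f ≫ freeActApp A Y) ≫ A ◁ g ≫ freeActApp A X = 𝟙 _ := by
    intro X Y f g h
    rw [Category.assoc, ← reassoc_of% freeActApp_naturality, freeActApp_assoc,
      ← MonoidalCategory.whiskerLeft_comp_assoc, ← MonoidalCategory.whiskerLeft_comp_assoc,
      Category.assoc]
    change A ◁ RepGL.kl A f g ≫ _ = _
    rw [h, whiskerLeft_freeUnitApp_freeActApp]
  exact ⟨A ◁ g ≫ freeActApp A X, key f g h1, key g f h2⟩

/-- The `A`-linear extension of `a ≫ freeUnitApp A Y` is `A ◁ a`. Combined with `KlIso.of_comp`,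
this is the standard test below: a map of `C` is invertible once its composite with a known
trivialization of the target is again a trivialization. -/
theorem KlIso.isIso_of_reflects [(tensorLeft A).ReflectsIsomorphisms] {X Y : C} {a : X ⟶ Y}
    (h : KlIso (a ≫ freeUnitApp A Y)) : IsIso a := by
  have h1 := h.isIso
  rw [MonoidalCategory.whiskerLeft_comp, Category.assoc, whiskerLeft_freeUnitApp_freeActApp,
    Category.comp_id] at h1
  have : IsIso ((tensorLeft A).map a) := h1
  exact isIso_of_reflects_iso a (tensorLeft A)

/-- Functoriality of the tensor product of free `A`-modules, a consequence of `freeActApp_tensor`.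
-/
theorem kl_tensor [BraidedCategory C] [IsCommMonObj A] {X Y Z X' Y' Z' : C}
    (f : X ⟶ A ⊗ Y) (g : Y ⟶ A ⊗ Z) (f' : X' ⟶ A ⊗ Y') (g' : Y' ⟶ A ⊗ Z') :
    kl A ((f ⊗ₘ f') ≫ freeμ A Y Y') ((g ⊗ₘ g') ≫ freeμ A Z Z') =
      (kl A f g ⊗ₘ kl A f' g') ≫ freeμ A Z Z' := by
  simp only [kl, Category.assoc, MonoidalCategory.whiskerLeft_comp]
  rw [← reassoc_of% freeμ_natural, freeActApp_tensor]
  simp only [← tensorHom_comp_tensorHom, Category.assoc]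

theorem KlIso.tensor [BraidedCategory C] [IsCommMonObj A] {X Y X' Y' : C}
    {f : X ⟶ A ⊗ Y} {f' : X' ⟶ A ⊗ Y'} (hf : KlIso f) (hf' : KlIso f') :
    KlIso ((f ⊗ₘ f') ≫ freeμ A Y Y') := by
  obtain ⟨g, h1, h2⟩ := hf
  obtain ⟨g', h3, h4⟩ := hf'
  refine ⟨(g ⊗ₘ g') ≫ freeμ A X X', ?_, ?_⟩
  · rw [kl_tensor, h1, h3, freeUnitApp_tensor]
  · rw [kl_tensor, h2, h4, freeUnitApp_tensor]

end Kleisli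

/-! ### Pointwise equalizers of monoidal transformations. -/

section Equalizer

universe v₁ u₁ v₂ u₂

variable {D : Type u₂} [Category.{v₂} D] {C : Type u₁} [Category.{v₁} C] [HasEqualizers C]
  {K K' : D ⥤ C} (d₀ d₁ : K ⟶ K')

/-- The pointwise equalizer of two natural transformations. -/
def eqFunctor : D ⥤ C where
  obj X := equalizer (d₀.app X) (d₁.app X)
  map f := equalizer.lift (equalizer.ι _ _ ≫ K.map f) (by
    rw [Category.assoc, Category.assoc, d₀.naturality, d₁.naturality,
      equalizer.condition_assoc])

/-- The inclusion of the pointwise equalizer. -/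
def eqι : eqFunctor d₀ d₁ ⟶ K where
  app _ := equalizer.ι _ _
  naturality _ _ _ := equalizer.lift_ι _ _

instance (X : D) : Mono ((eqι d₀ d₁).app X) :=
  inferInstanceAs (Mono (equalizer.ι (d₀.app X) (d₁.app X)))

theorem eqι_condition (X : D) : (eqι d₀ d₁).app X ≫ d₀.app X = (eqι d₀ d₁).app X ≫ d₁.app X :=
  equalizer.condition _ _

theorem exists_eqι_lift {X : D} {Y : C} (f : Y ⟶ K.obj X) (h : f ≫ d₀.app X = f ≫ d₁.app X) :
    ∃ g : Y ⟶ (eqFunctor d₀ d₁).obj X, g ≫ (eqι d₀ d₁).app X = f :=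
  ⟨equalizer.lift f h, equalizer.lift_ι _ _⟩

variable [MonoidalCategory D] [MonoidalCategory C] [K.LaxMonoidal] [K'.LaxMonoidal]
  [NatTrans.IsMonoidal d₀] [NatTrans.IsMonoidal d₁]

/-- The structure morphism of the pointwise equalizer of two monoidal transformations. -/
def eqε : 𝟙_ C ⟶ (eqFunctor d₀ d₁).obj (𝟙_ D) :=
  equalizer.lift (ε K) (by rw [NatTrans.IsMonoidal.unit, NatTrans.IsMonoidal.unit])

/-- The structure morphism of the pointwise equalizer of two monoidal transformations. -/
def eqμ (X Y : D) :
    (eqFunctor d₀ d₁).obj X ⊗ (eqFunctor d₀ d₁).obj Y ⟶ (eqFunctor d₀ d₁).obj (X ⊗ Y) :=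
  equalizer.lift (((eqι d₀ d₁).app X ⊗ₘ (eqι d₀ d₁).app Y) ≫ Functor.LaxMonoidal.μ K X Y) (by
    rw [Category.assoc, Category.assoc, NatTrans.IsMonoidal.tensor, NatTrans.IsMonoidal.tensor,
      tensorHom_comp_tensorHom_assoc, tensorHom_comp_tensorHom_assoc, eqι_condition,
      eqι_condition])

theorem eqε_ι : eqε d₀ d₁ ≫ (eqι d₀ d₁).app (𝟙_ D) = ε K := equalizer.lift_ι _ _

theorem eqμ_ι (X Y : D) : eqμ d₀ d₁ X Y ≫ (eqι d₀ d₁).app (X ⊗ Y) =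
    ((eqι d₀ d₁).app X ⊗ₘ (eqι d₀ d₁).app Y) ≫ Functor.LaxMonoidal.μ K X Y :=
  equalizer.lift_ι _ _

/-- The inclusion into `K` is a pointwise monomorphism compatible with the structure maps, so every
axiom is inherited from `K`. -/
instance : (eqFunctor d₀ d₁).LaxMonoidal := by
  have nat : ∀ {X Y : D} (f : X ⟶ Y), (eqFunctor d₀ d₁).map f ≫ (eqι d₀ d₁).app Y =
    (eqι d₀ d₁).app X ≫ K.map f := fun f => (eqι d₀ d₁).naturality f
  refine ⟨eqε d₀ d₁, fun X Y => eqμ d₀ d₁ X Y, ?_, ?_, ?_, ?_, ?_⟩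
  · intro X Y f Z
    rw [← cancel_mono ((eqι d₀ d₁).app _)]
    rw [Category.assoc, Category.assoc, nat, eqμ_ι, reassoc_of% eqμ_ι, ← tensorHom_id,
      tensorHom_comp_tensorHom_assoc, nat, Category.id_comp, ← Functor.LaxMonoidal.μ_natural_left,
      ← tensorHom_id, tensorHom_comp_tensorHom_assoc, Category.comp_id]
  · intro X Y Z f
    rw [← cancel_mono ((eqι d₀ d₁).app _)]
    rw [Category.assoc, Category.assoc, nat, eqμ_ι, reassoc_of% eqμ_ι, ← id_tensorHom,
      tensorHom_comp_tensorHom_assoc, nat, Category.id_comp, ← Functor.LaxMonoidal.μ_natural_right,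
      ← id_tensorHom, tensorHom_comp_tensorHom_assoc, Category.comp_id]
  · intro X Y Z
    rw [← cancel_mono ((eqι d₀ d₁).app _)]
    simp only [Category.assoc, nat, eqμ_ι]
    rw [reassoc_of% eqμ_ι, ← tensorHom_id, ← id_tensorHom, tensorHom_comp_tensorHom_assoc,
      tensorHom_comp_tensorHom_assoc, eqμ_ι, eqμ_ι, Category.id_comp, Category.id_comp]
    have h := Functor.LaxMonoidal.associativity K X Y Z
    have e1 : (((eqι d₀ d₁).app X ⊗ₘ (eqι d₀ d₁).app Y) ≫ Functor.LaxMonoidal.μ K X Y ⊗ₘ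
        (eqι d₀ d₁).app Z) = (((eqι d₀ d₁).app X ⊗ₘ (eqι d₀ d₁).app Y) ⊗ₘ (eqι d₀ d₁).app Z) ≫
          (Functor.LaxMonoidal.μ K X Y ▷ K.obj Z) := by
      rw [← tensorHom_id, tensorHom_comp_tensorHom, Category.comp_id]
    have e2 : ((eqι d₀ d₁).app X ⊗ₘ ((eqι d₀ d₁).app Y ⊗ₘ (eqι d₀ d₁).app Z) ≫
        Functor.LaxMonoidal.μ K Y Z) =
        ((eqι d₀ d₁).app X ⊗ₘ ((eqι d₀ d₁).app Y ⊗ₘ (eqι d₀ d₁).app Z)) ≫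
          (K.obj X ◁ Functor.LaxMonoidal.μ K Y Z) := by
      rw [← id_tensorHom, tensorHom_comp_tensorHom, Category.comp_id]
    rw [e1, e2, Category.assoc, Category.assoc, h, associator_naturality_assoc]
  · intro X
    rw [← cancel_mono ((eqι d₀ d₁).app _)]
    simp only [Category.assoc, nat]
    rw [reassoc_of% eqμ_ι, ← tensorHom_id, tensorHom_comp_tensorHom_assoc, eqε_ι,
      Category.id_comp, tensorHom_def'_assoc, ← Functor.LaxMonoidal.left_unitality]
    simp
  · intro X
    rw [← cancel_mono ((eqι d₀ d₁).app _)]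
    simp only [Category.assoc, nat]
    rw [reassoc_of% eqμ_ι, ← id_tensorHom, tensorHom_comp_tensorHom_assoc, eqε_ι,
      Category.id_comp, tensorHom_def_assoc, ← Functor.LaxMonoidal.right_unitality]
    simp

instance : NatTrans.IsMonoidal (eqι d₀ d₁) where
  unit := eqε_ι d₀ d₁
  tensor X Y := eqμ_ι d₀ d₁ X Y

end Equalizer

section LiftMono

universe v₁ u₁ v₂ u₂

variable {D : Type u₂} [Category.{v₂} D] {C : Type u₁} [Category.{v₁} C]
  [MonoidalCategory D] [MonoidalCategory C] {F E K : D ⥤ C}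

theorem isMonoidal_of_comp_mono [F.LaxMonoidal] [E.LaxMonoidal] [K.LaxMonoidal]
    (α : F ⟶ E) (i : E ⟶ K) [∀ X, Mono (i.app X)] [NatTrans.IsMonoidal i]
    [h : NatTrans.IsMonoidal (α ≫ i)] : NatTrans.IsMonoidal α where
  unit := by
    rw [← cancel_mono (i.app _), Category.assoc, NatTrans.IsMonoidal.unit, ← h.unit]
    rfl
  tensor X Y := by
    have := h.tensor X Y
    simp only [NatTrans.comp_app] at this
    rw [← cancel_mono (i.app _), Category.assoc, this, Category.assoc, NatTrans.IsMonoidal.tensor,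
      tensorHom_comp_tensorHom_assoc]

theorem laxBraided_of_mono [BraidedCategory C] [BraidedCategory D] [E.LaxMonoidal] [K.LaxBraided]
    (i : E ⟶ K) [∀ X, Mono (i.app X)] [NatTrans.IsMonoidal i] (X Y : D) :
    Functor.LaxMonoidal.μ E X Y ≫ E.map (β_ X Y).hom =
      (β_ (E.obj X) (E.obj Y)).hom ≫ Functor.LaxMonoidal.μ E Y X := by
  rw [← cancel_mono (i.app _), Category.assoc, Category.assoc, i.naturality,
    NatTrans.IsMonoidal.tensor, NatTrans.IsMonoidal.tensor_assoc,
    ← BraidedCategory.braiding_naturality_assoc, Functor.LaxBraided.braided]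

end LiftMono

/-! ### The two inclusions of algebras into a tensor product. -/

section Inclusions

universe v₁ u₁

variable {C : Type u₁} [Category.{v₁} C] [MonoidalCategory C]

/-- The inclusion of the first factor into a tensor product of algebras. -/
def inl (M N : C) [MonObj N] : M ⟶ M ⊗ N := (ρ_ M).inv ≫ M ◁ η[N]

/-- The inclusion of the second factor into a tensor product of algebras. -/
def inr (M N : C) [MonObj M] : N ⟶ M ⊗ N := freeUnitApp M N

instance isMonHom_one (M : C) [MonObj M] : IsMonHom η[M] where
  one_hom := by simp
  mul_hom := by simp [← unitors_equal]

theorem inl_comp_mul (B : C) [MonObj B] : inl B B ≫ μ[B] = 𝟙 B := by simp [inl]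

theorem inr_comp_mul (B : C) [MonObj B] : inr B B ≫ μ[B] = 𝟙 B := by simp [inr, freeUnitApp]

variable [BraidedCategory C]

instance (M N : C) [MonObj M] [MonObj N] : IsMonHom (inl M N) := by
  unfold inl
  infer_instance

instance (M N : C) [MonObj M] [MonObj N] : IsMonHom (inr M N) := by
  unfold inr freeUnitApp
  infer_instance

/-- Multiplication by `1 ⊗ n` touches the second factor only. This and its mirror image turn
products in `B ⊗ B` and `B ⊗ (B ⊗ B)` into products in a single factor. -/
theorem whiskerLeft_inr_mul (M N : C) [MonObj M] [MonObj N] :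
    (M ⊗ N) ◁ inr M N ≫ μ[M ⊗ N] = (α_ M N N).hom ≫ M ◁ μ[N] := by
  have h : (M ⊗ N) ◁ (λ_ N).inv ≫ tensorμ M N (𝟙_ C) N ≫ ((ρ_ M).hom ⊗ₘ 𝟙 (N ⊗ N)) =
      (α_ M N N).hom := by
    simp only [tensorμ, braiding_tensorUnit_right]
    monoidal
  have h2 := tensorμ_natural_right M N (η[M]) (𝟙 N)
  rw [inr, freeUnitApp, MonObj.tensorObj.mul_def, MonoidalCategory.whiskerLeft_comp,
    ← tensorHom_id, Category.assoc, reassoc_of% h2, tensorHom_comp_tensorHom, MonObj.mul_one,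
    ← h]
  simp only [Category.assoc, ← id_tensorHom, tensorHom_comp_tensorHom,
    id_tensorHom_id, Category.id_comp, Category.comp_id]

theorem inl_whiskerRight_mul (M N : C) [MonObj M] [MonObj N] :
    inl M N ▷ (M ⊗ N) ≫ μ[M ⊗ N] = (α_ M M N).inv ≫ μ[M] ▷ N := by
  have h : (ρ_ M).inv ▷ (M ⊗ N) ≫ tensorμ M (𝟙_ C) M N ≫ (𝟙 (M ⊗ M) ⊗ₘ (λ_ N).hom) =
      (α_ M M N).inv := by
    simp only [tensorμ, braiding_tensorUnit_left]
    monoidal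
  have h2 := tensorμ_natural_left (𝟙 M) (η[N]) M N
  rw [inl, MonObj.tensorObj.mul_def, comp_whiskerRight,
    ← id_tensorHom, Category.assoc, reassoc_of% h2, tensorHom_comp_tensorHom, MonObj.one_mul,
    ← h]
  simp only [Category.assoc, ← tensorHom_id, tensorHom_comp_tensorHom,
    id_tensorHom_id, Category.id_comp, Category.comp_id]

end Inclusions

/-! ### Faithfully flat descent for a twisted trivial family. -/

section Descent

universe v₁ u₁ v₂ u₂

variable {D : Type u₂} [Category.{v₂} D] [MonoidalCategory D]
  {C : Type u₁} [Category.{v₁} C] [MonoidalCategory C] [SymmetricCategory C]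
  {B : C} [MonObj B] [IsCommMonObj B] {L : D ⥤ C} [L.Monoidal]

variable (B L) in
/-- The transformation `x ↦ 1 ⊗ x` from `B ⊗ L(-)` to `(B ⊗ B) ⊗ L(-)`. -/
def descent₀ : L ⋙ tensorLeft B ⟶ L ⋙ tensorLeft (B ⊗ B) :=
  Functor.whiskerLeft L (freeMap (inr B B))

/-- The transformation from `B ⊗ L(-)` to `(B ⊗ B) ⊗ L(-)` which is given by twisting
`b ⊗ x ↦ (b ⊗ 1) ⊗ x` with `t`. -/
def descent₁ (t : L ⟶ L ⋙ tensorLeft (B ⊗ B)) : L ⋙ tensorLeft B ⟶ L ⋙ tensorLeft (B ⊗ B) :=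
  Functor.whiskerLeft L (freeMap (inl B B)) ≫ Functor.whiskerRight t (tensorLeft (B ⊗ B)) ≫
    (Functor.associator _ _ _).hom ≫ Functor.whiskerLeft L (freeAct (B ⊗ B))

instance : NatTrans.IsMonoidal (descent₀ B L) := by
  unfold descent₀
  infer_instance

variable (t : L ⟶ L ⋙ tensorLeft (B ⊗ B))

instance [NatTrans.IsMonoidal t] : NatTrans.IsMonoidal (descent₁ t) := by
  unfold descent₁
  infer_instance

theorem descent₀_app (W : D) : (descent₀ B L).app W = inr B B ▷ L.obj W := rfl

theorem descent₁_app (W : D) : (descent₁ t).app W =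
    inl B B ▷ L.obj W ≫ (B ⊗ B) ◁ t.app W ≫ freeActApp (B ⊗ B) (L.obj W) := by
  simp [descent₁, freeMap, freeAct]

/-- The compatibility conditions for a twist `t` to be a descent datum for the trivial family
`B ⊗ L(-)`. -/
structure IsDescentDatum : Prop where
  norm (W : D) : t.app W ≫ μ[B] ▷ L.obj W = freeUnitApp B (L.obj W)
  cocycle (W : D) : kl (B ⊗ (B ⊗ B)) (t.app W ≫ (B ◁ inl B B) ▷ L.obj W)
    (t.app W ≫ inr B (B ⊗ B) ▷ L.obj W) = t.app W ≫ (B ◁ inr B B) ▷ L.obj W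

variable {t}

/-- With `B ⊗ B` acting through its first factor, `descent₁ t` is the `B`-linear extension of `t`,
while `descent₀` is the unit of `B ⊗ L W` (next lemma). Equalizing the two therefore becomes a
Kleisli identity. -/
theorem descent₁_assoc (W : D) : (descent₁ t).app W ≫ (α_ B B (L.obj W)).hom =
    B ◁ (t.app W ≫ (α_ B B (L.obj W)).hom) ≫ freeActApp B (B ⊗ L.obj W) := by
  rw [descent₁_app, freeActApp, freeActApp, MonoidalCategory.whiskerLeft_comp, Category.assoc,
    Category.assoc, Category.assoc, ← whisker_exchange_assoc]
  have h : inl B B ▷ ((B ⊗ B) ⊗ L.obj W) ≫ (α_ (B ⊗ B) (B ⊗ B) (L.obj W)).inv ≫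
      μ[B ⊗ B] ▷ L.obj W = (α_ B (B ⊗ B) (L.obj W)).inv ≫ (α_ B B B).inv ▷ L.obj W ≫
        μ[B] ▷ B ▷ L.obj W := by
    rw [associator_inv_naturality_left_assoc, ← comp_whiskerRight, inl_whiskerRight_mul,
      comp_whiskerRight]
  have h' := reassoc_of% h
  refine (congrArg (B ◁ t.app W ≫ ·) (h' _)).trans ?_
  dsimp
  rw [Category.assoc]
  congr 1
  simp

theorem descent₀_assoc (W : D) : (descent₀ B L).app W ≫ (α_ B B (L.obj W)).hom =
    freeUnitApp B (B ⊗ L.obj W) := by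
  simp [descent₀_app, inr, freeUnitApp]

/-- The cocycle condition says exactly that `t` equalizes the pair after `B ⊗ -`. By flatness `t`
then factors through `B ⊗ E`, where `E` is the equalizer, and this factorization will be the inverse
trivialization. -/
theorem descent_cocycle (ht : IsDescentDatum t) (W : D) :
    (t.app W ≫ (α_ B B (L.obj W)).hom) ≫ B ◁ (descent₁ t).app W =
      (t.app W ≫ (α_ B B (L.obj W)).hom) ≫ B ◁ (descent₀ B L).app W := by
  have h := ht.cocycle W
  rw [← cancel_mono (α_ B (B ⊗ B) (L.obj W)).inv]
  have h0 : (α_ B B (L.obj W)).hom ≫ B ◁ (descent₀ B L).app W ≫ (α_ B (B ⊗ B) (L.obj W)).inv =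
      (B ◁ inr B B) ▷ L.obj W := by
    rw [descent₀_app]
    simp
  have h1 : (B ◁ inl B B) ▷ L.obj W ≫ (B ⊗ (B ⊗ B)) ◁ (t.app W ≫ inr B (B ⊗ B) ▷ L.obj W) ≫
      freeActApp (B ⊗ (B ⊗ B)) (L.obj W) =
      (α_ B B (L.obj W)).hom ≫ B ◁ (descent₁ t).app W ≫ (α_ B (B ⊗ B) (L.obj W)).inv := by
    have e : (B ⊗ (B ⊗ B)) ◁ (inr B (B ⊗ B) ▷ L.obj W) ≫ freeActApp (B ⊗ (B ⊗ B)) (L.obj W) =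
        (α_ B (B ⊗ B) ((B ⊗ B) ⊗ L.obj W)).hom ≫ B ◁ freeActApp (B ⊗ B) (L.obj W) ≫
          (α_ B (B ⊗ B) (L.obj W)).inv := by
      rw [freeActApp, associator_inv_naturality_middle_assoc, ← comp_whiskerRight,
        whiskerLeft_inr_mul, freeActApp]
      simp
    rw [MonoidalCategory.whiskerLeft_comp, Category.assoc, e, descent₁_app]
    simp
  rw [Category.assoc, Category.assoc, Category.assoc, Category.assoc, h0, ← h1, ← h, kl,
    Category.assoc]

variable [HasEqualizers C]

/-- A descent datum for a faithfully flat algebra is effective. -/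
theorem IsDescentDatum.klIso (ht : IsDescentDatum t) (hB : IsFaithfullyFlat B) (W : D) :
    KlIso (A := B) (Y := L.obj W) ((eqι (descent₀ B L) (descent₁ t)).app W) := by
  have := hB.preservesFiniteLimits
  set i := (eqι (descent₀ B L) (descent₁ t)).app W
  have hi : i ≫ (descent₀ B L).app W = i ≫ (descent₁ t).app W := eqι_condition _ _ W
  have hlim : IsLimit (Fork.ofι (f := (descent₀ B L).app W) (g := (descent₁ t).app W) i hi) :=
    equalizerIsEqualizer _ _
  -- Flatness: `B ⊗ -` preserves the equalizer, so maps into `B ⊗ E W` can be constructed and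
  -- compared inside `B ⊗ (B ⊗ L W)`.
  have hlim' := isLimitForkMapOfIsLimit (tensorLeft B) hi hlim
  have hmono : Mono ((tensorLeft B).map i) := by
    have : Mono i := inferInstance
    infer_instance
  obtain ⟨u, hu⟩ := Fork.IsLimit.lift' hlim' (t.app W ≫ (α_ B B (L.obj W)).hom)
    (descent_cocycle ht W).symm
  have hu' : u ≫ B ◁ i = t.app W ≫ (α_ B B (L.obj W)).hom := hu
  refine ⟨u, ?_, ?_⟩
  -- One composite is the unit because `i` equalizes `descent₀` and `descent₁`; the other one is the
  -- normalization of `t` along the multiplication of `B`.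
  · have : Mono (B ◁ i) := hmono
    rw [← cancel_mono (B ◁ i), ← freeUnitApp_naturality, kl, Category.assoc, Category.assoc,
      ← freeActApp_naturality, ← MonoidalCategory.whiskerLeft_comp_assoc, hu']
    refine (congrArg (i ≫ ·) (descent₁_assoc (t := t) W).symm).trans ?_
    refine Eq.trans ?_ (congrArg (i ≫ ·) (descent₀_assoc W))
    rw [← Category.assoc, ← hi, Category.assoc]
  · rw [kl, reassoc_of% hu', freeActApp, Iso.hom_inv_id_assoc, ht.norm]

end Descent

/-! ### The descended functor is symmetric monoidal and a left adjoint. -/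

section DescentFunctor

universe v₁ u₁ v₂ u₂

variable {D : Type u₂} [Category.{v₂} D] [MonoidalCategory D]
  {C : Type u₁} [Category.{v₁} C] [MonoidalCategory C] [SymmetricCategory C]
  {B : C} [MonObj B]

/-- After `B ⊗ -` the functor `E` becomes isomorphic to `B ⊗ L(-)`, a left adjoint. By Beck's
theorem `B ⊗ -` is comonadic: it has the right adjoint `ihom B`, reflects isomorphisms and preserves
equalizers. The adjoint lifting theorem then supplies a right adjoint of `E` itself, as a
coreflexive equalizer in `D`. -/
theorem isLeftAdjoint_of_klIso [MonoidalClosed C] [HasEqualizers C] [HasCoreflexiveEqualizers D]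
    (hB : IsFaithfullyFlat B) {E L : D ⥤ C} [L.IsLeftAdjoint] (i : E ⟶ L ⋙ tensorLeft B)
    (hi : ∀ W, KlIso (A := B) (Y := L.obj W) (i.app W)) : E.IsLeftAdjoint := by
  have := hB.preservesFiniteLimits
  have := hB.reflectsIsomorphisms
  let e : E ⋙ tensorLeft B ≅ L ⋙ tensorLeft B := by
    refine NatIso.ofComponents (fun W => @asIso _ _ _ _ _ (hi W).isIso) ?_
    intro W W' f
    change B ◁ E.map f ≫ B ◁ i.app W' ≫ freeActApp B (L.obj W') =
      (B ◁ i.app W ≫ freeActApp B (L.obj W)) ≫ B ◁ L.map f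
    have hn : E.map f ≫ i.app W' = i.app W ≫ B ◁ L.map f := i.naturality f
    rw [← MonoidalCategory.whiskerLeft_comp_assoc, hn, MonoidalCategory.whiskerLeft_comp_assoc,
      freeActApp_naturality, Category.assoc]
  have : Comonad.PreservesLimitOfIsCoreflexivePair (tensorLeft B) := ⟨fun _ _ _ => inferInstance⟩
  let adj : tensorLeft B ⊣ ihom B := ihom.adjunction B
  have : ComonadicLeftAdjoint (tensorLeft B) :=
    Comonad.comonadicOfHasPreservesCoreflexiveEqualizersOfReflectsIsomorphisms adj
  have : (tensorLeft B).IsLeftAdjoint := adj.isLeftAdjoint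
  exact isLeftAdjoint_square_lift_comonadic E (tensorLeft B) L (tensorLeft B) e.symm

variable [IsCommMonObj B] {L : D ⥤ C} [SymmetricCategory D] [HasEqualizers C]

/-- The functor which is obtained from `B ⊗ L(-)` by descent along the faithfully flat algebra `B`
is symmetric strong monoidal. -/
theorem IsDescentDatum.exists_braided [L.Braided] {t : L ⟶ L ⋙ tensorLeft (B ⊗ B)}
    [NatTrans.IsMonoidal t] (ht : IsDescentDatum t) (hB : IsFaithfullyFlat B) :
    ∃ (E : D ⥤ C) (_ : E.Braided) (i : E ⟶ L ⋙ tensorLeft B), NatTrans.IsMonoidal i ∧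
      (∀ W, KlIso (A := B) (Y := L.obj W) (i.app W)) ∧ (∀ W, Mono (i.app W)) ∧
      (∀ W, i.app W ≫ (descent₀ B L).app W = i.app W ≫ (descent₁ t).app W) ∧
      ∀ (W : D) (Y : C) (f : Y ⟶ (L ⋙ tensorLeft B).obj W),
        f ≫ (descent₀ B L).app W = f ≫ (descent₁ t).app W → ∃ g, g ≫ i.app W = f := by
  have := hB.reflectsIsomorphisms
  let E := eqFunctor (descent₀ B L) (descent₁ t)
  let i : E ⟶ L ⋙ tensorLeft B := eqι (descent₀ B L) (descent₁ t)
  have hi : ∀ W, KlIso (A := B) (Y := L.obj W) (i.app W) := fun W => ht.klIso hB W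
  -- The lax structure maps of `E`, followed by the trivialization `i`, are structure maps of `L`
  -- over `B` composed with Kleisli isomorphisms; hence they are invertible over `B`, and so
  -- invertible.
  have hε : IsIso (ε E) := by
    have h1 : KlIso (A := B) (Y := L.obj (𝟙_ D)) (ε E ≫ i.app (𝟙_ D)) := by
      have h2 : ε E ≫ i.app (𝟙_ D) = ε L ≫ freeUnitApp B (L.obj (𝟙_ D)) := by
        rw [NatTrans.IsMonoidal.unit (τ := i), Functor.LaxMonoidal.comp_ε]
        change freeUnitApp B (𝟙_ C) ≫ B ◁ ε L = _
        rw [freeUnitApp_naturality]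
      rw [h2]
      exact KlIso.of_iso _
    exact (KlIso.of_comp (hi _) h1).isIso_of_reflects
  have hμ : ∀ X Y, IsIso (Functor.LaxMonoidal.μ E X Y) := by
    intro X Y
    have h1 : KlIso (A := B) (Y := L.obj (X ⊗ Y))
        (Functor.LaxMonoidal.μ E X Y ≫ i.app (X ⊗ Y)) := by
      rw [NatTrans.IsMonoidal.tensor (τ := i), Functor.LaxMonoidal.comp_μ]
      have h2 := ((hi X).tensor (hi Y)).comp_iso (Functor.LaxMonoidal.μ L X Y)
      rw [Category.assoc] at h2
      exact h2
    exact (KlIso.of_comp (hi _) h1).isIso_of_reflects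
  let hE : E.Braided := by
    letI : E.Monoidal := Functor.Monoidal.ofLaxMonoidal E
    exact { braided := fun X Y => laxBraided_of_mono i X Y }
  refine ⟨E, hE, i, ?_, hi, fun W => inferInstance,
    fun W => eqι_condition _ _ W, fun W Y f hf => exists_eqι_lift _ _ f hf⟩
  exact ⟨eqε_ι _ _, fun X Y => eqμ_ι _ _ X Y⟩

end DescentFunctor

section Additive

universe v₁ u₁ v₂ u₂

variable {D : Type u₂} [Category.{v₂} D] [Preadditive D] {C : Type u₁} [Category.{v₁} C]
  [Preadditive C] {E K : D ⥤ C} 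

theorem additive_of_mono (i : E ⟶ K) [∀ W, Mono (i.app W)] [K.Additive] : E.Additive where
  map_add {X Y f g} := by
    rw [← cancel_mono (i.app Y), Preadditive.add_comp, i.naturality, i.naturality, i.naturality,
      K.map_add, Preadditive.comp_add]

theorem linear_of_mono (i : E ⟶ K) [∀ W, Mono (i.app W)] (R : Type*) [CommRing R] [Linear R D] [Linear R C]
    [K.Linear R] : E.Linear R where
  map_smul {X Y} f r := by
    rw [← cancel_mono (i.app Y), Linear.smul_comp, i.naturality, i.naturality, K.map_smul,
      Linear.comp_smul]

end Additive

open scoped Obj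

/-! ### Transport of Kleisli morphisms along a monoidal functor. -/

section Action

variable {C : Type*} [Category* C] [MonoidalCategory C] {A : C} [MonObj A]

theorem whiskerRight_freeActApp {X Z Y Y' : C} (x : X ⟶ A ⊗ Z) (y : Z ⟶ A) (v : Y ⟶ Y') :
    x ▷ Y ≫ (α_ A Z Y).hom ≫ A ◁ (y ⊗ₘ v) ≫ freeActApp A Y' =
      (x ≫ A ◁ y ≫ μ[A]) ▷ Y ≫ A ◁ v := by
  rw [MonoidalCategory.tensorHom_def, MonoidalCategory.whiskerLeft_comp_assoc,
    freeActApp_naturality, freeActApp]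
  simp

end Action

section MapKleisli

universe v₁ u₁ v₂ u₂

variable {D : Type u₂} [Category.{v₂} D] [MonoidalCategory D]
  {C : Type u₁} [Category.{v₁} C] [MonoidalCategory C] {H : D} [MonObj H] {A : C} [MonObj A]
  (F : D ⥤ C) [F.Monoidal] (b : F.obj H ⟶ A)

/-- The image of a Kleisli morphism for `H` under a strong monoidal functor `F` and a morphism of
algebras `F H ⟶ A`. -/
def mapKl {X Y : D} (f : X ⟶ H ⊗ Y) : F.obj X ⟶ A ⊗ F.obj Y :=
  F.map f ≫ Functor.OplaxMonoidal.δ F H Y ≫ b ▷ F.obj Y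

theorem mapKl_comp_whiskerLeft {X Y Z : D} (f : X ⟶ H ⊗ Y) (g : Y ⟶ Z) :
    mapKl F b (f ≫ H ◁ g) = mapKl F b f ≫ A ◁ F.map g := by
  rw [mapKl, mapKl, Functor.map_comp_assoc, ← Functor.OplaxMonoidal.δ_natural_right_assoc,
    Category.assoc, Category.assoc, whisker_exchange]

theorem map_comp_mapKl {X Y Z : D} (f : X ⟶ Y) (g : Y ⟶ H ⊗ Z) :
    mapKl F b (f ≫ g) = F.map f ≫ mapKl F b g := by
  rw [mapKl, mapKl, Functor.map_comp_assoc]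

theorem mapKl_whiskerRight {X Y Z : D} (r : X ⟶ H ⊗ Y) (s : H ⟶ H ⊗ Z) :
    mapKl F b (r ≫ s ▷ Y ≫ (α_ H Z Y).hom) ≫ A ◁ Functor.OplaxMonoidal.δ F Z Y =
      F.map r ≫ Functor.OplaxMonoidal.δ F H Y ≫ mapKl F b s ▷ F.obj Y ≫ (α_ A _ _).hom := by
  simp only [mapKl, Functor.map_comp, Category.assoc, comp_whiskerRight]
  rw [associator_naturality_left, ← whisker_exchange,
    Functor.OplaxMonoidal.δ_natural_left_assoc, Functor.OplaxMonoidal.associativity_assoc]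

variable [IsMonHom b]

theorem mapKl_unit (X : D) : mapKl F b (freeUnitApp H X) = freeUnitApp A (F.obj X) := by
  have h : ε F ≫ F.map η[H] ≫ b = η[A] := by
    have := IsMonHom.one_hom b
    rwa [Functor.obj.η_def, Category.assoc] at this
  rw [mapKl, freeUnitApp, freeUnitApp, ← h, Functor.map_comp, Category.assoc,
    ← Functor.OplaxMonoidal.δ_natural_left_assoc, ← comp_whiskerRight]
  rw [Functor.Monoidal.map_leftUnitor_inv]
  simp

/-- Together with `mapKl_unit`: applying `F` and then extending scalars along the algebra map `b` is
a functor between Kleisli categories. In particular trivializations over `H` go to trivializations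
over `A`. -/
theorem mapKl_comp {X Y Z : D} (f : X ⟶ H ⊗ Y) (g : Y ⟶ H ⊗ Z) :
    mapKl F b (kl H f g) = kl A (mapKl F b f) (mapKl F b g) := by
  have hb : Functor.LaxMonoidal.μ F H H ≫ F.map μ[H] ≫ b = (b ⊗ₘ b) ≫ μ[A] := by
    have := IsMonHom.mul_hom b
    rwa [Functor.obj.μ_def, Category.assoc] at this
  have key : F.map (freeActApp H Z) ≫ Functor.OplaxMonoidal.δ F H Z ≫ b ▷ F.obj Z =
      Functor.OplaxMonoidal.δ F H (H ⊗ Z) ≫ F.obj H ◁ Functor.OplaxMonoidal.δ F H Z ≫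
        b ▷ (F.obj H ⊗ F.obj Z) ≫ A ◁ (b ▷ F.obj Z) ≫ freeActApp A (F.obj Z) := by
    rw [freeActApp, freeActApp, Functor.map_comp, Category.assoc,
      ← Functor.OplaxMonoidal.δ_natural_left_assoc, ← comp_whiskerRight,
      associator_inv_naturality_middle_assoc, associator_inv_naturality_left_assoc,
      ← comp_whiskerRight, ← comp_whiskerRight, ← MonoidalCategory.tensorHom_def_assoc, ← hb]
    rw [Functor.Monoidal.map_associator_inv]
    simp
  simp only [mapKl, kl, Functor.map_comp, Category.assoc, MonoidalCategory.whiskerLeft_comp]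
  rw [key, ← Functor.OplaxMonoidal.δ_natural_right_assoc, ← whisker_exchange_assoc,
    whisker_exchange_assoc b (b ▷ F.obj Z), whisker_exchange_assoc b,
    whisker_exchange_assoc b]

theorem KlIso.mapKl {X Y : D} {f : X ⟶ H ⊗ Y} (hf : KlIso f) : KlIso (mapKl F b f) := by
  obtain ⟨g, h1, h2⟩ := hf
  exact ⟨RepGL.mapKl F b g, by rw [← mapKl_comp, h1, mapKl_unit],
    by rw [← mapKl_comp, h2, mapKl_unit]⟩

end MapKleisli

section MapTensor

universe v₁ u₁ v₂ u₂

variable {D : Type u₂} [Category.{v₂} D] [MonoidalCategory D] [BraidedCategory D]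
  {C : Type u₁} [Category.{v₁} C] [MonoidalCategory C] [BraidedCategory C]
  {H : D} [MonObj H] {A : C} [MonObj A]

theorem map_freeμ (F : D ⥤ C) [F.Braided] (X Y : D) :
    Functor.LaxMonoidal.μ F (H ⊗ X) (H ⊗ Y) ≫ F.map (freeμ H X Y) ≫
      Functor.OplaxMonoidal.δ F H (X ⊗ Y) =
    (Functor.OplaxMonoidal.δ F H X ⊗ₘ Functor.OplaxMonoidal.δ F H Y) ≫
      freeμ (F.obj H) (F.obj X) (F.obj Y) ≫ F.obj H ◁ Functor.LaxMonoidal.μ F X Y := by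
  have h := tensorμ_comp_μ_tensorHom_μ_comp_μ F H X H Y
  rw [← cancel_epi (Functor.LaxMonoidal.μ F H X ⊗ₘ Functor.LaxMonoidal.μ F H Y), freeμ, freeμ,
    Functor.map_comp, Category.assoc, ← reassoc_of% h, tensorHom_id, tensorHom_id,
    ← Functor.OplaxMonoidal.δ_natural_left, Functor.Monoidal.μ_δ_assoc,
    tensorHom_comp_tensorHom_assoc, Functor.Monoidal.μ_δ, Functor.Monoidal.μ_δ, id_tensorHom_id,
    Category.id_comp, Functor.obj.μ_def, Category.assoc]
  simp only [← tensorHom_id, ← id_tensorHom, tensorHom_comp_tensorHom, Category.id_comp,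
    Category.comp_id]

/-- The braided structure of `F` is needed because the tensor product of Kleisli morphisms shuffles
the two copies of the algebra. -/
theorem mapKl_tensor (F : D ⥤ C) [F.Braided] (b : F.obj H ⟶ A) [IsMonHom b] {X X' Y Y' : D}
    (f : X ⟶ H ⊗ Y) (g : X' ⟶ H ⊗ Y') :
    Functor.LaxMonoidal.μ F X X' ≫ mapKl F b ((f ⊗ₘ g) ≫ freeμ H Y Y') =
      (mapKl F b f ⊗ₘ mapKl F b g) ≫ freeμ A (F.obj Y) (F.obj Y') ≫
        A ◁ Functor.LaxMonoidal.μ F Y Y' := by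
  rw [mapKl, Functor.map_comp_assoc, ← Functor.LaxMonoidal.μ_natural_assoc,
    reassoc_of% map_freeμ F Y Y', whisker_exchange, reassoc_of% freeμ_hom b]
  simp only [mapKl, tensorHom_comp_tensorHom_assoc]

end MapTensor

section Conv

universe v₁ u₁ v₂ u₂

variable {D : Type u₂} [Category.{v₂} D] [MonoidalCategory D]
  {C : Type u₁} [Category.{v₁} C] [MonoidalCategory C] [BraidedCategory C] {H : D} [MonObj H]
  {A : C} [MonObj A] [IsCommMonObj A] {F L : D ⥤ C} [F.LaxMonoidal] [L.LaxMonoidal]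

/-- When `θ` is the twist by a point `b`, this map is the convolution product of `b` and `c`, in
other words the product of the two matrices. Commutativity of `A` makes a product of algebra maps
multiplicative. -/
theorem isMonHom_conv (θ : F ⟶ L ⋙ tensorLeft A) [NatTrans.IsMonoidal θ] (c : L.obj H ⟶ A)
    [IsMonHom c] : IsMonHom (M := F.obj H) (N := A)
      ((θ.app H : F.obj H ⟶ A ⊗ L.obj H) ≫ A ◁ c ≫ μ[A]) where
  one_hom := by
    have h1 : ε L ≫ L.map η[H] ≫ c = η[A] := by
      have := IsMonHom.one_hom c
      rwa [Functor.obj.η_def, Category.assoc] at this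
    have hn : F.map η[H] ≫ θ.app H = θ.app (𝟙_ D) ≫ A ◁ L.map η[H] := θ.naturality _
    have hu : ε F ≫ θ.app (𝟙_ D) = freeUnitApp A (𝟙_ C) ≫ A ◁ ε L :=
      NatTrans.IsMonoidal.unit
    have e : freeUnitApp A (𝟙_ C) ≫ A ◁ η[A] ≫ μ[A] = η[A] := by
      rw [freeUnitApp, MonObj.mul_one, Category.assoc, rightUnitor_naturality, unitors_inv_equal,
        Iso.inv_hom_id_assoc]
    rw [Functor.obj.η_def, Category.assoc, reassoc_of% hn, reassoc_of% hu,
      ← MonoidalCategory.whiskerLeft_comp_assoc, ← MonoidalCategory.whiskerLeft_comp_assoc,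
      Category.assoc, h1, e]
  mul_hom := by
    have h1 : Functor.LaxMonoidal.μ L H H ≫ L.map μ[H] ≫ c = (c ⊗ₘ c) ≫ μ[A] := by
      have := IsMonHom.mul_hom c
      rwa [Functor.obj.μ_def, Category.assoc] at this
    have hn : F.map μ[H] ≫ θ.app H = θ.app (H ⊗ H) ≫ A ◁ L.map μ[H] := θ.naturality _
    have hu : Functor.LaxMonoidal.μ F H H ≫ θ.app (H ⊗ H) =
        (θ.app H ⊗ₘ θ.app H) ≫ freeμ A (L.obj H) (L.obj H) ≫ A ◁ Functor.LaxMonoidal.μ L H H :=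
      NatTrans.IsMonoidal.tensor _ _
    have e : freeμ A A A ≫ A ◁ μ[A] ≫ μ[A] = (μ[A] ⊗ₘ μ[A]) ≫ μ[A] := by
      rw [freeμ, ← id_tensorHom, Category.assoc, tensorHom_comp_tensorHom_assoc, Category.comp_id,
        Category.id_comp, MonObj.mul_mul_mul_comm]
    rw [Functor.obj.μ_def, Category.assoc, reassoc_of% hn, reassoc_of% hu,
      ← MonoidalCategory.whiskerLeft_comp_assoc, ← MonoidalCategory.whiskerLeft_comp_assoc,
      Category.assoc, h1, MonoidalCategory.whiskerLeft_comp_assoc, ← reassoc_of% freeμ_natural, e]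
    simp only [tensorHom_comp_tensorHom_assoc]

end Conv

/-! ### Twisting a functor by a point of the group, and composition of twists. -/

section Twist

universe v₁ u₁ v₂ u₂ v₃ u₃

variable {D : Type u₂} [Category.{v₂} D] [MonoidalCategory D] [BraidedCategory D]
  {M : Type u₃} [Category.{v₃} M] [MonoidalCategory M]
  {C : Type u₁} [Category.{v₁} C] [MonoidalCategory C] [BraidedCategory C]
  {H : D} [MonObj H] {A : C} [MonObj A]
  {ω : D ⥤ M} [ω.LaxMonoidal] {T : M ⥤ D} [T.LaxMonoidal]

variable (ρ : 𝟭 D ⟶ (ω ⋙ T) ⋙ tensorLeft H) (F : D ⥤ C) {U : M ⥤ C} (b : F.obj H ⟶ A)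
  (υ : T ⋙ F ⟶ U)

/-- The coaction of `H` as a transformation from a functor `F` to the free functor
`A ⊗ U(ω(-))`. -/
def twist [F.Monoidal] : F ⟶ (ω ⋙ U) ⋙ tensorLeft A where
  app W := mapKl F b (ρ.app W) ≫ A ◁ υ.app (ω.obj W)
  naturality W W' f := by
    have hρ : f ≫ ρ.app W' = ρ.app W ≫ H ◁ T.map (ω.map f) := ρ.naturality f
    have hυ : F.map (T.map (ω.map f)) ≫ υ.app (ω.obj W') =
      υ.app (ω.obj W) ≫ U.map (ω.map f) := υ.naturality _
    change F.map f ≫ mapKl F b (ρ.app W') ≫ A ◁ υ.app (ω.obj W') =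
      (mapKl F b (ρ.app W) ≫ A ◁ υ.app (ω.obj W)) ≫ A ◁ U.map (ω.map f)
    have h1 : mapKl F b (ρ.app W ≫ H ◁ T.map (ω.map f)) =
      mapKl F b (ρ.app W) ≫ A ◁ F.map (T.map (ω.map f)) := mapKl_comp_whiskerLeft F b _ _
    rw [Category.assoc, ← MonoidalCategory.whiskerLeft_comp, ← hυ,
      MonoidalCategory.whiskerLeft_comp, ← reassoc_of% h1, ← reassoc_of% map_comp_mapKl F b]
    exact congrArg (mapKl F b · ≫ _) hρ

theorem twist_app [F.Monoidal] (W : D) : (twist ρ F b υ).app W =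
    mapKl F b (ρ.app W) ≫ A ◁ υ.app (ω.obj W) := rfl

theorem twist_app_hom [F.Monoidal] {A' : C} [MonObj A'] (h : A ⟶ A') (W : D) :
    (twist ρ F b υ).app W ≫ h ▷ U.obj (ω.obj W) = (twist ρ F (b ≫ h) υ).app W := by
  simp only [twist_app, mapKl, comp_whiskerRight, Category.assoc]
  congr 2
  exact congrArg (b ▷ _ ≫ ·) (whisker_exchange _ _)

theorem klIso_twist [F.Monoidal] [IsMonHom b] [IsIso υ] (W : D)
    (h : KlIso (A := H) (Y := T.obj (ω.obj W)) (ρ.app W)) :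
    KlIso (A := A) (Y := U.obj (ω.obj W)) ((twist ρ F b υ).app W) := by
  have : IsIso (υ.app (ω.obj W)) := inferInstance
  exact (KlIso.mapKl F b h).comp_iso (υ.app (ω.obj W))

/-- The twist is the coaction `ρ`, transported along the algebra map `b` and then along `υ`; each
ingredient is monoidal, and `mapKl_tensor` joins them. -/
instance isMonoidal_twist [NatTrans.IsMonoidal ρ] [F.Braided] [U.LaxMonoidal] [IsMonHom b]
    [NatTrans.IsMonoidal υ] : NatTrans.IsMonoidal (twist ρ F b υ) where
  unit := by
    have hρ : ρ.app (𝟙_ D) = freeUnitApp H (𝟙_ D) ≫ H ◁ (ε T ≫ T.map (ε ω)) := by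
      have : 𝟙 _ ≫ ρ.app (𝟙_ D) = _ := NatTrans.IsMonoidal.unit (τ := ρ)
      rw [Category.id_comp] at this
      exact this
    have hυ : ε F ≫ F.map (ε T) ≫ υ.app (𝟙_ M) = ε U := by
      have : (ε F ≫ F.map (ε T)) ≫ υ.app (𝟙_ M) = _ := NatTrans.IsMonoidal.unit (τ := υ)
      rwa [Category.assoc] at this
    have hυ' : F.map (T.map (ε ω)) ≫ υ.app (ω.obj (𝟙_ D)) =
      υ.app (𝟙_ M) ≫ U.map (ε ω) := υ.naturality _
    change ε F ≫ mapKl F b (ρ.app (𝟙_ D)) ≫ A ◁ υ.app (ω.obj (𝟙_ D)) =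
      freeUnitApp A (𝟙_ C) ≫ A ◁ (ε U ≫ U.map (ε ω))
    refine (congrArg (fun z => ε F ≫ mapKl F b z ≫ _) hρ).trans ?_
    rw [mapKl_comp_whiskerLeft, mapKl_unit, Category.assoc, reassoc_of% freeUnitApp_naturality A (ε F), ← hυ,
      ← MonoidalCategory.whiskerLeft_comp, ← MonoidalCategory.whiskerLeft_comp, Functor.map_comp,
      Category.assoc, Category.assoc, Category.assoc]
    congr 2
    exact congrArg (ε F ≫ F.map (ε T) ≫ ·) hυ'
  tensor W W' := by
    have hρ : ρ.app (W ⊗ W') = (ρ.app W ⊗ₘ ρ.app W') ≫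
        freeμ H (T.obj (ω.obj W)) (T.obj (ω.obj W')) ≫
          H ◁ (Functor.LaxMonoidal.μ T _ _ ≫ T.map (Functor.LaxMonoidal.μ ω W W')) := by
      have : 𝟙 _ ≫ ρ.app (W ⊗ W') = _ := NatTrans.IsMonoidal.tensor (τ := ρ) W W'
      rw [Category.id_comp] at this
      exact this
    have hυ : Functor.LaxMonoidal.μ F _ _ ≫ F.map (Functor.LaxMonoidal.μ T _ _) ≫
        υ.app (ω.obj W ⊗ ω.obj W') =
        (υ.app (ω.obj W) ⊗ₘ υ.app (ω.obj W')) ≫ Functor.LaxMonoidal.μ U _ _ := by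
      have : (Functor.LaxMonoidal.μ F _ _ ≫ F.map (Functor.LaxMonoidal.μ T _ _)) ≫
        υ.app (ω.obj W ⊗ ω.obj W') = _ := NatTrans.IsMonoidal.tensor (τ := υ) _ _
      rwa [Category.assoc] at this
    have hυ' : F.map (T.map (Functor.LaxMonoidal.μ ω W W')) ≫ υ.app (ω.obj (W ⊗ W')) =
      υ.app (ω.obj W ⊗ ω.obj W') ≫ U.map (Functor.LaxMonoidal.μ ω W W') := υ.naturality _
    change Functor.LaxMonoidal.μ F W W' ≫ mapKl F b (ρ.app (W ⊗ W')) ≫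
      A ◁ υ.app (ω.obj (W ⊗ W')) =
        ((mapKl F b (ρ.app W) ≫ A ◁ υ.app (ω.obj W)) ⊗ₘ
          (mapKl F b (ρ.app W') ≫ A ◁ υ.app (ω.obj W'))) ≫
        freeμ A _ _ ≫ A ◁ (Functor.LaxMonoidal.μ U _ _ ≫ U.map (Functor.LaxMonoidal.μ ω W W'))
    refine (congrArg (fun z => Functor.LaxMonoidal.μ F W W' ≫ mapKl F b z ≫ _) hρ).trans ?_
    have e : mapKl F b ((ρ.app W ⊗ₘ ρ.app W') ≫
        freeμ H (T.obj (ω.obj W)) (T.obj (ω.obj W')) ≫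
          H ◁ (Functor.LaxMonoidal.μ T _ _ ≫ T.map (Functor.LaxMonoidal.μ ω W W'))) =
        mapKl F b ((ρ.app W ⊗ₘ ρ.app W') ≫ freeμ H (T.obj (ω.obj W)) (T.obj (ω.obj W'))) ≫
          A ◁ F.map (Functor.LaxMonoidal.μ T _ _ ≫ T.map (Functor.LaxMonoidal.μ ω W W')) := by
      rw [← mapKl_comp_whiskerLeft, Category.assoc]
    have e' : Functor.LaxMonoidal.μ F W W' ≫
        mapKl F b ((ρ.app W ⊗ₘ ρ.app W') ≫ freeμ H (T.obj (ω.obj W)) (T.obj (ω.obj W'))) = _ :=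
      mapKl_tensor F b (ρ.app W) (ρ.app W')
    rw [e, Category.assoc, reassoc_of% e', ← MonoidalCategory.whiskerLeft_comp,
      ← MonoidalCategory.whiskerLeft_comp, ← tensorHom_comp_tensorHom, Category.assoc]
    have e'' : Functor.LaxMonoidal.μ F (T.obj (ω.obj W)) (T.obj (ω.obj W')) ≫
        F.map (Functor.LaxMonoidal.μ T _ _ ≫ T.map (Functor.LaxMonoidal.μ ω W W')) ≫
          υ.app (ω.obj (W ⊗ W')) = (υ.app (ω.obj W) ⊗ₘ υ.app (ω.obj W')) ≫
            Functor.LaxMonoidal.μ U _ _ ≫ U.map (Functor.LaxMonoidal.μ ω W W') := by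
      rw [Functor.map_comp_assoc, hυ', reassoc_of% hυ]
    refine (congrArg (fun z => _ ≫ freeμ A _ _ ≫ A ◁ z) e'').trans ?_
    rw [MonoidalCategory.whiskerLeft_comp, reassoc_of% freeμ_natural A]
    rfl

end Twist

section TwistComp

universe v₁ u₁ v₂ u₂ v₃ u₃

variable {D : Type u₂} [Category.{v₂} D] [MonoidalCategory D] [BraidedCategory D]
  {M : Type u₃} [Category.{v₃} M] [MonoidalCategory M]
  {C : Type u₁} [Category.{v₁} C] [MonoidalCategory C] [BraidedCategory C]
  {H : D} [MonObj H] {A : C} [MonObj A]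
  {ω : D ⥤ M} [ω.Monoidal] {T : M ⥤ D} [T.Monoidal]
  (ρ : 𝟭 D ⟶ (ω ⋙ T) ⋙ tensorLeft H) (κ : T ⋙ ω ⟶ 𝟭 M)

/-- The underlying coaction of an object. -/
def coaction (W : D) : ω.obj W ⟶ ω.obj H ⊗ ω.obj W :=
  ω.map (ρ.app W) ≫ Functor.OplaxMonoidal.δ ω H (T.obj (ω.obj W)) ≫ ω.obj H ◁ κ.app (ω.obj W)

/-- The comparison `T ⋙ ω ⋙ U ⟶ U` for a retraction `κ` of `T`. -/
def retract (U : M ⥤ C) : T ⋙ ω ⋙ U ⟶ U :=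
  Functor.whiskerRight κ U

instance [NatTrans.IsMonoidal κ] (U : M ⥤ C) [U.Monoidal] :
    NatTrans.IsMonoidal (retract κ U) where
  unit := by
    have h : (ε ω ≫ ω.map (ε T)) ≫ κ.app (𝟙_ M) = 𝟙 _ := NatTrans.IsMonoidal.unit (τ := κ)
    change ((ε U ≫ U.map (ε ω)) ≫ U.map (ω.map (ε T))) ≫ U.map (κ.app (𝟙_ M)) = ε U
    rw [Category.assoc, Category.assoc, ← Functor.map_comp, ← Functor.map_comp, ← Category.assoc]
    refine (congrArg (fun z => ε U ≫ U.map z) h).trans ?_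
    simp
  tensor X Y := by
    have h : (Functor.LaxMonoidal.μ ω _ _ ≫ ω.map (Functor.LaxMonoidal.μ T X Y)) ≫ κ.app (X ⊗ Y) =
      (κ.app X ⊗ₘ κ.app Y) ≫ 𝟙 _ := NatTrans.IsMonoidal.tensor (τ := κ) X Y
    change ((Functor.LaxMonoidal.μ U _ _ ≫ U.map (Functor.LaxMonoidal.μ ω _ _)) ≫
      U.map (ω.map (Functor.LaxMonoidal.μ T X Y))) ≫ U.map (κ.app (X ⊗ Y)) =
      (U.map (κ.app X) ⊗ₘ U.map (κ.app Y)) ≫ Functor.LaxMonoidal.μ U X Y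
    rw [Category.assoc, Category.assoc, ← Functor.map_comp, ← Functor.map_comp, ← Category.assoc]
    refine (congrArg (fun z => Functor.LaxMonoidal.μ U _ _ ≫ U.map z) h).trans ?_
    rw [Category.comp_id]
    exact (Functor.LaxMonoidal.μ_natural U _ _).symm

theorem twist_retract (U : M ⥤ C) [U.Monoidal] (c : U.obj (ω.obj H) ⟶ A) (W : D) :
    (twist ρ (ω ⋙ U) c (retract κ U)).app W =
      U.map (coaction ρ κ W) ≫ Functor.OplaxMonoidal.δ U (ω.obj H) (ω.obj W) ≫
        c ▷ U.obj (ω.obj W) := by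
  have h := Functor.OplaxMonoidal.δ_natural_right U (ω.obj H) (κ.app (ω.obj W))
  change (U.map (ω.map (ρ.app W)) ≫ (U.map (Functor.OplaxMonoidal.δ ω H (T.obj (ω.obj W))) ≫
    Functor.OplaxMonoidal.δ U (ω.obj H) (ω.obj (T.obj (ω.obj W)))) ≫ c ▷ _) ≫
      A ◁ U.map (κ.app (ω.obj W)) = _
  rw [coaction, Functor.map_comp, Functor.map_comp]
  simp only [Category.assoc]
  rw [← whisker_exchange]
  have h' := congrArg (· ≫ c ▷ U.obj (ω.obj W)) h
  simp only [Category.assoc] at h'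
  exact congrArg (fun z => _ ≫ _ ≫ z) h'

/-- Acting by `b` and then by `c` is acting by their convolution. The hypothesis `hco` is
coassociativity: coacting twice on `W` is coacting once and then comultiplying in `H`. -/
theorem twist_comp_retract (F : D ⥤ C) [F.Monoidal] (U : M ⥤ C) [U.Monoidal] (b : F.obj H ⟶ A)
    (υ : T ⋙ F ⟶ U) [NatTrans.IsMonoidal υ] (c : U.obj (ω.obj H) ⟶ A) (W : D)
    (hco : ρ.app W ≫ H ◁ (T.map (coaction ρ κ W) ≫ Functor.OplaxMonoidal.δ T (ω.obj H) (ω.obj W)) =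
      ρ.app W ≫ (ρ.app H ▷ T.obj (ω.obj W) : H ⊗ T.obj (ω.obj W) ⟶ (H ⊗ T.obj (ω.obj H)) ⊗ _) ≫
        (α_ H (T.obj (ω.obj H)) (T.obj (ω.obj W))).hom) :
    kl A ((twist ρ F b υ).app W) ((twist ρ (ω ⋙ U) c (retract κ U)).app W) =
      (twist ρ F ((twist ρ F b υ).app H ≫ A ◁ c ≫ μ[A]) υ).app W := by
  have h1 : υ.app (ω.obj W) ≫ U.map (coaction ρ κ W) =
      F.map (T.map (coaction ρ κ W)) ≫ υ.app (ω.obj H ⊗ ω.obj W) := (υ.naturality _).symm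
  have h2 : υ.app (ω.obj H ⊗ ω.obj W) ≫ Functor.OplaxMonoidal.δ U (ω.obj H) (ω.obj W) =
      F.map (Functor.OplaxMonoidal.δ T (ω.obj H) (ω.obj W)) ≫
        Functor.OplaxMonoidal.δ F (T.obj (ω.obj H)) (T.obj (ω.obj W)) ≫
          (υ.app (ω.obj H) ⊗ₘ υ.app (ω.obj W)) := by
    have : (Functor.LaxMonoidal.μ F _ _ ≫ F.map (Functor.LaxMonoidal.μ T _ _)) ≫
      υ.app (ω.obj H ⊗ ω.obj W) = _ := NatTrans.IsMonoidal.tensor (τ := υ) _ _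
    rw [← cancel_mono (Functor.LaxMonoidal.μ U (ω.obj H) (ω.obj W))]
    simp only [Category.assoc, Functor.Monoidal.δ_μ, Category.comp_id]
    refine Eq.trans ?_ (congrArg (fun z => F.map (Functor.OplaxMonoidal.δ T _ _) ≫
      Functor.OplaxMonoidal.δ F _ _ ≫ z) this)
    simp only [Category.assoc, Functor.Monoidal.δ_μ_assoc]
    rw [← Functor.map_comp_assoc, Functor.Monoidal.δ_μ, CategoryTheory.Functor.map_id, Category.id_comp]
  have h3 := congrArg (fun z => mapKl F b z) hco
  -- The second twist is pulled back through `υ` into the image of `F`, so that `hco` can be applied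
  -- in `D` before `F`.
  have h4 : υ.app (ω.obj W) ≫ U.map (coaction ρ κ W) ≫
      Functor.OplaxMonoidal.δ U (ω.obj H) (ω.obj W) ≫ c ▷ U.obj (ω.obj W) =
      F.map (T.map (coaction ρ κ W) ≫ Functor.OplaxMonoidal.δ T (ω.obj H) (ω.obj W)) ≫
        Functor.OplaxMonoidal.δ F (T.obj (ω.obj H)) (T.obj (ω.obj W)) ≫
          ((υ.app (ω.obj H) ≫ c) ⊗ₘ υ.app (ω.obj W)) := by
    have h1' := congrArg (· ≫ Functor.OplaxMonoidal.δ U (ω.obj H) (ω.obj W) ≫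
      c ▷ U.obj (ω.obj W)) h1
    have h2' := congrArg (fun z => F.map (T.map (coaction ρ κ W)) ≫ z ≫ c ▷ U.obj (ω.obj W)) h2
    simp only [Category.assoc, tensorHom_comp_whiskerRight] at h1' h2'
    rw [Functor.map_comp_assoc]
    exact h1'.trans h2'
  have h5 : mapKl F b (ρ.app W) ≫
      A ◁ F.map (T.map (coaction ρ κ W) ≫ Functor.OplaxMonoidal.δ T (ω.obj H) (ω.obj W)) =
      mapKl F b (ρ.app W ≫ ρ.app H ▷ T.obj (ω.obj W) ≫
        (α_ H (T.obj (ω.obj H)) (T.obj (ω.obj W))).hom) :=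
    (mapKl_comp_whiskerLeft F b _ _).symm.trans h3
  have h6 : mapKl F b (ρ.app W ≫ ρ.app H ▷ T.obj (ω.obj W) ≫
        (α_ H (T.obj (ω.obj H)) (T.obj (ω.obj W))).hom) ≫ A ◁ Functor.OplaxMonoidal.δ F _ _ = _ :=
    mapKl_whiskerRight F b (ρ.app W) (ρ.app H)
  rw [twist_retract, kl, twist_app, twist_app]
  change (mapKl F b (ρ.app W) ≫ A ◁ υ.app (ω.obj W)) ≫ A ◁ (U.map (coaction ρ κ W) ≫
      Functor.OplaxMonoidal.δ U (ω.obj H) (ω.obj W) ≫ c ▷ U.obj (ω.obj W)) ≫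
        freeActApp A (U.obj (ω.obj W)) = _
  rw [Category.assoc, ← MonoidalCategory.whiskerLeft_comp_assoc, h4,
    MonoidalCategory.whiskerLeft_comp, MonoidalCategory.whiskerLeft_comp, Category.assoc,
    Category.assoc, reassoc_of% h5, reassoc_of% h6]
  refine (congrArg (fun z => F.map (ρ.app W) ≫ Functor.OplaxMonoidal.δ F _ _ ≫ z)
    (whiskerRight_freeActApp (mapKl F b (ρ.app H)) (υ.app (ω.obj H) ≫ c)
      (υ.app (ω.obj W)))).trans ?_
  have h7 : (twist ρ F b υ).app H ≫ A ◁ c ≫ μ[A] =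
      mapKl F b (ρ.app H) ≫ A ◁ (υ.app (ω.obj H) ≫ c) ≫ μ[A] := by
    rw [twist_app, MonoidalCategory.whiskerLeft_comp]
    simp only [Category.assoc]
  rw [← h7]
  simp only [mapKl, Category.assoc]
  rfl

end TwistComp

/-! ### Cocontinuous functors on modules and the functor `free`. -/

section ModuleInduction

variable {R : Type u} [CommRing R]

/-- The morphism out of the ring classified by an element. -/
def elt {W : ModuleCat.{u} R} (x : W) : 𝟙_ (ModuleCat.{u} R) ⟶ W :=
  ModuleCat.ofHom (LinearMap.toSpanSingleton R W x)

@[simp]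
theorem elt_apply {W : ModuleCat.{u} R} (x : W) (r : R) : (elt x).hom r = r • x := rfl

theorem elt_comp {W W' : ModuleCat.{u} R} (x : W) (f : W ⟶ W') : elt x ≫ f = elt (f.hom x) := by
  ext
  simp [elt]

/-- Every module is a cokernel of a morphism between free modules. -/
theorem moduleCat_induction (P : ObjectProperty (ModuleCat.{u} R))
    (hfree : ∀ (I : Type u), P (∐ fun _ : I => 𝟙_ (ModuleCat.{u} R)))
    (hcoker : ∀ {X Y : ModuleCat.{u} R} (f : X ⟶ Y) (c : CokernelCofork f), IsColimit c →
      P X → P Y → P c.pt) (W : ModuleCat.{u} R) : P W := by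
  -- All elements of `S` serve as generators; applied to the whole module and then to the kernel
  -- this gives a free presentation.
  have key : ∀ (N : ModuleCat.{u} R) (S : Submodule R N),
      ∃ (I : Type u) (g : (∐ fun _ : I => 𝟙_ (ModuleCat.{u} R)) ⟶ N), LinearMap.range g.hom = S := by
    intro N S
    refine ⟨S, Sigma.desc fun s => elt s.1, le_antisymm ?_ ?_⟩
    · let g' : (∐ fun _ : S => 𝟙_ (ModuleCat.{u} R)) ⟶ ModuleCat.of R S := Sigma.desc fun s => elt s
      have : g' ≫ ModuleCat.ofHom S.subtype = Sigma.desc fun s => elt s.1 := by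
        refine Sigma.hom_ext _ _ fun s => ?_
        rw [Sigma.ι_desc_assoc, Sigma.ι_desc, elt_comp]
        rfl
      rw [← this]
      rintro _ ⟨y, rfl⟩
      exact (g'.hom y).2
    · intro s hs
      refine ⟨(Sigma.ι (fun _ : S => 𝟙_ (ModuleCat.{u} R)) ⟨s, hs⟩).hom (1 : R), ?_⟩
      rw [← ModuleCat.comp_apply, Sigma.ι_desc]
      simp
  obtain ⟨I, g, hg⟩ := key W ⊤
  obtain ⟨J, f, hf⟩ := key _ (LinearMap.ker g.hom)
  exact hcoker f _ (ModuleCat.isColimitCokernelCofork f g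
    (LinearMap.exact_iff.2 hf.symm) (LinearMap.range_eq_top.1 hg)) (hfree _) (hfree _)

/-- A transformation of cocontinuous functors on modules is invertible if it is so at the ring. -/
theorem isIso_of_isIso_unit {C : Type*} [Category* C] {F G : ModuleCat.{u} R ⥤ C}
    [PreservesColimitsOfSize.{u, u} F] [PreservesColimitsOfSize.{u, u} G]
    [PreservesColimitsOfSize.{0, 0} F] [PreservesColimitsOfSize.{0, 0} G] (τ : F ⟶ G)
    [IsIso (τ.app (𝟙_ _))] : IsIso τ := by
  rw [NatTrans.isIso_iff_isIso_app]
  refine moduleCat_induction (fun W => IsIso (τ.app W)) (fun I => ?_) fun {X Y} f c hc hX hY => ?_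
  · have : IsIso (Functor.whiskerLeft (Discrete.functor fun _ : I => 𝟙_ (ModuleCat.{u} R)) τ) := by
      rw [NatTrans.isIso_iff_isIso_app]
      rintro ⟨i⟩
      exact ‹IsIso (τ.app (𝟙_ _))›
    exact isIso_app_coconePt_of_preservesColimit _ τ _ (colimit.isColimit _)
  · have : IsIso (Functor.whiskerLeft (parallelPair f 0) τ) := by
      rw [NatTrans.isIso_iff_isIso_app]
      rintro (_ | _)
      exacts [hX, hY]
    exact isIso_app_coconePt_of_preservesColimit _ τ _ hc

end ModuleInduction

section SectionProduct

variable {R : Type u} [CommRing R] {C : Type w} [Category.{u} C] [MonoidalCategory C]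

/-- The product of two global sections. -/
def secMul {X Y : C} (a : 𝟙_ C ⟶ X) (b : 𝟙_ C ⟶ Y) : 𝟙_ C ⟶ X ⊗ Y :=
  (λ_ (𝟙_ C)).inv ≫ (a ⊗ₘ b)

section Additive

variable [Preadditive C] [MonoidalPreadditive C]

theorem secMul_add_left {X Y : C} (a a' : 𝟙_ C ⟶ X) (b : 𝟙_ C ⟶ Y) :
    secMul (a + a') b = secMul a b + secMul a' b := by
  simp [secMul, MonoidalPreadditive.add_tensor]

theorem secMul_add_right {X Y : C} (a : 𝟙_ C ⟶ X) (b b' : 𝟙_ C ⟶ Y) :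
    secMul a (b + b') = secMul a b + secMul a b' := by
  simp [secMul, MonoidalPreadditive.tensor_add]

variable [Linear R C] [MonoidalLinear R C]

theorem secMul_smul_left {X Y : C} (r : R) (a : 𝟙_ C ⟶ X) (b : 𝟙_ C ⟶ Y) :
    secMul (r • a) b = r • secMul a b := by
  simp [secMul, MonoidalCategory.tensorHom_def]

theorem secMul_smul_right {X Y : C} (r : R) (a : 𝟙_ C ⟶ X) (b : 𝟙_ C ⟶ Y) :
    secMul a (r • b) = r • secMul a b := by
  simp [secMul, MonoidalCategory.tensorHom_def]

end Additive

theorem secMul_comp {X X' Y Y' : C} (a : 𝟙_ C ⟶ X) (b : 𝟙_ C ⟶ Y) (f : X ⟶ X') (g : Y ⟶ Y') :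
    secMul a b ≫ (f ⊗ₘ g) = secMul (a ≫ f) (b ≫ g) := by
  simp [secMul]

theorem secMul_assoc {X Y Z : C} (a : 𝟙_ C ⟶ X) (b : 𝟙_ C ⟶ Y) (c : 𝟙_ C ⟶ Z) :
    secMul (secMul a b) c ≫ (α_ X Y Z).hom = secMul a (secMul b c) := by
  simp only [secMul, Category.assoc]
  rw [← Category.id_comp c, ← tensorHom_comp_tensorHom, Category.assoc, associator_naturality,
    Category.id_comp, ← Category.id_comp a, ← tensorHom_comp_tensorHom, Category.id_comp,
    tensorHom_id, id_tensorHom]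
  simp [unitors_inv_equal]

theorem secMul_id_left {X : C} (a : 𝟙_ C ⟶ X) : secMul (𝟙 (𝟙_ C)) a ≫ (λ_ X).hom = a := by
  simp [secMul]

theorem secMul_id_right {X : C} (a : 𝟙_ C ⟶ X) : secMul a (𝟙 (𝟙_ C)) ≫ (ρ_ X).hom = a := by
  simp [secMul, unitors_inv_equal]

theorem secMul_braiding [BraidedCategory C] {X Y : C} (a : 𝟙_ C ⟶ X) (b : 𝟙_ C ⟶ Y) :
    secMul a b ≫ (β_ X Y).hom = secMul b a := by
  rw [secMul, Category.assoc, BraidedCategory.braiding_naturality, secMul]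
  simp [unitors_inv_equal]

end SectionProduct

section GlobalSections

variable (R : Type u) [CommRing R] (C : Type w) [Category.{u} C] [Preadditive C] [Linear R C]
  [MonoidalCategory C]

/-- The functor `Hom(𝟙, -)` with values in modules. -/
def sections : C ⥤ ModuleCat.{u} R :=
  (linearCoyoneda R C).obj (Opposite.op (𝟙_ C))

instance : (sections R C).Additive :=
  inferInstanceAs ((linearCoyoneda R C).obj (Opposite.op (𝟙_ C))).Additive

instance : (sections R C).Linear R where
  map_smul f r := by
    ext a
    exact Linear.comp_smul _ _ _ _ _ _

variable [MonoidalPreadditive C] [MonoidalLinear R C]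

/-- The multiplication of global sections. -/
def sectionsμ (X Y : C) :
    (sections R C).obj X ⊗ (sections R C).obj Y ⟶ (sections R C).obj (X ⊗ Y) :=
  ModuleCat.ofHom (TensorProduct.lift (LinearMap.mk₂ R
    (fun (a : 𝟙_ C ⟶ X) (b : 𝟙_ C ⟶ Y) => secMul a b)
    (fun a a' b => secMul_add_left a a' b) (fun r a b => secMul_smul_left r a b)
    (fun a b b' => secMul_add_right a b b') (fun r a b => secMul_smul_right r a b)))

instance sectionsLax : (sections R C).LaxMonoidal := by
  refine ⟨elt (show (sections R C).obj (𝟙_ C) from 𝟙 (𝟙_ C)), fun X Y => sectionsμ R C X Y,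
    ?_, ?_, ?_, ?_, ?_⟩
  · intro X Y f Z
    refine ModuleCat.MonoidalCategory.tensor_ext fun a b => ?_
    refine Eq.trans ?_ (congrArg (secMul (a : 𝟙_ C ⟶ X) (b : 𝟙_ C ⟶ Z) ≫ ·) (tensorHom_id f Z))
    refine Eq.trans ?_ (secMul_comp (a : 𝟙_ C ⟶ X) (b : 𝟙_ C ⟶ Z) f (𝟙 Z)).symm
    exact congrArg (secMul (X := Y) (Y := Z) _) (Category.comp_id (b : 𝟙_ C ⟶ Z)).symm
  · intro X Y Z f
    refine ModuleCat.MonoidalCategory.tensor_ext fun a b => ?_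
    refine Eq.trans ?_ (congrArg (secMul (a : 𝟙_ C ⟶ Z) (b : 𝟙_ C ⟶ X) ≫ ·) (id_tensorHom Z f))
    refine Eq.trans ?_ (secMul_comp (a : 𝟙_ C ⟶ Z) (b : 𝟙_ C ⟶ X) (𝟙 Z) f).symm
    exact congrArg (secMul (X := Z) (Y := Y) · _) (Category.comp_id (a : 𝟙_ C ⟶ Z)).symm
  · intro X Y Z
    refine ModuleCat.MonoidalCategory.tensor_ext₃' fun a b c => ?_
    exact secMul_assoc (a : 𝟙_ C ⟶ X) (b : 𝟙_ C ⟶ Y) (c : 𝟙_ C ⟶ Z)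
  · intro X
    refine ModuleCat.MonoidalCategory.tensor_ext fun r a => ?_
    have h : ∀ (r : R) (a : 𝟙_ C ⟶ X), r • a = secMul (r • 𝟙 (𝟙_ C)) a ≫ (λ_ X).hom := fun r a => by
      rw [secMul_smul_left, Linear.smul_comp, secMul_id_left]
    exact h r a
  · intro X
    refine ModuleCat.MonoidalCategory.tensor_ext fun a r => ?_
    have h : ∀ (r : R) (a : 𝟙_ C ⟶ X), r • a = secMul a (r • 𝟙 (𝟙_ C)) ≫ (ρ_ X).hom := fun r a => by
      rw [secMul_smul_right, Linear.smul_comp, secMul_id_right]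
    exact h r a

instance [BraidedCategory C] : (sections R C).LaxBraided where
  braided X Y := by
    refine ModuleCat.MonoidalCategory.tensor_ext fun a b => ?_
    exact secMul_braiding (a : 𝟙_ C ⟶ X) (b : 𝟙_ C ⟶ Y)

end GlobalSections

section Free

variable (R : Type u) [CommRing R] (C : Type w) [Category.{u} C] [Preadditive C] [Linear R C]
  [MonoidalCategory C] [HasColimits C]

/-- The modules at which the left adjoint is defined are closed under colimits, and `R` is one of
them: maps from `R` to `Hom(𝟙, Y)` are maps `𝟙 ⟶ Y`. Free presentations give all modules. -/
instance : (sections R C).IsRightAdjoint := by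
  refine Functor.isRightAdjoint_of_leftAdjointObjIsDefined_eq_top ?_
  have hfree : (sections R C).leftAdjointObjIsDefined (𝟙_ (ModuleCat.{u} R)) := by
    refine ⟨𝟙_ C, ⟨{ homEquiv := fun {Y} => ?_, homEquiv_comp := ?_ }⟩⟩
    · exact { toFun := fun a => elt (show (sections R C).obj Y from a)
              invFun := fun f => f.hom (1 : R)
              left_inv := fun a => one_smul R _
              right_inv := fun f => by
                refine ModuleCat.hom_ext (LinearMap.ext_ring ?_)
                exact one_smul R _ }
    · intro Y Y' g f
      exact (elt_comp (R := R) (W := (sections R C).obj Y) f ((sections R C).map g)).symm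
  ext W
  refine ⟨fun _ => trivial, fun _ => ?_⟩
  revert W
  suffices ∀ W, (sections R C).leftAdjointObjIsDefined W from fun W _ => this W
  refine moduleCat_induction _ (fun I => ?_) fun {X Y} f c hc hX hY => ?_
  · exact Functor.leftAdjointObjIsDefined_colimit _ fun ⟨i⟩ => hfree
  · refine Functor.leftAdjointObjIsDefined_of_isColimit hc ?_
    rintro (_ | _)
    exacts [hX, hY]

/-- The cocontinuous functor from modules which sends the ring to the unit. -/
def free : ModuleCat.{u} R ⥤ C := (sections R C).leftAdjoint

/-- The adjunction between free objects and global sections. -/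
def freeAdj : free R C ⊣ sections R C := Adjunction.ofIsRightAdjoint _

instance : (free R C).IsLeftAdjoint := (freeAdj R C).isLeftAdjoint

instance : (free R C).Additive := (freeAdj R C).left_adjoint_additive

instance : (free R C).Linear R where
  map_smul f r := by
    apply ((freeAdj R C).homEquiv _ _).injective
    rw [Adjunction.homEquiv_unit, Adjunction.homEquiv_unit,
      Functor.map_smul (F := sections R C), Linear.comp_smul,
      ← Functor.comp_map, ← Functor.comp_map, ← (freeAdj R C).unit.naturality,
      ← (freeAdj R C).unit.naturality, Functor.id_map, Functor.id_map, Linear.smul_comp]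

variable [MonoidalPreadditive C] [MonoidalLinear R C]

/-- The oplax monoidal structure of the left adjoint of a lax monoidal functor. -/
abbrev freeOplax : (free R C).OplaxMonoidal := (freeAdj R C).leftAdjointOplaxMonoidal

section

attribute [local instance] freeOplax

theorem map_elt_comp_counit {Y : C} (a : 𝟙_ C ⟶ Y) :
    (freeAdj R C).homEquiv _ _ (Functor.OplaxMonoidal.η (free R C) ≫ a) =
      elt (show (sections R C).obj Y from a) := by
  rw [Adjunction.homEquiv_naturality_right]
  have : (freeAdj R C).homEquiv _ _ (Functor.OplaxMonoidal.η (free R C)) = ε (sections R C) :=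
    ((freeAdj R C).homEquiv _ _).apply_symm_apply _
  rw [this]
  refine (elt_comp _ _).trans (congrArg elt ?_)
  exact Category.id_comp a

/-- By Yoneda: maps out of `free R` and maps out of `𝟙` are both the global sections of the target,
and `map_elt_comp_counit` says that `η` realizes this identification. -/
instance : IsIso (Functor.OplaxMonoidal.η (free R C)) := by
  rw [isIso_iff_coyoneda_map_bijective]
  intro Y
  refine ⟨fun a b h => ?_, fun f => ?_⟩
  · have h' := congrArg ((freeAdj R C).homEquiv _ _) h
    simp only [map_elt_comp_counit] at h'
    have := congrArg (fun f => f.hom (1 : R)) h'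
    exact (one_smul R a).symm.trans (this.trans (one_smul R b))
  · refine ⟨((freeAdj R C).homEquiv _ _ f).hom (1 : R), ?_⟩
    apply ((freeAdj R C).homEquiv _ _).injective
    refine (map_elt_comp_counit R C _).trans ?_
    refine ModuleCat.hom_ext (LinearMap.ext_ring ?_)
    exact one_smul R _

/-- The oplax structure as a transformation in the first variable. -/
def freeδ (Y : ModuleCat.{u} R) : tensorRight Y ⋙ free R C ⟶ free R C ⋙ tensorRight ((free R C).obj Y) where
  app X := Functor.OplaxMonoidal.δ (free R C) X Y
  naturality _ _ f := (Functor.OplaxMonoidal.δ_natural_left (free R C) f Y).symm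

variable [MonoidalClosed C] [BraidedCategory C]

/-- Both sides are cocontinuous in `X`, since `C` is closed; so the case `X = R` suffices, and there
it is the unit constraint. -/
instance (X Y : ModuleCat.{u} R) : IsIso (Functor.OplaxMonoidal.δ (free R C) X Y) := by
  have : IsIso ((freeδ R C Y).app (𝟙_ _)) := by
    have h : Functor.OplaxMonoidal.δ (free R C) (𝟙_ _) Y = (free R C).map (λ_ Y).hom ≫
        (λ_ ((free R C).obj Y)).inv ≫ inv (Functor.OplaxMonoidal.η (free R C)) ▷ _ := by
      rw [Functor.OplaxMonoidal.left_unitality]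
      simp only [Category.assoc, ← comp_whiskerRight, IsIso.hom_inv_id, id_whiskerRight,
        Category.comp_id, Iso.map_hom_inv_id_assoc]
    change IsIso (Functor.OplaxMonoidal.δ (free R C) (𝟙_ _) Y)
    rw [h]
    infer_instance
  have := isIso_of_isIso_unit (freeδ R C Y)
  exact inferInstanceAs (IsIso ((freeδ R C Y).app X))

instance freeMonoidal : (free R C).Monoidal :=
  Functor.Monoidal.ofOplaxMonoidal _

end

variable [MonoidalClosed C]

instance [BraidedCategory C] : (freeAdj R C).IsMonoidal :=
  have : @Adjunction.IsMonoidal _ _ _ _ _ _ _ _ (freeAdj R C) (freeOplax R C) _ := by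
    infer_instance
  ⟨this.leftAdjoint_ε, this.leftAdjoint_μ⟩

instance [SymmetricCategory C] : (free R C).Braided where
  braided X Y := by
    rw [← cancel_epi (Functor.OplaxMonoidal.δ (free R C) X Y),
      ← cancel_mono (Functor.OplaxMonoidal.δ (free R C) Y X)]
    simp only [Category.assoc, Functor.Monoidal.δ_μ_assoc, Functor.Monoidal.μ_δ, Category.comp_id]
    apply ((freeAdj R C).homEquiv _ _).injective
    rw [Adjunction.homEquiv_unit, Adjunction.homEquiv_unit, Functor.map_comp, Functor.map_comp,
      ← Functor.comp_map, ← (freeAdj R C).unit.naturality_assoc, Functor.id_map,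
      Adjunction.unit_app_tensor_comp_map_δ,
      Adjunction.unit_app_tensor_comp_map_δ_assoc, Functor.LaxBraided.braided,
      BraidedCategory.braiding_naturality_assoc]

variable {R C}

section

variable [BraidedCategory C]

/-- The global section of a free object which is given by an element of the module. -/
def freeElt {W : ModuleCat.{u} R} (x : W) : 𝟙_ C ⟶ (free R C).obj W :=
  ((freeAdj R C).unit.app W).hom x

theorem freeElt_comp {W W' : ModuleCat.{u} R} (x : W) (f : W ⟶ W') :
    freeElt x ≫ (free R C).map f = freeElt (f.hom x) :=
  (LinearMap.congr_fun (congrArg ModuleCat.Hom.hom ((freeAdj R C).unit.naturality f)) x).symm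

theorem free_hom_ext {W : ModuleCat.{u} R} {Y : C} {f g : (free R C).obj W ⟶ Y}
    (h : ∀ x : W, freeElt x ≫ f = freeElt x ≫ g) : f = g := by
  apply ((freeAdj R C).homEquiv _ _).injective
  ext x
  exact h x

theorem secMul_freeElt {W W' : ModuleCat.{u} R} (x : W) (y : W') :
    secMul (freeElt x) (freeElt y) = freeElt (C := C) (show (W ⊗ W' : ModuleCat.{u} R) from x ⊗ₜ y) ≫
      Functor.OplaxMonoidal.δ (free R C) W W' :=
  (LinearMap.congr_fun (congrArg ModuleCat.Hom.hom
    ((freeAdj R C).unit_app_tensor_comp_map_δ W W')) (x ⊗ₜ y)).symm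

theorem freeElt_one : freeElt (show 𝟙_ (ModuleCat.{u} R) from (1 : R)) = ε (free R C) := by
  have h : (freeAdj R C).unit.app (𝟙_ _) ≫
      (sections R C).map (Functor.OplaxMonoidal.η (free R C)) = ε (sections R C) :=
    (freeAdj R C).unit_app_unit_comp_map_η
  rw [← cancel_mono (Functor.OplaxMonoidal.η (free R C)), Functor.Monoidal.ε_η]
  refine (LinearMap.congr_fun (congrArg ModuleCat.Hom.hom h) (1 : R)).trans ?_
  exact one_smul R _

theorem free_tensor_hom_ext {W W' : ModuleCat.{u} R} {Y : C}
    {f g : (free R C).obj (W ⊗ W') ⟶ Y}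
    (h : ∀ (x : W) (y : W'), freeElt (show (W ⊗ W' : ModuleCat.{u} R) from x ⊗ₜ y) ≫ f =
      freeElt (show (W ⊗ W' : ModuleCat.{u} R) from x ⊗ₜ y) ≫ g) : f = g := by
  apply ((freeAdj R C).homEquiv _ _).injective
  refine ModuleCat.MonoidalCategory.tensor_ext fun x y => ?_
  exact h x y

theorem exists_freeElt_comp {W : ModuleCat.{u} R} {Y : C} (s : W →ₗ[R] (𝟙_ C ⟶ Y)) :
    ∃ f : (free R C).obj W ⟶ Y, ∀ x, freeElt x ≫ f = s x := by
  refine ⟨((freeAdj R C).homEquiv _ _).symm (ModuleCat.ofHom (Y := (sections R C).obj Y) s),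
    fun x => ?_⟩
  have h := ((freeAdj R C).homEquiv _ _).apply_symm_apply
    (ModuleCat.ofHom (Y := (sections R C).obj Y) s)
  rw [Adjunction.homEquiv_unit] at h
  exact LinearMap.congr_fun (congrArg ModuleCat.Hom.hom h) x

end

section Comparison

variable [BraidedCategory C] (G : ModuleCat.{u} R ⥤ C) [G.Monoidal] [G.Additive] [G.Linear R]

/-- The global section of `G W` given by an element of `W`. -/
def imageElt (W : ModuleCat.{u} R) : W →ₗ[R] (𝟙_ C ⟶ G.obj W) where
  toFun x := ε G ≫ G.map (elt x)
  map_add' x y := by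
    rw [← Preadditive.comp_add, ← Functor.map_add]
    congr 2
    ext
    simp [elt]
  map_smul' r x := by
    rw [RingHom.id_apply, ← Linear.comp_smul, ← Functor.map_smul]
    congr 2
    ext
    simp [elt]

theorem imageElt_apply {W : ModuleCat.{u} R} (x : W) : imageElt G W x = ε G ≫ G.map (elt x) := rfl

theorem imageElt_comp {W W' : ModuleCat.{u} R} (x : W) (f : W ⟶ W') :
    imageElt G W x ≫ G.map f = imageElt G W' (f.hom x) := by
  rw [imageElt_apply, imageElt_apply, Category.assoc, ← Functor.map_comp, elt_comp]

theorem secMul_imageElt {W W' : ModuleCat.{u} R} (x : W) (y : W') :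
    secMul (imageElt G W x) (imageElt G W' y) ≫ Functor.LaxMonoidal.μ G W W' =
      imageElt G (W ⊗ W') (x ⊗ₜ y) := by
  have h : elt (show (W ⊗ W' : ModuleCat.{u} R) from x ⊗ₜ y) =
      (λ_ (𝟙_ (ModuleCat.{u} R))).inv ≫ (elt x ⊗ₘ elt y) := by
    refine ModuleCat.hom_ext (LinearMap.ext_ring ?_)
    change (1 : R) • (x ⊗ₜ[R] y) = ((1 : R) • x) ⊗ₜ[R] ((1 : R) • y)
    simp
  rw [imageElt_apply, imageElt_apply, imageElt_apply, secMul, ← tensorHom_comp_tensorHom,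
    Category.assoc, Category.assoc, Functor.LaxMonoidal.μ_natural]
  refine Eq.trans ?_ (congrArg (fun f => ε G ≫ G.map f) h.symm)
  rw [Functor.map_comp, Functor.Monoidal.map_leftUnitor_inv, MonoidalCategory.tensorHom_def']
  simp

/-- The comparison of `free` with a monoidal functor on modules. -/
def freeTo : free R C ⟶ G where
  app W := (exists_freeElt_comp (imageElt G W)).choose
  naturality W W' f := by
    refine free_hom_ext fun x => ?_
    rw [← Category.assoc, freeElt_comp, (exists_freeElt_comp (imageElt G W')).choose_spec,
      reassoc_of% (exists_freeElt_comp (imageElt G W)).choose_spec, imageElt_comp]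

theorem freeElt_freeTo {W : ModuleCat.{u} R} (x : W) :
    freeElt x ≫ (freeTo G).app W = ε G ≫ G.map (elt x) :=
  (exists_freeElt_comp (imageElt G W)).choose_spec x

theorem ε_freeTo : ε (free R C) ≫ (freeTo G).app (𝟙_ _) = ε G := by
  have h : elt (show 𝟙_ (ModuleCat.{u} R) from (1 : R)) = 𝟙 _ :=
    ModuleCat.hom_ext (LinearMap.ext_ring (one_smul R _))
  rw [← freeElt_one, freeElt_freeTo, h, CategoryTheory.Functor.map_id, Category.comp_id]

instance : NatTrans.IsMonoidal (freeTo G) where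
  unit := ε_freeTo G
  tensor W W' := by
    rw [← cancel_epi (Functor.OplaxMonoidal.δ (free R C) W W'), Functor.Monoidal.δ_μ_assoc]
    refine free_tensor_hom_ext fun x y => ?_
    rw [← reassoc_of% secMul_freeElt x y, reassoc_of% secMul_comp, freeElt_freeTo, freeElt_freeTo,
      freeElt_freeTo]
    exact (secMul_imageElt G x y).symm

/-- At `R` the comparison relates the unit constraints of two strong monoidal functors. Thus a
cocontinuous linear monoidal functor on modules is canonically `free`. -/
theorem isIso_freeTo [PreservesColimitsOfSize.{u, u} G] [PreservesColimitsOfSize.{0, 0} G] :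
    IsIso (freeTo G) := by
  have : IsIso ((freeTo G).app (𝟙_ _)) := by
    have : IsIso (ε (free R C) ≫ (freeTo G).app (𝟙_ _)) := by
      rw [ε_freeTo]
      infer_instance
    exact IsIso.of_isIso_comp_left (ε (free R C)) _
  exact isIso_of_isIso_unit _

end Comparison

end Free

open scoped Obj

section ExtIso

variable {C : Type*} [Category* C] [MonoidalCategory C] {A : C} [MonObj A]

/-- Converse of `KlIso.isIso`: the inverse of an `A`-linear isomorphism is `A`-linear, hence is the
extension of its restriction along the unit. -/
theorem KlIso.of_isIso_ext {X Y : C} (f : X ⟶ A ⊗ Y) [IsIso (A ◁ f ≫ freeActApp A Y)] :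
    KlIso f := by
  have h : freeActApp A X ≫ A ◁ f ≫ freeActApp A Y =
      A ◁ (A ◁ f ≫ freeActApp A Y) ≫ freeActApp A Y := by
    rw [← reassoc_of% freeActApp_naturality A f, freeActApp_assoc,
      MonoidalCategory.whiskerLeft_comp_assoc]
  have h' : A ◁ inv (A ◁ f ≫ freeActApp A Y) ≫ freeActApp A X =
      freeActApp A Y ≫ inv (A ◁ f ≫ freeActApp A Y) := by
    rw [← cancel_epi (A ◁ (A ◁ f ≫ freeActApp A Y)), ← reassoc_of% h,
      ← MonoidalCategory.whiskerLeft_comp_assoc]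
    simp only [IsIso.hom_inv_id, MonoidalCategory.whiskerLeft_id, Category.id_comp]
    rw [← Category.assoc (A ◁ f), IsIso.hom_inv_id, Category.comp_id]
  refine ⟨freeUnitApp A Y ≫ inv (A ◁ f ≫ freeActApp A Y), ?_, ?_⟩
  · rw [RepGL.kl, MonoidalCategory.whiskerLeft_comp_assoc, h',
      reassoc_of% whiskerLeft_freeUnitApp_freeActApp A Y]
    rw [← cancel_mono (A ◁ f ≫ freeActApp A Y)]
    simp only [Category.assoc, IsIso.inv_hom_id, Category.comp_id]
    rw [← reassoc_of% freeUnitApp_naturality A f, freeUnitApp_freeActApp, Category.comp_id]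
  · rw [RepGL.kl, Category.assoc, IsIso.inv_hom_id, Category.comp_id]

end ExtIso

/-! ### Trivial, regular and cofree comodules; the coaction as a trivialization. -/

namespace Comod

variable {R : Type u} [CommRing R]

section Bialgebra

variable {H : Type u} [CommRing H] [Bialgebra R H]

variable (R H) in
/-- The comodule with the trivial coaction. -/
def trivial : ModuleCat.{u} R ⥤ Comod R H where
  obj N :=
    { carrier := N
      coact := TensorProduct.mk R H N 1
      coassoc := by
        refine LinearMap.ext fun r => ?_
        change TensorProduct.assoc R H H N
          ((Coalgebra.comul (R := R)).rTensor N ((1 : H) ⊗ₜ[R] r)) =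
          (TensorProduct.mk R H N 1).lTensor H ((1 : H) ⊗ₜ[R] r)
        simp [Algebra.TensorProduct.one_def]
      counit_coact := by
        refine LinearMap.ext fun r => ?_
        change TensorProduct.lid R N ((Coalgebra.counit (R := R)).rTensor N ((1 : H) ⊗ₜ[R] r)) = r
        simp }
  map f := ⟨f, rfl⟩

instance : (trivial R H).Additive where

instance : (trivial R H).Linear R where

instance : (trivial R H).Monoidal :=
  Functor.CoreMonoidal.toMonoidal
    { εIso := mkIso (Iso.refl _) (by
        refine LinearMap.ext fun r => ?_
        rfl)
      μIso := fun X Y => mkIso (Iso.refl _) (by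
        refine TensorProduct.ext' fun x y => ?_
        change (LinearMap.id).lTensor H (mulShuffle _ _ ((1 ⊗ₜ[R] x) ⊗ₜ[R] (1 ⊗ₜ[R] y))) =
          (1 : H) ⊗ₜ[R] (x ⊗ₜ[R] y)
        simp)
      μIso_hom_natural_left := fun _ _ => hom_ext rfl
      μIso_hom_natural_right := fun _ _ => hom_ext rfl
      associativity := fun X Y Z => hom_ext (by
        change (𝟙 (X ⊗ Y) ⊗ₘ 𝟙 Z) ≫ 𝟙 _ ≫ (α_ X Y Z).hom =
          (α_ X Y Z).hom ≫ (𝟙 X ⊗ₘ 𝟙 (Y ⊗ Z)) ≫ 𝟙 _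
        simp)
      left_unitality := fun X => hom_ext (by
        change (λ_ X).hom = (𝟙 _ ⊗ₘ 𝟙 X) ≫ 𝟙 _ ≫ (λ_ X).hom
        simp)
      right_unitality := fun X => hom_ext (by
        change (ρ_ X).hom = (𝟙 X ⊗ₘ 𝟙 _) ≫ 𝟙 _ ≫ (ρ_ X).hom
        simp) }

instance : (trivial R H).Braided where
  braided X Y := hom_ext (by
    change 𝟙 _ ≫ (β_ X Y).hom = (β_ X Y).hom ≫ 𝟙 _
    simp)

variable (R H) in
/-- The regular comodule. -/
def regular : Comod R H where
  carrier := ModuleCat.of R H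
  coact := Coalgebra.comul
  coassoc := Coalgebra.coassoc
  counit_coact := by
    refine LinearMap.ext fun h => ?_
    change TensorProduct.lid R H ((Coalgebra.counit (R := R)).rTensor H (Coalgebra.comul h)) = h
    simp

instance : MonObj (regular R H) where
  one := ⟨ModuleCat.ofHom (Algebra.linearMap R H), by
    refine LinearMap.ext_ring ?_
    change (1 : H) ⊗ₜ[R] algebraMap R H 1 = Coalgebra.comul (algebraMap R H 1)
    simp [Algebra.TensorProduct.one_def]⟩
  mul := ⟨ModuleCat.ofHom (LinearMap.mul' R H), by
    -- This reduces the compatibility of the product with the coaction to multiplicativity of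
    -- `Coalgebra.comul`.
    have key : ∀ x y : H ⊗[R] H, (LinearMap.mul' R H).lTensor H (mulShuffle H H (x ⊗ₜ y)) =
        x * y := by
      intro x y
      induction x with
      | zero => simp
      | add x x' hx hx' => simp only [map_add, TensorProduct.add_tmul, hx, hx', add_mul]
      | tmul a m =>
        induction y with
        | zero => simp
        | add y y' hy hy' => simp only [map_add, TensorProduct.tmul_add, hy, hy', mul_add]
        | tmul b n => simp
    have key2 : ∀ x y : H, (LinearMap.mul' R H).lTensor H
        (mulShuffle H H (Coalgebra.comul (R := R) x ⊗ₜ Coalgebra.comul (R := R) y)) =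
          Coalgebra.comul (R := R) (x * y) := fun x y => by rw [key, Bialgebra.comul_mul]
    exact TensorProduct.ext' fun x y => key2 x y⟩
  one_mul := hom_ext (ModuleCat.MonoidalCategory.tensor_ext 
    fun r x =>
      have h : ∀ (r : R) (x : H), algebraMap R H r * x = r • x := fun r x =>
        (Algebra.smul_def r x).symm
      h r x)
  mul_one := hom_ext (ModuleCat.MonoidalCategory.tensor_ext
    fun x r =>
    have h : ∀ (x : H) (r : R), x * algebraMap R H r = r • x := fun x r => by
      rw [Algebra.smul_def, _root_.mul_comm]
    h x r)
  mul_assoc := hom_ext (ModuleCat.MonoidalCategory.tensor_ext₃' 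
    fun (x y z : H) => _root_.mul_assoc x y z)

instance : IsCommMonObj (regular R H) where
  mul_comm := hom_ext (ModuleCat.MonoidalCategory.tensor_ext 
    fun (x y : H) => _root_.mul_comm y x)

variable (R H) in
/-- The coaction as a morphism of comodules. -/
def coactHom : 𝟭 (Comod R H) ⟶ (forget R H ⋙ trivial R H) ⋙ tensorLeft (regular R H) where
  app W := ⟨ModuleCat.ofHom W.coact, by
    -- On `H ⊗ W₀` with trivial `W₀` only the factor `H` is coacted upon, so the coaction is a
    -- morphism of comodules exactly by coassociativity.
    have key : ∀ t : H ⊗[R] W.carrier,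
        mulShuffle (R := R) H W.carrier (TensorProduct.map (Coalgebra.comul (R := R) (A := H))
          (TensorProduct.mk R H W.carrier 1) t) =
          TensorProduct.assoc R H H W.carrier
            ((Coalgebra.comul (R := R) (A := H)).rTensor W.carrier t) := by
      intro t
      induction t with
      | zero => simp
      | add x x' hx hx' => simp only [map_add, hx, hx']
      | tmul a m =>
        change mulShuffle (R := R) H W.carrier (Coalgebra.comul a ⊗ₜ[R] (1 ⊗ₜ[R] m)) =
          TensorProduct.assoc R H H W.carrier (Coalgebra.comul a ⊗ₜ[R] m)
        induction Coalgebra.comul (R := R) a with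
        | zero => simp
        | add x x' hx hx' => simp only [map_add, TensorProduct.add_tmul, hx, hx']
        | tmul b c => simp
    refine LinearMap.ext fun w => ?_
    exact (LinearMap.congr_fun W.coassoc w).symm.trans (key _).symm⟩
  naturality W W' f := hom_ext (ModuleCat.hom_ext f.comm.symm)

theorem freeμ_regular_hom (X Y : Comod R H) :
    (freeμ (regular R H) X Y).hom.hom = mulShuffle (R := R) (H := H) X.carrier Y.carrier :=
  TensorProduct.ext_fourfold' fun _ _ _ _ => rfl

instance : NatTrans.IsMonoidal (coactHom R H) where
  unit := hom_ext (ModuleCat.hom_ext (LinearMap.ext fun (r : R) => by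
    change (1 : H) ⊗ₜ[R] r = algebraMap R H 1 ⊗ₜ[R] r
    rw [map_one]))
  tensor W W' := hom_ext (ModuleCat.MonoidalCategory.tensor_ext fun x y => by
    refine (LinearMap.congr_fun (freeμ_regular_hom ((trivial R H).obj W.carrier)
      ((trivial R H).obj W'.carrier)) (W.coact x ⊗ₜ[R] W'.coact y)).symm.trans ?_
    exact (LinearMap.congr_fun (LinearMap.lTensor_id (R := R) H
      (TensorProduct R W.carrier W'.carrier)) _).symm)

variable (R H) in
/-- Forgetting the trivial coaction. -/
def trivialForget : trivial R H ⋙ forget R H ⟶ 𝟭 (ModuleCat.{u} R) := 𝟙 (𝟭 _)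

instance : NatTrans.IsMonoidal (trivialForget R H) where
  unit := rfl
  tensor _ _ := ModuleCat.MonoidalCategory.tensor_ext fun _ _ => rfl

theorem coaction_eq (W : Comod R H) :
    coaction (coactHom R H) (trivialForget R H) W = ModuleCat.ofHom W.coact := by
  refine ModuleCat.hom_ext (LinearMap.ext fun w => ?_)
  change (LinearMap.id).lTensor H (W.coact w) = W.coact w
  simp

/-- Coassociativity in the form required by `twist_comp_retract`. -/
theorem coactHom_coassoc (W : Comod R H) :
    (coactHom R H).app W ≫ (regular R H) ◁ ((trivial R H).map (coaction (coactHom R H) (trivialForget R H) W) ≫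
        Functor.OplaxMonoidal.δ (trivial R H) ((forget R H).obj (regular R H)) ((forget R H).obj W)) =
      (coactHom R H).app W ≫ (((coactHom R H).app (regular R H)) ▷ (trivial R H).obj ((forget R H).obj W) :
      (regular R H) ⊗ (trivial R H).obj ((forget R H).obj W) ⟶ ((regular R H) ⊗ (trivial R H).obj ((forget R H).obj (regular R H))) ⊗ _) ≫
        (α_ (regular R H) ((trivial R H).obj ((forget R H).obj (regular R H))) ((trivial R H).obj ((forget R H).obj W))).hom := by
  rw [coaction_eq]
  refine hom_ext (ModuleCat.hom_ext (LinearMap.ext fun w => ?_))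
  exact (LinearMap.congr_fun W.coassoc w).symm

/-- Invariant elements. -/
def invariants (W : Comod R H) : Submodule R W.carrier :=
  LinearMap.ker (W.coact - TensorProduct.mk R H W.carrier 1)

theorem mem_invariants {W : Comod R H} {w : W.carrier} :
    w ∈ invariants W ↔ W.coact w = 1 ⊗ₜ w := by
  rw [invariants, LinearMap.mem_ker, LinearMap.sub_apply, sub_eq_zero]
  rfl

variable (R H) in
/-- The invariants as a functor, right adjoint to the trivial coaction. -/
def invariantsFunctor : Comod R H ⥤ ModuleCat.{u} R where
  obj W := ModuleCat.of R (invariants W)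
  map {W W'} f := ModuleCat.ofHom (f.hom.hom.restrict fun w hw => by
    rw [mem_invariants] at hw ⊢
    have := LinearMap.congr_fun f.comm w
    rw [LinearMap.comp_apply, LinearMap.comp_apply, hw] at this
    exact this.symm)

variable (R H) in
/-- The trivial coaction is left adjoint to the invariants. -/
def trivialAdj : trivial R H ⊣ invariantsFunctor R H :=
  Adjunction.mkOfHomEquiv
    { homEquiv := fun _ W =>
        { toFun := fun f => ModuleCat.ofHom (f.hom.hom.codRestrict (invariants W) fun n =>
            mem_invariants.2 (LinearMap.congr_fun f.comm n).symm)
          invFun := fun g => ⟨ModuleCat.ofHom (Submodule.subtype _ ∘ₗ g.hom),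
            LinearMap.ext fun n => (mem_invariants.1 (g.hom n).2).symm⟩
          left_inv := fun _ => rfl
          right_inv := fun _ => rfl }
      homEquiv_naturality_left_symm := fun _ _ => rfl
      homEquiv_naturality_right := fun _ _ => rfl }

instance : (trivial R H).IsLeftAdjoint := (trivialAdj R H).isLeftAdjoint

variable (H) in
/-- The coaction on a cofree comodule. -/
def cofreeCoact (N : Type u) [AddCommGroup N] [Module R N] :
    H ⊗[R] N →ₗ[R] H ⊗[R] (H ⊗[R] N) :=
  (TensorProduct.assoc R H H N).toLinearMap ∘ₗ (Coalgebra.comul (R := R) (A := H)).rTensor N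

variable (R H) in
/-- The cofree comodule on a module. -/
def cofree : ModuleCat.{u} R ⥤ Comod R H where
  obj N :=
    { carrier := ModuleCat.of R (H ⊗[R] N)
      coact := cofreeCoact H N
      coassoc := by
        refine TensorProduct.ext' fun h n => ?_
        have key : ∀ t : H ⊗[R] H, TensorProduct.assoc R H H (H ⊗[R] N)
            ((Coalgebra.comul (R := R) (A := H)).rTensor (H ⊗[R] N)
              (TensorProduct.assoc R H H N (t ⊗ₜ n))) =
            ((TensorProduct.assoc R H H N).toLinearMap ∘ₗ
              (TensorProduct.mk R (H ⊗[R] H) N).flip n).lTensor H (TensorProduct.assoc R H H H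
                ((Coalgebra.comul (R := R) (A := H)).rTensor H t)) := by
          intro t
          induction t with
          | zero => simp
          | add x y hx hy => simp only [map_add, TensorProduct.add_tmul, hx, hy]
          | tmul a b =>
            simp only [TensorProduct.assoc_tmul, LinearMap.rTensor_tmul]
            induction Coalgebra.comul (R := R) a with
            | zero => simp
            | add x y hx hy => simp only [map_add, TensorProduct.add_tmul, hx, hy]
            | tmul c e => simp
        have key2 : ∀ t : H ⊗[R] H, (cofreeCoact H N).lTensor H
              (TensorProduct.assoc R H H N (t ⊗ₜ n)) =
            ((TensorProduct.assoc R H H N).toLinearMap ∘ₗ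
              (TensorProduct.mk R (H ⊗[R] H) N).flip n).lTensor H
                ((Coalgebra.comul (R := R) (A := H)).lTensor H t) := by
          intro t
          induction t with
          | zero => simp
          | add x y hx hy => simp only [map_add, TensorProduct.add_tmul, hx, hy]
          | tmul a b => simp [cofreeCoact]
        refine (key _).trans (Eq.trans ?_ (key2 _).symm)
        rw [Coalgebra.coassoc_apply]
      counit_coact := by
        refine TensorProduct.ext' fun h n => ?_
        have key : ∀ t : H ⊗[R] H, TensorProduct.lid R (H ⊗[R] N)
            ((Coalgebra.counit (R := R) (A := H)).rTensor (H ⊗[R] N)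
              (TensorProduct.assoc R H H N (t ⊗ₜ n))) =
            TensorProduct.lid R H ((Coalgebra.counit (R := R) (A := H)).rTensor H t) ⊗ₜ n := by
          intro t
          induction t with
          | zero => simp
          | add x y hx hy => simp only [map_add, TensorProduct.add_tmul, hx, hy]
          | tmul a b => simp [TensorProduct.smul_tmul']
        refine (key _).trans ?_
        simp }
  map {N N'} f := ⟨ModuleCat.ofHom (f.hom.lTensor H), by
    have key : ∀ (t : H ⊗[R] H) (n : N), (f.hom.lTensor H).lTensor H
        (TensorProduct.assoc R H H N (t ⊗ₜ n)) = TensorProduct.assoc R H H N' (t ⊗ₜ f.hom n) := by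
      intro t n
      induction t with
      | zero => simp
      | add x y hx hy => simp only [map_add, TensorProduct.add_tmul, hx, hy]
      | tmul a b => simp
    exact TensorProduct.ext' fun h n => key _ n⟩
  map_id N := hom_ext (ModuleCat.hom_ext (LinearMap.lTensor_id H N))
  map_comp f g := hom_ext (ModuleCat.hom_ext (LinearMap.lTensor_comp H g.hom f.hom))

variable (R H) in
/-- The cofree comodule is right adjoint to the forgetful functor. -/
def forgetAdj : forget R H ⊣ cofree R H :=
  Adjunction.mkOfUnitCounit
    { unit :=
        { app := fun W => ⟨ModuleCat.ofHom W.coact, W.coassoc.symm⟩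
          naturality := fun W W' f => hom_ext (ModuleCat.hom_ext f.comm.symm) }
      counit :=
        { app := fun N => ModuleCat.ofHom ((TensorProduct.lid R N).toLinearMap ∘ₗ
            (Coalgebra.counit (R := R) (A := H)).rTensor N)
          naturality := fun N N' f => ModuleCat.hom_ext (TensorProduct.ext' fun h n => by
            change TensorProduct.lid R N' (Coalgebra.counit (R := R) h ⊗ₜ[R] f.hom n) =
              f.hom (TensorProduct.lid R N (Coalgebra.counit (R := R) h ⊗ₜ[R] n))
            simp) }
      left_triangle := by
        ext W : 2
        exact (Category.id_comp _).trans (ModuleCat.hom_ext W.counit_coact)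
      right_triangle := by
        ext N : 2
        refine hom_ext (ModuleCat.hom_ext ?_)
        refine TensorProduct.ext' (R := R) (M := H) (N := N) fun h n => ?_
        have key : ∀ t : H ⊗[R] H, ((TensorProduct.lid R N).toLinearMap ∘ₗ
            (Coalgebra.counit (R := R) (A := H)).rTensor N).lTensor H
              (TensorProduct.assoc R H H N (t ⊗ₜ n)) =
            TensorProduct.rid R H ((Coalgebra.counit (R := R) (A := H)).lTensor H t) ⊗ₜ n := by
          intro t
          induction t with
          | zero => simp
          | add x y hx hy => simp only [map_add, TensorProduct.add_tmul, hx, hy]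
          | tmul a b => simp [TensorProduct.smul_tmul]
        refine (key _).trans ?_
        simp
        rfl }

instance : (forget R H).IsLeftAdjoint := (forgetAdj R H).isLeftAdjoint

instance : (forget R H).ReflectsIsomorphisms where
  reflects {W W'} f hf := by
    let e : W ≅ W' := mkIso (@asIso _ _ _ _ ((forget R H).map f) hf) f.comm
    exact e.isIso_hom

theorem isIso_of_bijective {W W' : Comod R H} (f : W ⟶ W')
    (h : Function.Bijective f.hom.hom) : IsIso f := by
  have : IsIso ((forget R H).map f) := (ConcreteCategory.isIso_iff_bijective _).2 h
  exact isIso_of_reflects_iso f (forget R H)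

end Bialgebra

section Hopf

variable {H : Type u} [CommRing H] [HopfAlgebra R H]

theorem freeActApp_regular_hom (X : Comod R H) :
    (freeActApp (regular R H) X).hom.hom =
      (LinearMap.mul' R H).rTensor X.carrier ∘ₗ
        (TensorProduct.assoc R H H X.carrier).symm.toLinearMap :=
  TensorProduct.ext (LinearMap.ext fun _ => TensorProduct.ext' fun _ _ => rfl)

/-- The inverse of the coaction over the Hopf algebra. -/
def antiCoact (W : Comod R H) : W.carrier →ₗ[R] H ⊗[R] W.carrier :=
  (HopfAlgebra.antipode R).rTensor W.carrier ∘ₗ W.coact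

/-- The extension of `f` to an `H`-linear map. -/
def extLin {M N : Type u} [AddCommGroup M] [Module R M] [AddCommGroup N] [Module R N]
    (f : M →ₗ[R] H ⊗[R] N) : H ⊗[R] M →ₗ[R] H ⊗[R] N :=
  (LinearMap.mul' R H).rTensor N ∘ₗ (TensorProduct.assoc R H H N).symm.toLinearMap ∘ₗ f.lTensor H

theorem extLin_tmul {M N : Type u} [AddCommGroup M] [Module R M] [AddCommGroup N] [Module R N]
    (f : M →ₗ[R] H ⊗[R] N) (h : H) (m : M) : extLin f (h ⊗ₜ m) = h • f m := by
  have key : ∀ t : H ⊗[R] N, (LinearMap.mul' R H).rTensor N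
      ((TensorProduct.assoc R H H N).symm (h ⊗ₜ t)) = h • t := by
    intro t
    induction t with
    | zero => simp
    | add x y hx hy => simp only [map_add, TensorProduct.tmul_add, hx, hy, smul_add]
    | tmul a n => simp [TensorProduct.smul_tmul']
  exact key (f m)

theorem extLin_smul {M N : Type u} [AddCommGroup M] [Module R M] [AddCommGroup N] [Module R N]
    (f : M →ₗ[R] H ⊗[R] N) (h : H) (t : H ⊗[R] M) : extLin f (h • t) = h • extLin f t := by
  induction t with
  | zero => simp
  | add x y hx hy => simp only [map_add, hx, hy, smul_add]
  | tmul a n => rw [TensorProduct.smul_tmul', extLin_tmul, extLin_tmul, smul_smul, smul_eq_mul]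

theorem rTensor_unit_counit {N : Type u} [AddCommGroup N] [Module R N] (t : H ⊗[R] N) :
    (Algebra.linearMap R H ∘ₗ Coalgebra.counit).rTensor N t =
      (1 : H) ⊗ₜ[R] TensorProduct.lid R N ((Coalgebra.counit (R := R) (A := H)).rTensor N t) := by
  induction t with
  | zero => simp
  | add x y hx hy => simp only [map_add, TensorProduct.tmul_add, hx, hy]
  | tmul a n => simp [Algebra.algebraMap_eq_smul_one, TensorProduct.smul_tmul]

/-- In Sweedler notation: `S(w₋₂) w₋₁ ⊗ w₀ = ε(w₋₁) ⊗ w₀ = 1 ⊗ w`, by coassociativity, the antipode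
axiom and counitality. The opposite composite uses the other antipode axiom. -/
theorem extLin_coact_antiCoact (W : Comod R H) (w : W.carrier) :
    extLin W.coact (antiCoact W w) = 1 ⊗ₜ w := by
  have key : ∀ t : H ⊗[R] W.carrier,
      extLin W.coact ((HopfAlgebra.antipode R).rTensor W.carrier t) =
        (LinearMap.mul' R H ∘ₗ (HopfAlgebra.antipode R).rTensor H).rTensor W.carrier
          ((TensorProduct.assoc R H H W.carrier).symm (W.coact.lTensor H t)) := by
    intro t
    induction t with
    | zero => simp
    | add x y hx hy => simp only [map_add, hx, hy]
    | tmul a m =>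
      rw [LinearMap.rTensor_tmul, extLin_tmul, LinearMap.lTensor_tmul]
      induction W.coact m with
      | zero => simp
      | add x y hx hy => simp only [map_add, TensorProduct.tmul_add, hx, hy, smul_add]
      | tmul b n => simp [TensorProduct.smul_tmul']
  have h := LinearMap.congr_fun W.coassoc w
  simp only [LinearMap.comp_apply, LinearEquiv.coe_coe] at h
  have h' := LinearMap.congr_fun W.counit_coact w
  simp only [LinearMap.comp_apply, LinearEquiv.coe_coe, LinearMap.id_apply] at h'
  rw [antiCoact, LinearMap.comp_apply, key, ← h, LinearEquiv.symm_apply_apply,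
    ← LinearMap.comp_apply (LinearMap.rTensor _ _), ← LinearMap.rTensor_comp,
    LinearMap.comp_assoc, HopfAlgebra.mul_antipode_rTensor_comul]
  rw [rTensor_unit_counit, h']

theorem extLin_antiCoact_coact (W : Comod R H) (w : W.carrier) :
    extLin (antiCoact W) (W.coact w) = 1 ⊗ₜ w := by
  have key : ∀ t : H ⊗[R] W.carrier, extLin (antiCoact W) t =
        (LinearMap.mul' R H ∘ₗ (HopfAlgebra.antipode R).lTensor H).rTensor W.carrier
          ((TensorProduct.assoc R H H W.carrier).symm (W.coact.lTensor H t)) := by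
    intro t
    induction t with
    | zero => simp
    | add x y hx hy => simp only [map_add, hx, hy]
    | tmul a m =>
      rw [extLin_tmul, LinearMap.lTensor_tmul, antiCoact, LinearMap.comp_apply]
      induction W.coact m with
      | zero => simp
      | add x y hx hy => simp only [map_add, TensorProduct.tmul_add, hx, hy, smul_add]
      | tmul b n => simp [TensorProduct.smul_tmul']
  have h := LinearMap.congr_fun W.coassoc w
  simp only [LinearMap.comp_apply, LinearEquiv.coe_coe] at h
  have h' := LinearMap.congr_fun W.counit_coact w
  simp only [LinearMap.comp_apply, LinearEquiv.coe_coe, LinearMap.id_apply] at h'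
  rw [key, ← h, LinearEquiv.symm_apply_apply,
    ← LinearMap.comp_apply (LinearMap.rTensor _ _), ← LinearMap.rTensor_comp,
    LinearMap.comp_assoc, HopfAlgebra.mul_antipode_lTensor_comul]
  rw [rTensor_unit_counit, h']

theorem extLin_bijective (W : Comod R H) : Function.Bijective (extLin W.coact) := by
  have e1 : extLin W.coact ∘ₗ extLin (antiCoact W) = LinearMap.id :=
    TensorProduct.ext' fun h w => by
      rw [LinearMap.comp_apply, extLin_tmul, extLin_smul, extLin_coact_antiCoact,
        TensorProduct.smul_tmul', smul_eq_mul, mul_one, LinearMap.id_apply]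
  have e2 : extLin (antiCoact W) ∘ₗ extLin W.coact = LinearMap.id :=
    TensorProduct.ext' fun h w => by
      rw [LinearMap.comp_apply, extLin_tmul, extLin_smul, extLin_antiCoact_coact,
        TensorProduct.smul_tmul', smul_eq_mul, mul_one, LinearMap.id_apply]
  exact Function.bijective_iff_has_inverse.2
    ⟨extLin (antiCoact W), LinearMap.congr_fun e2, LinearMap.congr_fun e1⟩

theorem ext_coactHom_apply (W : Comod R H) (h : H) (w : W.carrier) :
    (regular R H ◁ ((coactHom R H).app W : W ⟶ regular R H ⊗ (trivial R H).obj W.carrier) ≫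
      freeActApp (regular R H) _).hom.hom (h ⊗ₜ w) = extLin W.coact (h ⊗ₜ[R] w) := by
  exact LinearMap.congr_fun (freeActApp_regular_hom ((trivial R H).obj W.carrier))
    (h ⊗ₜ[R] W.coact w)

/-- Every representation is trivialized over the regular one, by `h ⊗ w ↦ h w₋₁ ⊗ w₀`. This is the
source of all trivializations in `C`. -/
theorem klIso_coactHom (W : Comod R H) :
    KlIso (A := regular R H) (Y := (trivial R H).obj ((forget R H).obj W))
      ((coactHom R H).app W) := by
  have h : (regular R H ◁ ((coactHom R H).app W : W ⟶ regular R H ⊗ (trivial R H).obj W.carrier) ≫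
      freeActApp (regular R H) _).hom.hom = extLin W.coact :=
    TensorProduct.ext' (ext_coactHom_apply W)
  have h2 := extLin_bijective W
  rw [← h] at h2
  exact @KlIso.of_isIso_ext _ _ _ _ _ _ _ _ (isIso_of_bijective _ h2)

end Hopf

end Comod

open scoped Obj

/-! ### Subcomodules and equalizers over a flat bialgebra. -/

namespace Comod

variable {R : Type u} [CommRing R]

section Subcomodule

variable {H : Type u} [CommRing H] [Bialgebra R H] [Module.Flat R H]

variable (W : Comod R H) (S : Submodule R W.carrier)
  (hS : ∀ s : S, W.coact s ∈ LinearMap.range (S.subtype.lTensor H))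

theorem lTensor_subtype_injective : Function.Injective (S.subtype.lTensor H) :=
  Module.Flat.lTensor_preserves_injective_linearMap _ S.subtype_injective

/-- The coaction on a submodule which is stable under the coaction. -/
def subCoact : S →ₗ[R] H ⊗[R] S :=
  (LinearEquiv.ofInjective _ (lTensor_subtype_injective W S)).symm.toLinearMap ∘ₗ
    (W.coact ∘ₗ S.subtype).codRestrict _ hS

theorem lTensor_subCoact (s : S) : S.subtype.lTensor H (subCoact W S hS s) = W.coact s :=
  congrArg Subtype.val ((LinearEquiv.ofInjective _ (lTensor_subtype_injective W S)).apply_symm_apply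
    ⟨W.coact s, hS s⟩)

theorem lTensor_comp_subCoact :
    S.subtype.lTensor H ∘ₗ subCoact W S hS = W.coact ∘ₗ S.subtype :=
  LinearMap.ext (lTensor_subCoact W S hS)

/-- The subcomodule on a submodule which is stable under the coaction. -/
def sub : Comod R H where
  carrier := ModuleCat.of R S
  coact := subCoact W S hS
  coassoc := by
    have hinj : Function.Injective ((S.subtype.lTensor H).lTensor H) :=
      Module.Flat.lTensor_preserves_injective_linearMap _ (lTensor_subtype_injective W S)
    refine LinearMap.ext fun s => hinj ?_
    have key : ∀ t : H ⊗[R] S, (S.subtype.lTensor H).lTensor H (TensorProduct.assoc R H H S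
        ((Coalgebra.comul (R := R) (A := H)).rTensor S t)) = TensorProduct.assoc R H H W.carrier
        ((Coalgebra.comul (R := R) (A := H)).rTensor W.carrier (S.subtype.lTensor H t)) := by
      intro t
      induction t with
      | zero => simp
      | add x y hx hy => simp only [map_add, hx, hy]
      | tmul a m =>
        simp only [LinearMap.rTensor_tmul, LinearMap.lTensor_tmul]
        induction Coalgebra.comul (R := R) a with
        | zero => simp
        | add x y hx hy => simp only [map_add, TensorProduct.add_tmul, hx, hy]
        | tmul b c => simp
    have h1 : (S.subtype.lTensor H).lTensor H ((subCoact W S hS).lTensor H (subCoact W S hS s)) =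
        W.coact.lTensor H (W.coact s) := by
      rw [← LinearMap.comp_apply, ← LinearMap.lTensor_comp, lTensor_comp_subCoact,
        LinearMap.lTensor_comp, LinearMap.comp_apply, lTensor_subCoact]
    refine (key _).trans (Eq.trans ?_ h1.symm)
    rw [lTensor_subCoact]
    exact LinearMap.congr_fun W.coassoc s
  counit_coact := by
    refine LinearMap.ext fun s => Subtype.ext ?_
    have key : ∀ t : H ⊗[R] S, (TensorProduct.lid R S
        ((Coalgebra.counit (R := R) (A := H)).rTensor S t) : W.carrier) =
        TensorProduct.lid R W.carrier
        ((Coalgebra.counit (R := R) (A := H)).rTensor W.carrier (S.subtype.lTensor H t)) := by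
      intro t
      induction t with
      | zero => simp
      | add x y hx hy => simp only [map_add, Submodule.coe_add, hx, hy]
      | tmul a m => simp
    refine (key _).trans ?_
    rw [lTensor_subCoact]
    exact LinearMap.congr_fun W.counit_coact s

/-- The inclusion of a subcomodule. -/
def subι : sub W S hS ⟶ W := ⟨ModuleCat.ofHom S.subtype, lTensor_comp_subCoact W S hS⟩

/-- A morphism with values in a subcomodule. -/
def subLift {W' : Comod R H} (f : W' ⟶ W) (hf : ∀ x, f.hom.hom x ∈ S) : W' ⟶ sub W S hS :=
  ⟨ModuleCat.ofHom (f.hom.hom.codRestrict S hf), by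
    refine LinearMap.ext fun x => lTensor_subtype_injective W S ?_
    refine Eq.trans ?_ (lTensor_subCoact W S hS _).symm
    change S.subtype.lTensor H ((f.hom.hom.codRestrict S hf).lTensor H (W'.coact x)) = _
    rw [← LinearMap.comp_apply, ← LinearMap.lTensor_comp]
    exact LinearMap.congr_fun f.comm x⟩

/-- Flatness identifies `H ⊗ ker` with the kernel after `H ⊗ -`, so the kernel of a difference is
stable under the coaction. Equalizers of comodules are required by the adjoint lifting argument. -/
instance : HasEqualizers (Comod R H) := by
  have key : ∀ {W W' : Comod R H} (f g : W ⟶ W'), HasLimit (parallelPair f g) := by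
    intro W W' f g
    let S : Submodule R W.carrier := LinearMap.ker (f.hom.hom - g.hom.hom)
    have hS : ∀ s : S, W.coact s ∈ LinearMap.range (S.subtype.lTensor H) := by
      intro s
      have hex := Module.Flat.lTensor_exact H
        (LinearMap.exact_subtype_ker_map (f.hom.hom - g.hom.hom))
      refine (hex _).1 ?_
      have hf := LinearMap.congr_fun f.comm s
      have hg := LinearMap.congr_fun g.comm s
      have hs : f.hom.hom s = g.hom.hom s := by
        have := s.2
        rwa [LinearMap.mem_ker, LinearMap.sub_apply, sub_eq_zero] at this
      simp only [LinearMap.comp_apply] at hf hg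
      rw [LinearMap.lTensor_sub, LinearMap.sub_apply, hf, hg, hs, sub_self]
    refine HasLimit.mk ⟨Fork.ofι (subι W S hS) (hom_ext (ModuleCat.hom_ext (LinearMap.ext fun s => ?_))),
      Fork.IsLimit.mk' _ fun s => ⟨subLift W S hS s.ι fun x => ?_, rfl, fun {m} hm => ?_⟩⟩
    · have := s.2
      rw [LinearMap.mem_ker, LinearMap.sub_apply, sub_eq_zero] at this
      exact this
    · rw [LinearMap.mem_ker, LinearMap.sub_apply, sub_eq_zero]
      exact LinearMap.congr_fun (congrArg (fun z => z.hom.hom) s.condition) x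
    · refine hom_ext (ModuleCat.hom_ext (LinearMap.ext fun x => Subtype.ext ?_))
      exact LinearMap.congr_fun (congrArg (fun z => z.hom.hom) hm) x
  exact hasEqualizers_of_hasLimit_parallelPair _

end Subcomodule

end Comod

instance (R : Type u) [CommRing R] (d : ℕ) : Module.Flat R (GLRing R d) := by
  have : Module.Flat (MvPolynomial (Fin d × Fin d) R) (GLRing R d) :=
    IsLocalization.flat _ (Submonoid.powers (Matrix.mvPolynomialX (Fin d) (Fin d) R).det)
  exact Module.Flat.trans R (MvPolynomial (Fin d × Fin d) R) (GLRing R d)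

open scoped Obj Matrix

/-! ### Comultiplicative matrices and dual comodules. -/

section Comatrix

variable (R : Type u) [CommRing R] {H : Type u} [CommRing H] {I : Type} [Fintype I] [DecidableEq I]

/-- A matrix which is comultiplicative, `Δ(a) = a₁ a₂` and `ε(a) = 1`. -/
structure IsComatrix [Bialgebra R H] (a : Matrix I I H) : Prop where
  comul : (Bialgebra.comulAlgHom R H).mapMatrix a =
    (Algebra.TensorProduct.includeLeft (R := R) (S := R) (A := H) (B := H)).mapMatrix a *
      (Algebra.TensorProduct.includeRight (R := R) (A := H) (B := H)).mapMatrix a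
  counit : (Bialgebra.counitAlgHom R H).mapMatrix a = 1

variable {R}

theorem IsComatrix.comul_apply [Bialgebra R H] {a : Matrix I I H} (ha : IsComatrix R a) (i j : I) :
    Coalgebra.comul (R := R) (a i j) = ∑ k, a i k ⊗ₜ[R] a k j := by
  have := congrFun (congrFun ha.comul i) j
  simpa [Matrix.mul_apply] using this

theorem IsComatrix.counit_apply [Bialgebra R H] {a : Matrix I I H} (ha : IsComatrix R a) (i j : I) :
    Coalgebra.counit (R := R) (a i j) = (1 : Matrix I I R) i j := by
  have := congrFun (congrFun ha.counit i) j
  simpa using this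

/-- The antipode axiom says that applying the antipode to all entries gives an inverse matrix. -/
theorem IsComatrix.isUnit_det [HopfAlgebra R H] {a : Matrix I I H} (ha : IsComatrix R a) :
    IsUnit a.det := by
  refine Matrix.isUnit_det_of_right_inverse (B := a.map (HopfAlgebra.antipode R)) ?_
  ext i j
  have h := LinearMap.congr_fun (HopfAlgebra.mul_antipode_lTensor_comul (R := R) (A := H)) (a i j)
  simp only [LinearMap.comp_apply, ha.comul_apply, ha.counit_apply, map_sum,
    LinearMap.lTensor_tmul, LinearMap.mul'_apply] at h
  rw [Matrix.mul_apply]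
  simp only [Matrix.map_apply]
  rw [h]
  by_cases hij : i = j <;> simp [Matrix.one_apply, hij]

/-- The contragredient: inversion reverses the product of the two matrices and transposition
restores its order, as `H ⊗ H` is commutative. -/
theorem IsComatrix.inv_transpose [HopfAlgebra R H] {a : Matrix I I H} (ha : IsComatrix R a) :
    IsComatrix R (a⁻¹)ᵀ := by
  have hu := ha.isUnit_det
  have key : ∀ {B : Type u} [CommRing B] [Algebra R B] (f : H →ₐ[R] B),
      f.mapMatrix (a⁻¹) = (f.mapMatrix a)⁻¹ := by
    intro B _ _ f
    refine (Matrix.inv_eq_right_inv ?_).symm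
    rw [← map_mul, Matrix.mul_nonsing_inv _ hu, map_one]
  have key' : ∀ {B : Type u} [CommRing B] [Algebra R B] (f : H →ₐ[R] B),
      f.mapMatrix (a⁻¹)ᵀ = ((f.mapMatrix a)⁻¹)ᵀ := fun f => by
    rw [← key]
    rfl
  exact ⟨by rw [key', key', key', ha.comul, Matrix.mul_inv_rev, Matrix.transpose_mul],
    by rw [key', ha.counit, inv_one, Matrix.transpose_one]⟩

end Comatrix

namespace Comod

variable {R : Type u} [CommRing R] {H : Type u} [CommRing H]
  {I : Type} [Fintype I] [DecidableEq I]

section Bialgebra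

variable [Bialgebra R H]

/-- The coaction given by a matrix. -/
def matrixCoact (a : Matrix I I H) : (I → R) →ₗ[R] H ⊗[R] (I → R) :=
  (Pi.basisFun R I).constr R fun i => ∑ j, a i j ⊗ₜ[R] Pi.basisFun R I j

theorem matrixCoact_basis (a : Matrix I I H) (i : I) : matrixCoact a (Pi.basisFun R I i) =
    ∑ j, a i j ⊗ₜ[R] Pi.basisFun R I j := by
  simp only [matrixCoact, Module.Basis.constr_basis]

/-- The comodule given by a comultiplicative matrix. -/
def ofMatrix {a : Matrix I I H} (ha : IsComatrix R a) : Comod R H where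
  carrier := ModuleCat.of R (I → R)
  coact := matrixCoact a
  coassoc := by
    refine (Pi.basisFun R I).ext fun i => ?_
    change TensorProduct.assoc R _ _ _ ((Coalgebra.comul (R := R)).rTensor (I → R)
      (matrixCoact a (Pi.basisFun R I i))) =
        (matrixCoact a).lTensor _ (matrixCoact a (Pi.basisFun R I i))
    simp only [matrixCoact_basis, map_sum, LinearMap.rTensor_tmul, LinearMap.lTensor_tmul,
      ha.comul_apply, TensorProduct.sum_tmul, TensorProduct.tmul_sum, TensorProduct.assoc_tmul]
    rw [Finset.sum_comm]
  counit_coact := by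
    refine (Pi.basisFun R I).ext fun i => ?_
    change TensorProduct.lid R _ ((Coalgebra.counit (R := R)).rTensor (I → R)
      (matrixCoact a (Pi.basisFun R I i))) = Pi.basisFun R I i
    simp only [matrixCoact_basis, map_sum, LinearMap.rTensor_tmul, ha.counit_apply,
      TensorProduct.lid_tmul, Matrix.one_apply, ite_smul, one_smul, zero_smul]
    simp

theorem tmul_basis_injective {M N : Type u} [AddCommGroup M] [Module R M] [AddCommGroup N]
    [Module R N] (b : Module.Basis I R N) {x y : I → M}
    (h : ∑ i, x i ⊗ₜ[R] b i = ∑ i, y i ⊗ₜ[R] b i) : x = y := by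
  refine funext fun j => ?_
  have := DFunLike.congr_fun (congrArg (TensorProduct.equivFinsuppOfBasisRight (M := M) b) h) j
  simpa [TensorProduct.equivFinsuppOfBasisRight_apply_tmul_apply, Finsupp.single_apply] using this

/-- The matrix of the coaction with respect to a basis is comultiplicative. -/
theorem isComatrix (W : Comod R H) (b : Module.Basis I R W.carrier) {a : Matrix I I H}
    (hb : ∀ i, W.coact (b i) = ∑ j, a i j ⊗ₜ[R] b j) : IsComatrix R a where
  comul := by
    ext i j
    have h := LinearMap.congr_fun W.coassoc (b i)
    simp only [LinearMap.comp_apply, LinearEquiv.coe_coe, hb, map_sum, LinearMap.rTensor_tmul,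
      LinearMap.lTensor_tmul, TensorProduct.tmul_sum] at h
    rw [Finset.sum_comm] at h
    have h' : ∑ j, Coalgebra.comul (R := R) (a i j) ⊗ₜ[R] b j =
        ∑ j, (∑ k, a i k ⊗ₜ[R] a k j) ⊗ₜ[R] b j := by
      refine (TensorProduct.assoc R H H W.carrier).injective ?_
      simpa only [map_sum, TensorProduct.sum_tmul, TensorProduct.assoc_tmul] using h
    have := congrFun (tmul_basis_injective b h') j
    simpa [Matrix.mul_apply] using this
  counit := by
    ext i j
    have h := congrArg b.repr (LinearMap.congr_fun W.counit_coact (b i))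
    simp only [LinearMap.comp_apply, LinearEquiv.coe_coe, hb, map_sum, LinearMap.rTensor_tmul,
      TensorProduct.lid_tmul, LinearMap.id_apply, map_smul, Module.Basis.repr_self] at h
    have := DFunLike.congr_fun h j
    simpa [Finsupp.single_apply, Matrix.one_apply] using this

/-- Every coaction on a module with a finite basis is given by a matrix. -/
theorem exists_matrix (W : Comod R H) (b : Module.Basis I R W.carrier) :
    ∃ a : Matrix I I H, ∀ i, W.coact (b i) = ∑ j, a i j ⊗ₜ[R] b j := by
  refine ⟨fun i j => TensorProduct.equivFinsuppOfBasisRight (M := H) b (W.coact (b i)) j,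
    fun i => ?_⟩
  refine (TensorProduct.equivFinsuppOfBasisRight (M := H) b).injective (Finsupp.ext fun j => ?_)
  simp

section Dual

variable (W W' : Comod R H) (b : Module.Basis I R W.carrier) (b' : Module.Basis I R W'.carrier)
  {a a' : Matrix I I H}

theorem tensorCoact_basis (hb : ∀ i, W.coact (b i) = ∑ j, a i j ⊗ₜ[R] b j)
    (hb' : ∀ i, W'.coact (b' i) = ∑ j, a' i j ⊗ₜ[R] b' j) (i j : I) : tensorCoact W W' (b i ⊗ₜ[R] b' j) =
    ∑ k, ∑ l, (a i k * a' j l) ⊗ₜ[R] (b k ⊗ₜ[R] b' l) := by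
  rw [tensorCoact_tmul, hb, hb']
  simp only [TensorProduct.tmul_sum, TensorProduct.sum_tmul, map_sum, mulShuffle_tmul]
  exact Finset.sum_comm

/-- The coevaluation of dual comodules. -/
def dualCoev (hb : ∀ i, W.coact (b i) = ∑ j, a i j ⊗ₜ[R] b j)
    (hb' : ∀ i, W'.coact (b' i) = ∑ j, a' i j ⊗ₜ[R] b' j) (h : aᵀ * a' = 1) : 𝟙_ (Comod R H) ⟶ W ⊗ W' :=
  ⟨ModuleCat.ofHom (LinearMap.toSpanSingleton R (W.carrier ⊗[R] W'.carrier)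
      (∑ i, b i ⊗ₜ[R] b' i)), by
    refine LinearMap.ext_ring ?_
    change (1 : H) ⊗ₜ[R] ((1 : R) • (∑ i, b i ⊗ₜ[R] b' i)) =
      tensorCoact W W' ((1 : R) • (∑ i, b i ⊗ₜ[R] b' i))
    rw [one_smul, map_sum, Finset.sum_congr rfl fun i _ => tensorCoact_basis W W' b b' hb hb' i i,
      Finset.sum_comm, TensorProduct.tmul_sum]
    refine Finset.sum_congr rfl fun j _ => ?_
    rw [Finset.sum_comm]
    have h3 : ∀ k, ∑ i, (a i j * a' i k) = (1 : Matrix I I H) j k := by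
      intro k
      rw [← h, Matrix.mul_apply]
      rfl
    simp only [← TensorProduct.sum_tmul, h3, Matrix.one_apply]
    simp [TensorProduct.ite_tmul]⟩

/-- The bilinear form for which two bases are dual. -/
def dualForm : W'.carrier ⊗[R] W.carrier →ₗ[R] R :=
  TensorProduct.lift (b'.constr R fun i => b.coord i)

theorem dualForm_basis (i j : I) :
    dualForm W W' b b' (b' i ⊗ₜ[R] b j) = (1 : Matrix I I R) i j := by
  simp [dualForm, Matrix.one_apply, Finsupp.single_apply, eq_comm]

/-- The evaluation of dual comodules. -/
def dualEv (hb : ∀ i, W.coact (b i) = ∑ j, a i j ⊗ₜ[R] b j)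
    (hb' : ∀ i, W'.coact (b' i) = ∑ j, a' i j ⊗ₜ[R] b' j) (h : aᵀ * a' = 1) : W' ⊗ W ⟶ 𝟙_ (Comod R H) :=
  ⟨ModuleCat.ofHom (dualForm W W' b b'), by
    refine (b'.tensorProduct b).ext fun ⟨i, j⟩ => ?_
    change (dualForm W W' b b').lTensor H (tensorCoact W' W (b'.tensorProduct b (i, j))) =
      (1 : H) ⊗ₜ[R] dualForm W W' b b' (b'.tensorProduct b (i, j))
    rw [Module.Basis.tensorProduct_apply, tensorCoact_basis W' W b' b hb' hb i j, dualForm_basis]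
    have h1 : (1 : Matrix I I H) i j = ∑ k, a' i k * a j k := by
      rw [← _root_.mul_eq_one_comm.1 h, Matrix.mul_apply]
      rfl
    have h2 : (1 : H) ⊗ₜ[R] (1 : Matrix I I R) i j = (1 : Matrix I I H) i j ⊗ₜ[R] (1 : R) := by
      by_cases hij : i = j <;> simp [Matrix.one_apply, hij]
    rw [h2, h1]
    simp [dualForm_basis, Matrix.one_apply, TensorProduct.sum_tmul, TensorProduct.tmul_ite]⟩

/-- The duality between two comodules with dual bases. -/
@[reducible]
def exactPairing (hb : ∀ i, W.coact (b i) = ∑ j, a i j ⊗ₜ[R] b j)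
    (hb' : ∀ i, W'.coact (b' i) = ∑ j, a' i j ⊗ₜ[R] b' j) (h : aᵀ * a' = 1) : ExactPairing W W' where
  coevaluation' := dualCoev W W' b b' hb hb' h
  evaluation' := dualEv W W' b b' hb hb' h
  coevaluation_evaluation' := by
    have key : ∀ i, (dualForm W W' b b').rTensor W'.carrier
        ((TensorProduct.assoc R W'.carrier W.carrier W'.carrier).symm
          (b' i ⊗ₜ[R] ((1 : R) • ∑ k, b k ⊗ₜ[R] b' k))) = (1 : R) ⊗ₜ[R] ((1 : R) • b' i) := by
      intro i
      simp [TensorProduct.tmul_sum, dualForm_basis, Matrix.one_apply, TensorProduct.ite_tmul]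
    exact hom_ext (ModuleCat.hom_ext (TensorProduct.ext (b'.ext fun i =>
      LinearMap.ext_ring (key i))))
  evaluation_coevaluation' := by
    have key : ∀ i, (dualForm W W' b b').lTensor W.carrier
        (TensorProduct.assoc R W.carrier W'.carrier W.carrier
          (((1 : R) • ∑ k, b k ⊗ₜ[R] b' k) ⊗ₜ[R] b i)) = ((1 : R) • b i) ⊗ₜ[R] (1 : R) := by
      intro i
      simp [TensorProduct.sum_tmul, dualForm_basis, Matrix.one_apply, TensorProduct.tmul_ite]
    exact hom_ext (ModuleCat.hom_ext (TensorProduct.ext (LinearMap.ext_ring (b.ext fun i =>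
      key i))))

end Dual

end Bialgebra

/-- A comodule with a finite basis over a commutative Hopf algebra has a dual. -/
theorem exists_exactPairing [HopfAlgebra R H] (W : Comod R H) (b : Module.Basis I R W.carrier) :
    ∃ W' : Comod R H, Nonempty (ExactPairing W W') := by
  obtain ⟨a, hb⟩ := exists_matrix W b
  have ha := isComatrix W b hb
  refine ⟨ofMatrix ha.inv_transpose, ⟨exactPairing W _ b (Pi.basisFun R I) hb
    (matrixCoact_basis _) ?_⟩⟩
  rw [← Matrix.transpose_mul, Matrix.nonsing_inv_mul _ ha.isUnit_det, Matrix.transpose_one]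

end Comod
end
end RepGL

namespace RepGL

noncomputable section

open Functor.LaxMonoidal
open scoped Obj Matrix

/-! ### The exhaustion of the coordinate ring of `GL_d` by finite free subcomodules. -/

section Filtration

variable (R : Type u) [CommRing R] (d : ℕ)

/-- The ring `R` may have zero divisors. The substitution `x_ij ↦ x_ij + t δ_ij` turns the
determinant into a characteristic polynomial, which is monic in `t` and hence regular; the
substitution is injective since `t = 0` undoes it. -/
theorem det_mvPolynomialX_mem_nonZeroDivisors :
    (Matrix.mvPolynomialX (Fin d) (Fin d) R).det ∈
      nonZeroDivisors (MvPolynomial (Fin d × Fin d) R) := by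
  let X := Matrix.mvPolynomialX (Fin d) (Fin d) R
  let f : MvPolynomial (Fin d × Fin d) R →ₐ[R] Polynomial (MvPolynomial (Fin d × Fin d) R) :=
    MvPolynomial.aeval fun p => (-X).charmatrix p.1 p.2
  let g : Polynomial (MvPolynomial (Fin d × Fin d) R) →ₐ[MvPolynomial (Fin d × Fin d) R]
    MvPolynomial (Fin d × Fin d) R := Polynomial.aeval 0
  have hgf : ∀ p, g (f p) = p := by
    have : (g.restrictScalars R).comp f = AlgHom.id R _ := by
      refine MvPolynomial.algHom_ext fun p => ?_
      change g (f (MvPolynomial.X p)) = MvPolynomial.X p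
      simp only [f, MvPolynomial.aeval_X, Matrix.charmatrix_apply, Matrix.neg_apply, map_neg,
        sub_neg_eq_add, map_add, g, Polynomial.aeval_C]
      obtain ⟨i, j⟩ := p
      by_cases h : i = j <;> simp [h, X]
    exact fun p => AlgHom.congr_fun this p
  have hf : (f X.det).Monic := by
    have : f X.det = (-X).charpoly := by
      rw [AlgHom.map_det, Matrix.mvPolynomialX_mapMatrix_aeval]
      rfl
    rw [this]
    exact Matrix.charpoly_monic _
  rw [mem_nonZeroDivisors_iff_right]
  intro p hp
  have h := congrArg f hp
  rw [map_mul, map_zero] at h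
  rw [← hgf p, hf.mul_left_eq_zero_iff.1 h, map_zero]

theorem algebraMap_GLRing_injective :
    Function.Injective (algebraMap (MvPolynomial (Fin d × Fin d) R) (GLRing R d)) :=
  IsLocalization.injective _ (M := Submonoid.powers (Matrix.mvPolynomialX (Fin d) (Fin d) R).det)
    (Submonoid.powers_le.2 (det_mvPolynomialX_mem_nonZeroDivisors R d))

/-- The inverse of the determinant. -/
def detInv : GLRing R d :=
  IsLocalization.Away.invSelf (Matrix.mvPolynomialX (Fin d) (Fin d) R).det

theorem det_mul_detInv : algebraMap (MvPolynomial (Fin d × Fin d) R) (GLRing R d)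
    (Matrix.mvPolynomialX (Fin d) (Fin d) R).det * detInv R d = 1 :=
  IsLocalization.Away.mul_invSelf _

/-- The determinant of a comultiplicative matrix is group-like, and inverses are unique. -/
theorem comul_detInv : Coalgebra.comul (R := R) (detInv R d) = detInv R d ⊗ₜ[R] detInv R d := by
  have hd : algebraMap (MvPolynomial (Fin d × Fin d) R) (GLRing R d)
      (Matrix.mvPolynomialX (Fin d) (Fin d) R).det = (GLRing.gen R d).det := RingHom.map_det _ _
  have hc : IsComatrix R (GLRing.gen R d) :=
    ⟨by ext i j; simp [GLRing.comul_gen, Matrix.mul_apply], by ext i j; simp [GLRing.counit_gen]⟩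
  have h : Coalgebra.comul (R := R) (GLRing.gen R d).det =
      (GLRing.gen R d).det ⊗ₜ[R] (GLRing.gen R d).det := by
    have := congrArg Matrix.det hc.comul
    rw [Matrix.det_mul, ← AlgHom.map_det, ← AlgHom.map_det, ← AlgHom.map_det] at this
    simpa using this
  have h1 := det_mul_detInv R d
  rw [hd] at h1
  refine left_inv_eq_right_inv (a := Coalgebra.comul (R := R) (GLRing.gen R d).det) ?_ ?_
  · rw [← Bialgebra.comul_mul, _root_.mul_comm, h1, Bialgebra.comul_one]
  · rw [h, Algebra.TensorProduct.tmul_mul_tmul, h1, Algebra.TensorProduct.one_def]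

/-- The map `p ↦ p / det ^ n`. -/
def fracMap (n : ℕ) : MvPolynomial (Fin d × Fin d) R →ₗ[R] GLRing R d :=
  LinearMap.mulRight R (detInv R d ^ n) ∘ₗ
    (IsScalarTower.toAlgHom R (MvPolynomial (Fin d × Fin d) R) (GLRing R d)).toLinearMap

variable {R d} in
theorem fracMap_apply (n : ℕ) (p : MvPolynomial (Fin d × Fin d) R) :
    fracMap R d n p = algebraMap _ (GLRing R d) p * detInv R d ^ n := rfl

theorem fracMap_injective (n : ℕ) : Function.Injective (fracMap R d n) := by
  intro p q h
  refine algebraMap_GLRing_injective R d ?_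
  have hu : IsUnit (detInv R d ^ n) :=
    (IsUnit.of_mul_eq_one _ ((_root_.mul_comm _ _).trans (det_mul_detInv R d))).pow n
  exact hu.mul_left_injective h

theorem fracMap_det_mul (n : ℕ) (p : MvPolynomial (Fin d × Fin d) R) :
    fracMap R d (n + 1) (p * (Matrix.mvPolynomialX (Fin d) (Fin d) R).det) = fracMap R d n p := by
  rw [fracMap_apply, fracMap_apply, map_mul, pow_succ']
  linear_combination (algebraMap _ (GLRing R d) p * detInv R d ^ n) * det_mul_detInv R d

/-- A bound for the degree of the determinant. -/
abbrev detDegree : ℕ := (Matrix.mvPolynomialX (Fin d) (Fin d) R).det.totalDegree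

/-- The submodule of all `p / det ^ n` where `p` has degree at most `(δ + 1) n`. -/
def filt (n : ℕ) : Submodule R (GLRing R d) :=
  (MvPolynomial.restrictTotalDegree (Fin d × Fin d) R ((detDegree R d + 1) * n)).map
    (fracMap R d n)

variable {R d} in
theorem mem_filt {n : ℕ} {h : GLRing R d} : h ∈ filt R d n ↔
    ∃ p : MvPolynomial (Fin d × Fin d) R,
      p.totalDegree ≤ (detDegree R d + 1) * n ∧ fracMap R d n p = h := by
  simp only [filt, Submodule.mem_map, MvPolynomial.mem_restrictTotalDegree]

/-- Passing to the denominator `det ^ (n + 1)` multiplies the numerator by `det`, which raises its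
degree by at most `δ`, while the bound grows by `δ + 1`. -/
theorem filt_le_succ (n : ℕ) : filt R d n ≤ filt R d (n + 1) := by
  intro h hh
  obtain ⟨p, hp, rfl⟩ := mem_filt.1 hh
  refine mem_filt.2 ⟨_, (MvPolynomial.totalDegree_mul _ _).trans ?_, fracMap_det_mul R d n p⟩
  have : (Matrix.mvPolynomialX (Fin d) (Fin d) R).det.totalDegree = detDegree R d := rfl
  nlinarith

theorem filt_mono : Monotone (filt R d) := monotone_nat_of_le_succ (filt_le_succ R d)

theorem one_mem_filt (n : ℕ) : 1 ∈ filt R d n := by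
  refine filt_mono R d n.zero_le (mem_filt.2 ⟨1, by simp, by simp [fracMap_apply]⟩)

theorem exists_mem_filt (h : GLRing R d) : ∃ n, h ∈ filt R d n := by
  obtain ⟨k, p, hp⟩ : ∃ k p, fracMap R d k p = h := by
    obtain ⟨k, p, hp⟩ := IsLocalization.Away.surj (Matrix.mvPolynomialX (Fin d) (Fin d) R).det h
    refine ⟨k, p, ?_⟩
    rw [fracMap_apply, ← hp, _root_.mul_assoc, ← mul_pow, det_mul_detInv, one_pow, mul_one]
  have key : ∀ m, ∃ q : MvPolynomial (Fin d × Fin d) R, fracMap R d (k + m) q = h ∧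
      q.totalDegree ≤ p.totalDegree + m * detDegree R d := by
    intro m
    induction m with
    | zero => exact ⟨p, hp, by simp⟩
    | succ m ih =>
      obtain ⟨q, h1, h2⟩ := ih
      refine ⟨_, (fracMap_det_mul R d (k + m) q).trans h1,
        (MvPolynomial.totalDegree_mul _ _).trans ?_⟩
      have : (Matrix.mvPolynomialX (Fin d) (Fin d) R).det.totalDegree = detDegree R d := rfl
      rw [add_mul, one_mul]
      omega
  -- The summand `1` in `δ + 1` gains one degree per expansion by `det`, so `deg p` expansions bring
  -- any fraction `p / det ^ k` under the bound.
  obtain ⟨q, h1, h2⟩ := key p.totalDegree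
  refine ⟨_, mem_filt.2 ⟨q, h2.trans ?_, h1⟩⟩
  nlinarith [Nat.zero_le (k * (detDegree R d + 1))]

/-- Since `fracMap` is injective, the monomials of bounded degree give a finite basis. Freeness over
the arbitrary ring `R` is what makes these subcomodules dualizable. -/
theorem exists_basis_filt (n : ℕ) : ∃ (I : Type) (_ : Fintype I),
    Nonempty (Module.Basis I R (filt R d n)) := by
  have : Finite {s : Fin d × Fin d →₀ ℕ | (s.sum fun _ e => e) ≤ (detDegree R d + 1) * n} := by
    have := Finsupp.finite_of_degree_le (σ := Fin d × Fin d) ((detDegree R d + 1) * n)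
    exact this
  exact ⟨_, Fintype.ofFinite _, ⟨(MvPolynomial.basisRestrictSupport R _).map
    (Submodule.equivMapOfInjective _ (fracMap_injective R d n) _)⟩⟩

/-- The elements of `H ⊗ S`. -/
abbrev tensorRange (S : Submodule R (GLRing R d)) : Submodule R (GLRing R d ⊗[R] GLRing R d) :=
  LinearMap.range (S.subtype.lTensor (GLRing R d))

variable {R d} in
theorem mul_mem_tensorRange {S T U : Submodule R (GLRing R d)} (h : S * T ≤ U)
    {x y : GLRing R d ⊗[R] GLRing R d} (hx : x ∈ tensorRange R d S) (hy : y ∈ tensorRange R d T) :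
    x * y ∈ tensorRange R d U := by
  obtain ⟨x, rfl⟩ := hx
  obtain ⟨y, rfl⟩ := hy
  induction x with
  | zero => simp
  | add x x' hx hx' => simpa only [map_add, add_mul] using add_mem hx hx'
  | tmul a s =>
    induction y with
    | zero => simp
    | add y y' hy hy' => simpa only [map_add, mul_add] using add_mem hy hy'
    | tmul b t =>
      exact ⟨(a * b) ⊗ₜ ⟨s * t, h (Submodule.mul_mem_mul s.2 t.2)⟩, by simp⟩

theorem tmul_mem_tensorRange {S : Submodule R (GLRing R d)} (a : GLRing R d) {s : GLRing R d}
    (hs : s ∈ S) : a ⊗ₜ[R] s ∈ tensorRange R d S := ⟨a ⊗ₜ ⟨s, hs⟩, rfl⟩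

/-- The polynomial functions of degree at most `m`. -/
def polyFilt (m : ℕ) : Submodule R (GLRing R d) :=
  (MvPolynomial.restrictTotalDegree (Fin d × Fin d) R m).map (fracMap R d 0)

variable {R d} in
theorem mem_polyFilt {m : ℕ} {h : GLRing R d} : h ∈ polyFilt R d m ↔
    ∃ p : MvPolynomial (Fin d × Fin d) R, p.totalDegree ≤ m ∧
      algebraMap _ (GLRing R d) p = h := by
  simp only [polyFilt, Submodule.mem_map, MvPolynomial.mem_restrictTotalDegree, fracMap_apply,
    pow_zero, mul_one]

theorem polyFilt_mul (m n : ℕ) : polyFilt R d m * polyFilt R d n ≤ polyFilt R d (m + n) := by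
  rw [Submodule.mul_le]
  intro x hx y hy
  obtain ⟨p, hp, rfl⟩ := mem_polyFilt.1 hx
  obtain ⟨q, hq, rfl⟩ := mem_polyFilt.1 hy
  exact mem_polyFilt.2 ⟨p * q, (MvPolynomial.totalDegree_mul _ _).trans (add_le_add hp hq),
    map_mul _ _ _⟩

theorem polyFilt_mono : Monotone (polyFilt R d) := by
  intro m n hmn x hx
  obtain ⟨p, hp, rfl⟩ := mem_polyFilt.1 hx
  exact mem_polyFilt.2 ⟨p, hp.trans hmn, rfl⟩

theorem comul_one_mem : Coalgebra.comul (R := R) (1 : GLRing R d) ∈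
    tensorRange R d (polyFilt R d 0) := by
  rw [Bialgebra.comul_one, Algebra.TensorProduct.one_def]
  exact tmul_mem_tensorRange R d _ (mem_polyFilt.2 ⟨1, by simp, map_one _⟩)

theorem comul_gen_mem (i j : Fin d) : Coalgebra.comul (R := R) (GLRing.gen R d i j) ∈
    tensorRange R d (polyFilt R d 1) := by
  rw [GLRing.comul_gen]
  refine Submodule.sum_mem _ fun k _ => tmul_mem_tensorRange R d _ (mem_polyFilt.2
    ⟨MvPolynomial.X (k, j), ?_, rfl⟩)
  refine (MvPolynomial.totalDegree_monomial_le _ _).trans ?_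
  simp

theorem comul_gen_pow_mem (i j : Fin d) (n : ℕ) :
    Coalgebra.comul (R := R) (GLRing.gen R d i j ^ n) ∈ tensorRange R d (polyFilt R d n) := by
  induction n with
  | zero => simpa using comul_one_mem R d
  | succ n ih =>
    rw [pow_succ, Bialgebra.comul_mul]
    exact mul_mem_tensorRange (polyFilt_mul R d n 1) ih (comul_gen_mem R d i j)

/-- In `∑ x_ik ⊗ x_kj` the right factor has degree one, so comultiplication does not raise the
degree on the right. -/
theorem comul_monomial_mem (s : Fin d × Fin d →₀ ℕ) :
    Coalgebra.comul (R := R) (algebraMap _ (GLRing R d) (MvPolynomial.monomial s (1 : R))) ∈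
      tensorRange R d (polyFilt R d s.degree) := by
  induction s using Finsupp.induction_linear with
  | zero =>
    rw [← MvPolynomial.C_apply, map_one, map_one, map_zero]
    exact comul_one_mem R d
  | add s t hs ht =>
    have : MvPolynomial.monomial (s + t) (1 : R) =
        MvPolynomial.monomial s 1 * MvPolynomial.monomial t 1 := by simp
    rw [this, map_mul, Bialgebra.comul_mul, map_add]
    exact mul_mem_tensorRange (polyFilt_mul R d _ _) hs ht
  | single p n =>
    rw [← MvPolynomial.X_pow_eq_monomial, map_pow, Finsupp.degree_single]
    exact comul_gen_pow_mem R d p.1 p.2 n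

theorem tensorRange_mono {S T : Submodule R (GLRing R d)} (h : S ≤ T) :
    tensorRange R d S ≤ tensorRange R d T := by
  rintro _ ⟨x, rfl⟩
  refine ⟨(Submodule.inclusion h).lTensor _ x, ?_⟩
  rw [← LinearMap.comp_apply, ← LinearMap.lTensor_comp]
  rfl

theorem comul_polyFilt_mem (m : ℕ) (p : MvPolynomial (Fin d × Fin d) R) (hp : p.totalDegree ≤ m) :
    Coalgebra.comul (R := R) (algebraMap _ (GLRing R d) p) ∈
      tensorRange R d (polyFilt R d m) := by
  rw [← MvPolynomial.mem_restrictTotalDegree, MvPolynomial.restrictTotalDegree,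
    MvPolynomial.restrictSupport_eq_span] at hp
  induction hp using Submodule.span_induction with
  | mem x hx =>
    obtain ⟨s, hs, rfl⟩ := hx
    exact tensorRange_mono R d (polyFilt_mono R d hs) (comul_monomial_mem R d s)
  | zero => simp
  | add x y _ _ hx hy => simpa only [map_add] using add_mem hx hy
  | smul r x _ hx =>
    rw [← algebraMap_smul (MvPolynomial (Fin d × Fin d) R) r x, smul_eq_mul, map_mul,
      ← IsScalarTower.algebraMap_apply, ← Algebra.smul_def, map_smul]
    exact Submodule.smul_mem _ _ hx

/-- A numerator contributes right factors of no larger degree, and `det⁻ⁿ` is group-like; hence each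
step of the filtration is a subcomodule. -/
theorem comul_mem_filt (n : ℕ) {s : GLRing R d} (hs : s ∈ filt R d n) :
    Coalgebra.comul (R := R) s ∈ tensorRange R d (filt R d n) := by
  obtain ⟨p, hp, rfl⟩ := mem_filt.1 hs
  rw [fracMap_apply, Bialgebra.comul_mul, Bialgebra.comul_pow, comul_detInv,
    Algebra.TensorProduct.tmul_pow]
  refine mul_mem_tensorRange (S := polyFilt R d ((detDegree R d + 1) * n))
    (T := Submodule.span R {detInv R d ^ n}) 
    ?_ (comul_polyFilt_mem R d _ p hp)
    (tmul_mem_tensorRange R d _ (Submodule.mem_span_singleton_self _))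
  rw [Submodule.mul_le]
  intro x hx y hy
  obtain ⟨q, hq, rfl⟩ := mem_polyFilt.1 hx
  obtain ⟨r, rfl⟩ := Submodule.mem_span_singleton.1 hy
  rw [mul_smul_comm]
  exact Submodule.smul_mem _ _ (mem_filt.2 ⟨q, hq, rfl⟩)

end Filtration

end
end RepGL

namespace RepGL

noncomputable section

open Functor.LaxMonoidal
open scoped Obj

/-! ### Descent along a point of a dualizable object. -/

section Coaugmentation

variable {C : Type*} [Category* C] [MonoidalCategory C]

/-- The map `X ⟶ W ⊗ X` given by a point of `W`. -/
def pointApp {W : C} (p : 𝟙_ C ⟶ W) (X : C) : X ⟶ W ⊗ X := (λ_ X).inv ≫ p ▷ X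

theorem pointApp_naturality {W : C} (p : 𝟙_ C ⟶ W) {X Y : C} (f : X ⟶ Y) :
    f ≫ pointApp p Y = pointApp p X ≫ W ◁ f := by
  simp only [pointApp, Category.assoc]
  rw [← whisker_exchange, leftUnitor_inv_naturality_assoc]

theorem pointApp_comp {W W' : C} (p : 𝟙_ C ⟶ W) (q : W ⟶ W') (X : C) :
    pointApp p X ≫ q ▷ X = pointApp (p ≫ q) X := by
  simp [pointApp]

/-- The functional on the dual given by a point. -/
def dualPoint {W D : C} [ExactPairing W D] (p : 𝟙_ C ⟶ W) : D ⟶ 𝟙_ C :=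
  (ρ_ D).inv ≫ D ◁ p ≫ ε_ W D

/-- Under `Hom(D ⊗ Y, Y) ≅ Hom(Y, W ⊗ Y)` the dual functional corresponds to the point; this is how
equalizers for `W` become coequalizers for `D`. -/
theorem dualPoint_whiskerRight {W D : C} [ExactPairing W D] (p : 𝟙_ C ⟶ W) (Y : C) :
    dualPoint p ▷ Y ≫ (λ_ Y).hom = (tensorLeftHomEquiv Y W D Y).symm (pointApp p Y) := by
  change _ = D ◁ pointApp p Y ≫ (α_ _ _ _).inv ≫ ε_ W D ▷ Y ≫ (λ_ Y).hom
  simp [dualPoint, pointApp]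

/-- The unit object is presented by an augmented object. -/
structure IsAugmentation {D : C} (q : D ⟶ 𝟙_ C) : Prop where
  epi : Epi q
  exists_desc : ∀ {Z : C} (f : D ⟶ Z),
    (q ▷ D ≫ (λ_ D).hom) ≫ f = (D ◁ q ≫ (ρ_ D).hom) ≫ f → ∃ g, q ≫ g = f

theorem augmentation_condition {D : C} (q : D ⟶ 𝟙_ C) :
    (q ▷ D ≫ (λ_ D).hom) ≫ q = (D ◁ q ≫ (ρ_ D).hom) ≫ q := by
  rw [Category.assoc, Category.assoc, ← leftUnitor_naturality, ← rightUnitor_naturality,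
    whisker_exchange_assoc, unitors_equal]

variable {D : C} {q : D ⟶ 𝟙_ C}

/-- The presentation of the unit object as a colimit. -/
def IsAugmentation.isColimit (hq : IsAugmentation q) :
    IsColimit (Cofork.ofπ q (augmentation_condition q)) :=
  Cofork.IsColimit.mk' _ fun s =>
    ⟨(hq.exists_desc s.π s.condition).choose, (hq.exists_desc s.π s.condition).choose_spec,
      fun {m} hm => by
        have := hq.epi
        rw [← cancel_epi q]
        exact hm.trans (hq.exists_desc s.π s.condition).choose_spec.symm⟩

/-- An augmentation is expressed by a coequalizer and tensor products, both of which `F` preserves.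
It thus passes from comodules, where it is elementary, to `C`. -/
theorem IsAugmentation.map {C' : Type*} [Category* C'] [MonoidalCategory C'] (F : C ⥤ C')
    [F.Monoidal] [PreservesColimitsOfShape WalkingParallelPair F] (hq : IsAugmentation q) :
    IsAugmentation (F.map q ≫ Functor.OplaxMonoidal.η F) where
  epi := by
    have h := isColimitCoforkMapOfIsColimit F _ hq.isColimit
    have : Epi (F.map q) := epi_of_isColimit_cofork h
    exact epi_comp _ _
  exists_desc {Z} f hf := by
    have h := isColimitCoforkMapOfIsColimit F _ hq.isColimit
    obtain ⟨g, hg⟩ : ∃ g, F.map q ≫ g = f := by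
      have h' : F.map (q ▷ D ≫ (λ_ D).hom) ≫ f = F.map (D ◁ q ≫ (ρ_ D).hom) ≫ f := by
        rw [← cancel_epi (Functor.LaxMonoidal.μ F D D)]
        simp only [Functor.map_comp, Category.assoc, Functor.Monoidal.map_leftUnitor,
          Functor.Monoidal.map_rightUnitor, comp_whiskerRight,
          MonoidalCategory.whiskerLeft_comp] at hf ⊢
        rw [← μ_natural_left_assoc, ← μ_natural_right_assoc, Functor.Monoidal.μ_δ_assoc,
          Functor.Monoidal.μ_δ_assoc]
        exact hf
      exact ⟨Cofork.IsColimit.desc h f h', Cofork.IsColimit.π_desc' h f h'⟩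
    exact ⟨ε F ≫ g, by simpa using hg⟩

/-- In a closed category `- ⊗ Y` preserves the coequalizer, which then presents `Y` as a quotient of
`D ⊗ Y`. -/
theorem IsAugmentation.exists_desc_whiskerRight [BraidedCategory C] [MonoidalClosed C]
    (hq : IsAugmentation q) {Y Z : C} (f : D ⊗ Y ⟶ Z)
    (hf : D ◁ (q ▷ Y ≫ (λ_ Y).hom) ≫ f = (q ▷ (D ⊗ Y) ≫ (λ_ (D ⊗ Y)).hom) ≫ f) :
    ∃ g, (q ▷ Y ≫ (λ_ Y).hom) ≫ g = f := by
  have h := isColimitCoforkMapOfIsColimit (tensorRight Y) _ hq.isColimit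
  have h' : (q ▷ D ≫ (λ_ D).hom) ▷ Y ≫ f = (D ◁ q ≫ (ρ_ D).hom) ▷ Y ≫ f := by
    rw [← cancel_epi (α_ D D Y).inv]
    simpa using hf.symm
  obtain ⟨g, hg⟩ : ∃ g, q ▷ Y ≫ g = f :=
    ⟨Cofork.IsColimit.desc h f h', Cofork.IsColimit.π_desc' h f h'⟩
  exact ⟨(λ_ Y).inv ≫ g, by simpa using hg⟩

theorem IsAugmentation.epi_whiskerRight [BraidedCategory C] [MonoidalClosed C]
    (hq : IsAugmentation q) (Y : C) : Epi (q ▷ Y ≫ (λ_ Y).hom) := by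
  have := hq.epi
  have : Epi (q ▷ Y) := inferInstanceAs (Epi ((tensorRight Y).map q))
  exact epi_comp _ _

theorem pointApp_condition {W : C} (p : 𝟙_ C ⟶ W) (X : C) :
    pointApp p X ≫ pointApp p (W ⊗ X) = pointApp p X ≫ W ◁ pointApp p X :=
  pointApp_naturality p _

/-- Descent along a point whose dual presents the unit object. -/
def isLimitPointApp [BraidedCategory C] [MonoidalClosed C] {W D : C} [ExactPairing W D]
    (p : 𝟙_ C ⟶ W) (hp : IsAugmentation (dualPoint (D := D) p)) (X : C) :
    IsLimit (Fork.ofι (pointApp p X) (pointApp_condition p X)) := by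
  -- Transposition turns factoring `k : Y ⟶ W ⊗ X` through `X` into factoring `D ⊗ Y ⟶ X` through `D
  -- ⊗ Y ⟶ Y`, and the fork condition into the coequalizer condition.
  have key : ∀ {X Y : C} (g : Y ⟶ X), (tensorLeftHomEquiv Y W D X).symm (g ≫ pointApp p X) =
      (dualPoint p ▷ Y ≫ (λ_ Y).hom) ≫ g := by
    intro X Y g
    rw [dualPoint_whiskerRight, Equiv.symm_apply_eq, tensorLeftHomEquiv_naturality,
      Equiv.apply_symm_apply, pointApp_naturality]
  have hex : ∀ {Y : C} (k : Y ⟶ W ⊗ X), k ≫ pointApp p (W ⊗ X) = k ≫ W ◁ pointApp p X →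
      ∃ g, g ≫ pointApp p X = k := by
    intro Y k hk
    obtain ⟨g, hg⟩ := hp.exists_desc_whiskerRight ((tensorLeftHomEquiv Y W D X).symm k) (by
      rw [← key, ← tensorLeftHomEquiv_symm_naturality, ← key, hk]
      refine congrArg _ ?_
      rw [Equiv.symm_apply_eq, tensorLeftHomEquiv_naturality, Equiv.apply_symm_apply])
    exact ⟨g, (tensorLeftHomEquiv Y W D X).symm.injective ((key g).trans hg)⟩
  refine Fork.IsLimit.mk' _ fun s => ⟨(hex s.ι s.condition).choose,
    (hex s.ι s.condition).choose_spec, fun {m} hm => ?_⟩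
  have h : m ≫ pointApp p X = (hex s.ι s.condition).choose ≫ pointApp p X :=
    hm.trans (hex s.ι s.condition).choose_spec.symm
  have := hp.epi_whiskerRight s.pt
  have h' := congrArg (tensorLeftHomEquiv s.pt W D X).symm h
  rw [key, key] at h'
  exact (cancel_epi _).1 h'

end Coaugmentation

/-! ### Faithful flatness of a filtered union of dualizable objects with points. -/

section Colimit

variable {C : Type*} [Category* C] [MonoidalCategory C] [BraidedCategory C] [MonoidalClosed C]
  {J : Type*} [Category* J] (W : J ⥤ C)

/-- The functor `X ↦ (j ↦ W j ⊗ X)`. -/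
def tensorDiagram : C ⥤ J ⥤ C := (W ⋙ curriedTensor C).flip

instance [∀ j, (tensorLeft (W.obj j)).IsRightAdjoint] {K : Type*} [Category* K] :
    PreservesLimitsOfShape K (tensorDiagram W) where
  preservesLimit {F} := preservesLimit_of_evaluation _ _ fun j =>
    inferInstanceAs (PreservesLimit F (tensorLeft (W.obj j)))

variable {W}

/-- The tensor product with a colimit is the colimit of the tensor products. -/
def tensorDiagramCompColim [HasColimitsOfShape J C] {B : C} {i : W ⟶ (Functor.const J).obj B}
    (hi : IsColimit (Cocone.mk B i)) : tensorDiagram W ⋙ colim ≅ tensorLeft B :=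
  (colimitIsoFlipCompColim (W ⋙ curriedTensor C)).symm ≪≫
    (colimit.isColimit (W ⋙ curriedTensor C)).coconePointUniqueUpToIso
      (evaluationJointlyReflectsColimits ((curriedTensor C).mapCocone (Cocone.mk B i)) fun X =>
        isColimitOfPreserves (tensorRight X) hi)

variable [HasColimitsOfShape J C]

/-- Each `W j ⊗ -` preserves limits, being a right adjoint. Their colimit is `B ⊗ -`, and colimits
of shape `J` are exact. -/
theorem preservesFiniteLimits_tensorLeft_of_isColimit [HasExactColimitsOfShape J C]
    [∀ j, (tensorLeft (W.obj j)).IsRightAdjoint] {B : C} {i : W ⟶ (Functor.const J).obj B}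
    (hi : IsColimit (Cocone.mk B i)) : PreservesFiniteLimits (tensorLeft B) := by
  have : PreservesFiniteLimits (colim : (J ⥤ C) ⥤ C) :=
    HasExactColimitsOfShape.preservesFiniteLimits
  have : PreservesFiniteLimits (tensorDiagram W ⋙ colim) := ⟨fun K _ _ => inferInstance⟩
  exact ⟨fun K _ _ => preservesLimitsOfShape_of_natIso (tensorDiagramCompColim hi)⟩

/-- A filtered colimit of descent data along points is one. -/
theorem strongMono_pointApp_of_isColimit [IsConnected J] [HasExactColimitsOfShape J C]
    (p : ∀ j, 𝟙_ C ⟶ W.obj j) (hp : ∀ {j k} (f : j ⟶ k), p j ≫ W.map f = p k)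
    (D : J → C) [∀ j, ExactPairing (W.obj j) (D j)]
    (haug : ∀ j, IsAugmentation (dualPoint (D := D j) (p j)))
    {B : C} {i : W ⟶ (Functor.const J).obj B}
    (hi : IsColimit (Cocone.mk B i)) (e : 𝟙_ C ⟶ B) (he : ∀ j, p j ≫ i.app j = e) (X : C) :
    StrongMono (pointApp e X) := by
  have : PreservesFiniteLimits (colim : (J ⥤ C) ⥤ C) :=
    HasExactColimitsOfShape.preservesFiniteLimits
  -- The objects `W j ⊗ (W j ⊗ X)` form a diagram along the diagonal of `J`, which makes the forks
  -- of `isLimitPointApp` natural in `j`.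
  let G : J ⥤ C :=
    { obj := fun j => W.obj j ⊗ (W.obj j ⊗ X)
      map := fun f => W.map f ⊗ₘ (W.map f ▷ X) }
  let h : (Functor.const J).obj X ⟶ (tensorDiagram W).obj X :=
    { app := fun j => pointApp (p j) X
      naturality := fun j k f => by
        change 𝟙 X ≫ pointApp (p k) X = pointApp (p j) X ≫ W.map f ▷ X
        rw [pointApp_comp, hp, Category.id_comp] }
  let r : (tensorDiagram W).obj X ⟶ G :=
    { app := fun j => pointApp (p j) (W.obj j ⊗ X)
      naturality := fun j k f => by
        change W.map f ▷ X ≫ pointApp (p k) (W.obj k ⊗ X) =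
          pointApp (p j) (W.obj j ⊗ X) ≫ (W.map f ⊗ₘ (W.map f ▷ X))
        rw [MonoidalCategory.tensorHom_def, ← Category.assoc, pointApp_comp, hp,
          pointApp_naturality] }
  let s : (tensorDiagram W).obj X ⟶ G :=
    { app := fun j => W.obj j ◁ pointApp (p j) X
      naturality := fun j k f => by
        change W.map f ▷ X ≫ W.obj k ◁ pointApp (p k) X =
          W.obj j ◁ pointApp (p j) X ≫ (W.map f ⊗ₘ (W.map f ▷ X))
        rw [MonoidalCategory.tensorHom_def', ← MonoidalCategory.whiskerLeft_comp_assoc,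
          pointApp_comp, hp, whisker_exchange] }
  have w : h ≫ r = h ≫ s := by
    ext j
    exact pointApp_condition (p j) X
  have hlim : IsLimit (Fork.ofι h w) := evaluationJointlyReflectsLimits _ fun j =>
    (isLimitMapConeForkEquiv ((evaluation J C).obj j) w).symm
      (isLimitPointApp (p j) (haug j) X)
  have hlim' := isLimitForkMapOfIsLimit (colim : (J ⥤ C) ⥤ C) w hlim
  -- Exactness keeps the fork an equalizer in the colimit. Only regularity of the monomorphism is
  -- extracted, so the colimit of `G` need not be identified with `B ⊗ (B ⊗ X)`.
  have : StrongMono (colim.map h) := by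
    have : IsRegularMono (colim.map h) := ⟨⟨⟨_, _, _, _, hlim'⟩⟩⟩
    infer_instance
  have j : J := Classical.arbitrary J
  let e₁ : X ≅ colimit ((Functor.const J).obj X) := (isColimitConstCocone J X).coconePointUniqueUpToIso
    (colimit.isColimit ((Functor.const J).obj X))
  let e₂ : colimit ((tensorDiagram W).obj X) ≅ B ⊗ X := (colimit.isColimit ((tensorDiagram W).obj X)).coconePointUniqueUpToIso
    (isColimitOfPreserves (tensorRight X) hi)
  have h₁ : e₁.hom = colimit.ι ((Functor.const J).obj X) j := by
    have := (isColimitConstCocone J X).comp_coconePointUniqueUpToIso_hom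
      (colimit.isColimit ((Functor.const J).obj X)) j
    exact (Category.id_comp _).symm.trans this
  have h₂ : colimit.ι ((tensorDiagram W).obj X) j ≫ e₂.hom = i.app j ▷ X :=
    (colimit.isColimit ((tensorDiagram W).obj X)).comp_coconePointUniqueUpToIso_hom
      (isColimitOfPreserves (tensorRight X) hi) j
  have h₃ : pointApp e X = e₁.hom ≫ colim.map h ≫ e₂.hom := by
    have h₄ : colimit.ι ((Functor.const J).obj X) j ≫ colim.map h =
        pointApp (p j) X ≫ colimit.ι ((tensorDiagram W).obj X) j := ι_colimMap h j
    rw [h₁, ← Category.assoc]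
    refine Eq.trans ?_ (congrArg (· ≫ e₂.hom) h₄).symm
    refine Eq.trans ?_ ((congrArg (pointApp (p j) X ≫ ·) h₂).symm.trans
      (Category.assoc _ _ _).symm)
    exact (by rw [pointApp_comp, he] : pointApp e X = pointApp (p j) X ≫ i.app j ▷ X)
  rw [h₃]
  have : StrongMono (colim.map h ≫ e₂.hom) := strongMono_comp _ _
  exact strongMono_comp _ _

/-- For reflection of isomorphisms, let `B ◁ f` be invertible. Then `f` followed by the strong
monomorphism `Y ⟶ B ⊗ Y` is strong mono, hence so is `f`. It is also epi, because the maps `Z ⟶ B ⊗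
Z` are mono. A strong mono that is epi is invertible. -/
theorem isFaithfullyFlat_of_isColimit [IsConnected J] [HasExactColimitsOfShape J C]
    (p : ∀ j, 𝟙_ C ⟶ W.obj j) (hp : ∀ {j k} (f : j ⟶ k), p j ≫ W.map f = p k)
    (D : J → C) [∀ j, ExactPairing (W.obj j) (D j)]
    (haug : ∀ j, IsAugmentation (dualPoint (D := D j) (p j)))
    {B : C} {i : W ⟶ (Functor.const J).obj B}
    (hi : IsColimit (Cocone.mk B i)) (e : 𝟙_ C ⟶ B) (he : ∀ j, p j ≫ i.app j = e) :
    PreservesFiniteLimits (tensorLeft B) ∧ (tensorLeft B).ReflectsIsomorphisms := by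
  have (j : J) : (tensorLeft (W.obj j)).IsRightAdjoint :=
    (tensorLeftAdjunction (W.obj j) (D j)).isRightAdjoint
  have hmono := strongMono_pointApp_of_isColimit p hp D haug hi e he
  refine ⟨preservesFiniteLimits_tensorLeft_of_isColimit hi, ⟨fun {X Y} f hf => ?_⟩⟩
  have hf : IsIso (B ◁ f) := hf
  have : StrongMono f := by
    have : StrongMono (f ≫ pointApp e Y) := by
      rw [pointApp_naturality]
      exact strongMono_comp _ _
    exact strongMono_of_strongMono f (pointApp e Y)
  have : Epi f := ⟨fun {Z} g h hgh => by
    have h1 : B ◁ g = B ◁ h := by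
      rw [← cancel_epi (B ◁ f), ← MonoidalCategory.whiskerLeft_comp, hgh,
        MonoidalCategory.whiskerLeft_comp]
    rw [← cancel_mono (pointApp e Z), pointApp_naturality, pointApp_naturality, h1]⟩
  exact isIso_of_epi_of_strongMono f

end Colimit

open scoped Obj

/-! ### Augmentations of comodules and the filtered regular comodule. -/

namespace Comod

section Augmentation

variable {R : Type u} [CommRing R] {H : Type u} [CommRing H] [Bialgebra R H]

/-- Choose `x` with `q x = 1`. Evaluating the relation on `x ⊗ y` gives `f y = q(y) f(x)`, so `f`
factors through `q` by `1 ↦ f x`; surjectivity of `q` makes this factorization a comodule map. -/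
theorem isAugmentation_of_surjective {D : Comod R H} (q : D ⟶ 𝟙_ (Comod R H))
    (hq : Function.Surjective q.hom.hom) : IsAugmentation q where
  epi := ⟨fun {Z} f g h => hom_ext (ModuleCat.hom_ext (LinearMap.ext fun x => by
    obtain ⟨y, rfl⟩ := hq x
    exact LinearMap.congr_fun (congrArg (fun k => k.hom.hom) h) y))⟩
  exists_desc {Z} f hf := by
    obtain ⟨x, hx⟩ := hq (1 : R)
    have key : ∀ y : D.carrier, f.hom.hom y =
        ((show R from q.hom.hom y) • f.hom.hom x : Z.carrier) := by
      intro y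
      have h1 := LinearMap.congr_fun (congrArg (fun k => k.hom.hom) hf)
        (x ⊗ₜ[R] y : D.carrier ⊗[R] D.carrier)
      have h2 : f.hom.hom ((show R from q.hom.hom x) • y) =
        f.hom.hom ((show R from q.hom.hom y) • x) := h1
      rw [map_smul, map_smul, hx] at h2
      exact (one_smul R _).symm.trans h2
    let g : R →ₗ[R] Z.carrier := LinearMap.toSpanSingleton R Z.carrier (f.hom.hom x)
    have hg : g ∘ₗ q.hom.hom = f.hom.hom := LinearMap.ext fun y => (key y).symm
    refine ⟨⟨ModuleCat.ofHom g, ?_⟩, hom_ext (ModuleCat.hom_ext hg)⟩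
    refine LinearMap.ext fun r => ?_
    obtain ⟨y, rfl⟩ := hq r
    have h1 := LinearMap.congr_fun q.comm y
    have h2 := LinearMap.congr_fun f.comm y
    change g.lTensor H ((𝟙_ (Comod R H)).coact (q.hom.hom y)) =
      Z.coact ((g ∘ₗ q.hom.hom) y)
    rw [hg]
    refine Eq.trans ?_ h2
    have h3 : (g ∘ₗ q.hom.hom).lTensor H (D.coact y) =
        g.lTensor H (q.hom.hom.lTensor H (D.coact y)) :=
      LinearMap.congr_fun (LinearMap.lTensor_comp H g q.hom.hom) (D.coact y)
    rw [hg] at h3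
    exact ((congrArg (g.lTensor H) h1).symm.trans h3.symm)

/-- The functional given by a point is surjective if the point has a retraction of modules. -/
theorem dualPoint_surjective {W D : Comod R H} [ExactPairing W D] (p : 𝟙_ (Comod R H) ⟶ W)
    (l : W.carrier →ₗ[R] R) (hl : l (p.hom.hom (1 : R)) = (1 : R)) :
    Function.Surjective (dualPoint (D := D) p).hom.hom := by
  let ev : D.carrier ⊗[R] W.carrier →ₗ[R] R := (ε_ W D).hom.hom
  let t : W.carrier ⊗[R] D.carrier := (η_ W D).hom.hom (1 : R)
  -- The preimage of `1` is the functional `l` itself, realized in `D` as `(l ⊗ id)` of the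
  -- coevaluation; by the triangle identity its pairing with `w` is `l w`.
  have key : ∀ (t : W.carrier ⊗[R] D.carrier) (w : W.carrier),
      ev (TensorProduct.lid R D.carrier (l.rTensor D.carrier t) ⊗ₜ[R] w) =
      l (TensorProduct.rid R W.carrier (ev.lTensor W.carrier
        (TensorProduct.assoc R W.carrier D.carrier W.carrier (t ⊗ₜ[R] w)))) := by
    intro t w
    induction t with
    | zero => simp
    | add x y hx hy => simp only [map_add, TensorProduct.add_tmul, hx, hy]
    | tmul a b =>
      simp only [LinearMap.rTensor_tmul, TensorProduct.lid_tmul, TensorProduct.assoc_tmul,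
        LinearMap.lTensor_tmul, TensorProduct.rid_tmul, map_smul, ← TensorProduct.smul_tmul',
        smul_eq_mul]
      exact _root_.mul_comm _ _
  have key2 : ∀ w : W.carrier, TensorProduct.rid R W.carrier (ev.lTensor W.carrier
      (TensorProduct.assoc R W.carrier D.carrier W.carrier (t ⊗ₜ[R] w))) = w := by
    intro w
    have h := LinearMap.congr_fun (congrArg (fun k => k.hom.hom)
      (ExactPairing.evaluation_coevaluation W D)) ((1 : R) ⊗ₜ[R] w)
    have h' : ev.lTensor W.carrier
      (TensorProduct.assoc R W.carrier D.carrier W.carrier (t ⊗ₜ[R] w)) =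
        (TensorProduct.rid R W.carrier).symm (TensorProduct.lid R W.carrier ((1 : R) ⊗ₜ[R] w)) := h
    rw [h', LinearEquiv.apply_symm_apply, TensorProduct.lid_tmul, one_smul]
  have hval : ∀ y : D.carrier, (dualPoint (D := D) p).hom.hom y =
      ev (y ⊗ₜ[R] p.hom.hom (1 : R)) := fun y => rfl
  intro r
  refine ⟨(show R from r) • TensorProduct.lid R D.carrier (l.rTensor D.carrier t), ?_⟩
  rw [map_smul, hval, key, key2, hl]
  exact mul_one (show R from r)

end Augmentation

section Filtration

variable (R : Type u) [CommRing R] (d : ℕ)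

/-- The filtration of the regular comodule. -/
def filtComod (n : ℕ) : Rep R d :=
  sub (regular R (GLRing R d)) (filt R d n) fun s => comul_mem_filt R d n s.2

/-- The inclusion of the filtration. -/
def filtι (n : ℕ) : filtComod R d n ⟶ regular R (GLRing R d) := subι _ _ _

/-- The filtration as a functor. -/
def filtFunctor : ℕ ⥤ Rep R d where
  obj := filtComod R d
  map {m n} f := subLift _ _ _ (filtι R d m) fun x => filt_mono R d (leOfHom f) x.2

/-- The point given by the unit element. -/
def filtPoint (n : ℕ) : 𝟙_ (Rep R d) ⟶ filtComod R d n :=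
  subLift _ _ _ η[regular R (GLRing R d)] (by
    have h : ∀ r : R, algebraMap R (GLRing R d) r ∈ filt R d n := fun r => by
      rw [Algebra.algebraMap_eq_smul_one]
      exact Submodule.smul_mem _ _ (one_mem_filt R d n)
    exact h)

theorem filtPoint_comp (n : ℕ) : filtPoint R d n ≫ filtι R d n = η[regular R (GLRing R d)] :=
  rfl

theorem filtPoint_map {m n : ℕ} (f : m ⟶ n) :
    filtPoint R d m ≫ (filtFunctor R d).map f = filtPoint R d n := rfl

/-- The cocone of the filtration. -/
def filtCocone : filtFunctor R d ⟶ (Functor.const ℕ).obj (regular R (GLRing R d)) where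
  app := filtι R d

section Desc

variable {R d} (s : Cocone (filtFunctor R d))

/-- The maps of a cocone over the filtration as linear maps. -/
def filtMap (n : ℕ) : filt R d n →ₗ[R] s.pt.carrier := (s.ι.app n).hom.hom

theorem filtMap_eq {m n : ℕ} (h : GLRing R d) (hm : h ∈ filt R d m) (hn : h ∈ filt R d n) :
    filtMap s m ⟨h, hm⟩ = filtMap s n ⟨h, hn⟩ := by
  have key : ∀ {m n : ℕ} (hmn : m ≤ n) (hm : h ∈ filt R d m) (hn : h ∈ filt R d n),
      filtMap s n ⟨h, hn⟩ = filtMap s m ⟨h, hm⟩ := fun hmn hm hn =>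
    LinearMap.congr_fun (congrArg (fun k => k.hom.hom) (s.w (homOfLE hmn))) ⟨h, hm⟩
  rw [← key (le_max_left m n) hm (filt_mono R d (le_max_left m n) hm),
    ← key (le_max_right m n) hn (filt_mono R d (le_max_left m n) hm)]

/-- The linear map induced by a cocone over the filtration. -/
def filtDesc : GLRing R d →ₗ[R] s.pt.carrier where
  toFun h := filtMap s _ ⟨h, (exists_mem_filt R d h).choose_spec⟩
  map_add' x y := by
    obtain ⟨m, hx⟩ := exists_mem_filt R d x
    obtain ⟨n, hy⟩ := exists_mem_filt R d y
    have hx' := filt_mono R d (le_max_left m n) hx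
    have hy' := filt_mono R d (le_max_right m n) hy
    rw [filtMap_eq s _ _ hx', filtMap_eq s _ _ hy', filtMap_eq s _ _ (add_mem hx' hy'), ← map_add]
    rfl
  map_smul' r x := by
    obtain ⟨m, hx⟩ := exists_mem_filt R d x
    rw [filtMap_eq s _ _ hx, filtMap_eq s _ _ (Submodule.smul_mem _ r hx), RingHom.id_apply,
      ← map_smul]
    rfl

theorem filtDesc_apply {n : ℕ} (h : GLRing R d) (hn : h ∈ filt R d n) :
    filtDesc s h = filtMap s n ⟨h, hn⟩ := filtMap_eq s _ _ _

theorem filtDesc_comm : (filtDesc s).lTensor (GLRing R d) ∘ₗ Coalgebra.comul =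
    s.pt.coact ∘ₗ filtDesc s := by
  refine LinearMap.ext fun h => ?_
  obtain ⟨n, hn⟩ := exists_mem_filt R d h
  rw [LinearMap.comp_apply, LinearMap.comp_apply, filtDesc_apply s h hn]
  have h1 : (filtMap s n).lTensor (GLRing R d) ((filtComod R d n).coact ⟨h, hn⟩) =
      s.pt.coact (filtMap s n ⟨h, hn⟩) := LinearMap.congr_fun (s.ι.app n).comm ⟨h, hn⟩
  have h2 : (filt R d n).subtype.lTensor (GLRing R d) ((filtComod R d n).coact ⟨h, hn⟩) =
      Coalgebra.comul (R := R) h := LinearMap.congr_fun (filtι R d n).comm ⟨h, hn⟩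
  have h3 : filtDesc s ∘ₗ (filt R d n).subtype = filtMap s n :=
    LinearMap.ext fun x => filtDesc_apply s x.1 x.2
  rw [← h1, ← h3, LinearMap.lTensor_comp, ← h2]
  rfl

end Desc

/-- The regular comodule is the union of its filtration. -/
def isColimitFiltCocone : IsColimit (Cocone.mk _ (filtCocone R d)) where
  desc s := ⟨ModuleCat.ofHom (filtDesc s), filtDesc_comm s⟩
  fac s n := hom_ext (ModuleCat.hom_ext (LinearMap.ext fun x => filtDesc_apply s x.1 x.2))
  uniq s m hm := hom_ext (ModuleCat.hom_ext (LinearMap.ext fun (h : GLRing R d) => by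
    obtain ⟨n, hn⟩ := exists_mem_filt R d h
    refine Eq.trans ?_ (filtDesc_apply s h hn).symm
    exact LinearMap.congr_fun (congrArg (fun k => k.hom.hom) (hm n)) ⟨h, hn⟩))

theorem exists_exactPairing_filtComod (n : ℕ) :
    ∃ D : Rep R d, Nonempty (ExactPairing (filtComod R d n) D) := by
  obtain ⟨I, _, ⟨b⟩⟩ := exists_basis_filt R d n
  classical
  exact exists_exactPairing (filtComod R d n) b

/-- The counit restricted to the subcomodule is a linear retraction of the point `1`. -/
theorem isAugmentation_dualPoint_filtPoint (n : ℕ) (D : Rep R d)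
    [ExactPairing (filtComod R d n) D] :
    IsAugmentation (dualPoint (D := D) (filtPoint R d n)) := by
  refine isAugmentation_of_surjective _ (dualPoint_surjective _
    (Coalgebra.counit ∘ₗ (filt R d n).subtype) ?_)
  change Coalgebra.counit (R := R) (algebraMap R (GLRing R d) 1) = (1 : R)
  simp

end Filtration
end Comod

open scoped Obj

/-! ### Tensor functors send the regular comodule to a faithfully flat algebra. -/

section MapExactPairing

variable {C D : Type*} [Category* C] [MonoidalCategory C] [Category* D] [MonoidalCategory D]
  (F : C ⥤ D) [F.Monoidal]

/-- Strong monoidal functors preserve duals. -/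
@[reducible]
def mapExactPairing (X Y : C) [ExactPairing X Y] : ExactPairing (F.obj X) (F.obj Y) where
  coevaluation' := ε F ≫ F.map (η_ X Y) ≫ Functor.OplaxMonoidal.δ F X Y
  evaluation' := Functor.LaxMonoidal.μ F Y X ≫ F.map (ε_ X Y) ≫ Functor.OplaxMonoidal.η F
  coevaluation_evaluation' := by
    have h := congrArg (fun k => Functor.LaxMonoidal.μ F Y (𝟙_ C) ≫ k ≫
      Functor.OplaxMonoidal.δ F (𝟙_ C) Y) (congrArg F.map
      (ExactPairing.coevaluation_evaluation X Y))
    simp only [Functor.map_comp, Functor.Monoidal.map_whiskerLeft,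
      Functor.Monoidal.map_whiskerRight, Functor.Monoidal.map_associator_inv,
      Functor.Monoidal.map_rightUnitor, Functor.Monoidal.map_leftUnitor_inv, Category.assoc,
      Functor.Monoidal.μ_δ, Functor.Monoidal.μ_δ_assoc, Category.comp_id] at h
    simp only [MonoidalCategory.whiskerLeft_comp, comp_whiskerRight, Category.assoc]
    rw [reassoc_of% h]
    simp [← MonoidalCategory.whiskerLeft_comp_assoc]
  evaluation_coevaluation' := by
    have h := congrArg (fun k => Functor.LaxMonoidal.μ F (𝟙_ C) X ≫ k ≫
      Functor.OplaxMonoidal.δ F X (𝟙_ C)) (congrArg F.map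
      (ExactPairing.evaluation_coevaluation X Y))
    simp only [Functor.map_comp, Functor.Monoidal.map_whiskerLeft,
      Functor.Monoidal.map_whiskerRight, Functor.Monoidal.map_associator,
      Functor.Monoidal.map_leftUnitor, Functor.Monoidal.map_rightUnitor_inv, Category.assoc,
      Functor.Monoidal.μ_δ, Functor.Monoidal.μ_δ_assoc, Category.comp_id] at h
    simp only [MonoidalCategory.whiskerLeft_comp, comp_whiskerRight, Category.assoc]
    rw [reassoc_of% h]
    simp [← comp_whiskerRight_assoc]

theorem mapExactPairing_coevaluation (X Y : C) [ExactPairing X Y] :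
    letI := mapExactPairing F X Y
    η_ (F.obj X) (F.obj Y) = ε F ≫ F.map (η_ X Y) ≫ Functor.OplaxMonoidal.δ F X Y := rfl

theorem map_dualPoint {X Y : C} [ExactPairing X Y] (p : 𝟙_ C ⟶ X) :
    letI := mapExactPairing F X Y
    dualPoint (D := F.obj Y) (ε F ≫ F.map p) = F.map (dualPoint (D := Y) p) ≫
      Functor.OplaxMonoidal.η F := by
  let := mapExactPairing F X Y
  change (ρ_ _).inv ≫ F.obj Y ◁ (ε F ≫ F.map p) ≫ 
    Functor.LaxMonoidal.μ F Y X ≫ F.map (ε_ X Y) ≫ Functor.OplaxMonoidal.η F = _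
  simp [dualPoint]

end MapExactPairing

section FaithfullyFlat

variable {R : Type u} [CommRing R] {d : ℕ} {C : Type w} [Category.{u} C] [MonoidalCategory C]
  [BraidedCategory C] [MonoidalClosed C] [HasColimits C] [AB5 C]

instance : HasExactColimitsOfShape ℕ C := by
  have := AB5OfSize_of_univLE.{0, 0} C
  exact AB5OfSize.ofShape ℕ

/-- Tensor functors send the regular comodule to a faithfully flat algebra. -/
theorem isFaithfullyFlat_map_regular (F : Rep R d ⥤ C) [F.Monoidal] [F.IsLeftAdjoint] :
    IsFaithfullyFlat (F.obj (Comod.regular R (GLRing R d))) := by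
  choose D hD using fun n => Comod.exists_exactPairing_filtComod R d n
  have inst (n : ℕ) : ExactPairing (Comod.filtComod R d n) (D n) := (hD n).some
  let inst' (n : ℕ) : ExactPairing ((Comod.filtFunctor R d ⋙ F).obj n) (F.obj (D n)) :=
    mapExactPairing F (Comod.filtComod R d n) (D n)
  have h := isFaithfullyFlat_of_isColimit (W := Comod.filtFunctor R d ⋙ F)
    (fun n => ε F ≫ F.map (Comod.filtPoint R d n)) (fun {m n} f => by
      have := congrArg F.map (Comod.filtPoint_map R d f)
      exact (Category.assoc _ _ _).trans (congrArg (ε F ≫ ·) ((F.map_comp _ _).symm.trans this)))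
    (fun n => F.obj (D n)) (fun n => by
      have h := (Comod.isAugmentation_dualPoint_filtPoint R d n (D n)).map F
      rw [← map_dualPoint] at h
      exact h)
    (isColimitOfPreserves F (Comod.isColimitFiltCocone R d))
    (ε F ≫ F.map η[Comod.regular R (GLRing R d)])
    (fun n => by
      have := congrArg F.map (Comod.filtPoint_comp R d n)
      rw [Functor.map_comp] at this
      exact (Category.assoc _ _ _).trans (congrArg (ε F ≫ ·) this))
  exact ⟨h.1, h.2⟩

end FaithfullyFlat

open scoped Obj

/-! ### The universal property of the regular comodule among commutative algebras. -/

namespace Comod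

section CarrierRing

variable {R : Type u} [CommRing R] {H : Type u} [CommRing H] [Bialgebra R H]

section

variable (A : Comod R H) [MonObj A]

/-- The multiplication of an algebra in comodules. -/
def carrierMul : A.carrier ⊗[R] A.carrier →ₗ[R] A.carrier := (μ[A] : A ⊗ A ⟶ A).hom.hom

/-- The unit of an algebra in comodules. -/
def carrierOne : R →ₗ[R] A.carrier := (η[A] : 𝟙_ (Comod R H) ⟶ A).hom.hom

variable {A}

theorem carrierOne_mul (r : R) (x : A.carrier) :
    carrierMul A (carrierOne A r ⊗ₜ x) = r • x :=
  LinearMap.congr_fun (congrArg (fun k => k.hom.hom) (MonObj.one_mul A)) (r ⊗ₜ[R] x)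

theorem carrierMul_assoc (x y z : A.carrier) :
    carrierMul A (carrierMul A (x ⊗ₜ y) ⊗ₜ z) = carrierMul A (x ⊗ₜ carrierMul A (y ⊗ₜ z)) :=
  LinearMap.congr_fun (congrArg (fun k => k.hom.hom) (MonObj.mul_assoc A)) ((x ⊗ₜ[R] y) ⊗ₜ[R] z)

theorem carrierMul_comm [IsCommMonObj A] (x y : A.carrier) :
    carrierMul A (x ⊗ₜ y) = carrierMul A (y ⊗ₜ x) :=
  (LinearMap.congr_fun (congrArg (fun k => k.hom.hom) (IsCommMonObj.mul_comm A))
    (x ⊗ₜ[R] y)).symm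

variable (A) [IsCommMonObj A]

/-- The ring of elements of a commutative algebra in comodules. -/
abbrev carrierRing : CommRing A.carrier :=
  { (inferInstance : AddCommGroup A.carrier) with
    one := carrierOne A 1
    mul := fun x y => carrierMul A (x ⊗ₜ y)
    mul_assoc := carrierMul_assoc
    mul_comm := carrierMul_comm
    one_mul := fun x => (carrierOne_mul 1 x).trans (one_smul R x)
    mul_one := fun x => (carrierMul_comm _ _).trans ((carrierOne_mul 1 x).trans (one_smul R x))
    left_distrib := fun x y z => by
      change carrierMul A (x ⊗ₜ (y + z)) = carrierMul A (x ⊗ₜ y) + carrierMul A (x ⊗ₜ z)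
      rw [TensorProduct.tmul_add, map_add]
    right_distrib := fun x y z => by
      change carrierMul A ((x + y) ⊗ₜ z) = carrierMul A (x ⊗ₜ z) + carrierMul A (y ⊗ₜ z)
      rw [TensorProduct.add_tmul, map_add]
    zero_mul := fun x => by
      change carrierMul A ((0 : A.carrier) ⊗ₜ x) = 0
      rw [TensorProduct.zero_tmul, map_zero]
    mul_zero := fun x => by
      change carrierMul A (x ⊗ₜ (0 : A.carrier)) = 0
      rw [TensorProduct.tmul_zero, map_zero] }

/-- The algebra of elements of a commutative algebra in comodules. -/
abbrev carrierAlgebra : @Algebra R A.carrier _ (carrierRing A).toSemiring :=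
  letI := carrierRing A
  Algebra.ofModule
    (fun r x y => by
      change carrierMul A ((r • x) ⊗ₜ y) = r • carrierMul A (x ⊗ₜ y)
      rw [← TensorProduct.smul_tmul', map_smul])
    (fun r x y => by
      change carrierMul A (x ⊗ₜ (r • y)) = r • carrierMul A (x ⊗ₜ y)
      rw [TensorProduct.tmul_smul, map_smul])

end

variable {A : Comod R H} [MonObj A]

theorem coact_carrierMul (x y : A.carrier) : A.coact (carrierMul A (x ⊗ₜ y)) =
    (carrierMul A).lTensor H (mulShuffle _ _ (A.coact x ⊗ₜ A.coact y)) :=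
  (LinearMap.congr_fun (μ[A] : A ⊗ A ⟶ A).comm (x ⊗ₜ[R] y)).symm

theorem coact_carrierOne : A.coact (carrierOne A 1) = (1 : H) ⊗ₜ carrierOne A 1 :=
  (LinearMap.congr_fun (η[A] : 𝟙_ _ ⟶ A).comm (1 : R)).symm

theorem lTensor_carrierMul [IsCommMonObj A] (x y : H ⊗[R] A.carrier) :
    letI := carrierRing A
    letI := carrierAlgebra A
    (carrierMul A).lTensor H (mulShuffle _ _ (x ⊗ₜ y)) = (show H ⊗[R] A.carrier from x * y) := by
  let := carrierRing A
  let := carrierAlgebra A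
  induction x with
  | zero => simp
  | add x x' hx hx' =>
    simp only [TensorProduct.add_tmul, map_add, hx, hx']
    exact (add_mul x x' y).symm
  | tmul a m =>
    induction y with
    | zero => simp
    | add y y' hy hy' =>
      simp only [TensorProduct.tmul_add, map_add, hy, hy']
      exact (mul_add _ y y').symm
    | tmul b n =>
      rw [mulShuffle_tmul, LinearMap.lTensor_tmul]
      exact (Algebra.TensorProduct.tmul_mul_tmul a b m n).symm

end CarrierRing

section Universal

variable (R : Type u) [CommRing R] {d : ℕ}

/-- The columns of the generic matrix as morphisms to the regular comodule. -/
def column (j : Fin d) : std R d ⟶ regular R (GLRing R d) :=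
  ⟨ModuleCat.ofHom ((Pi.basisFun R (Fin d)).constr R fun i => GLRing.gen R d i j), by
    refine (Pi.basisFun R (Fin d)).ext fun i => ?_
    change (LinearMap.lTensor _ ((Pi.basisFun R (Fin d)).constr R fun i => GLRing.gen R d i j))
      (stdCoact R d (Pi.basisFun R (Fin d) i)) =
      Coalgebra.comul (((Pi.basisFun R (Fin d)).constr R fun i => GLRing.gen R d i j)
        (Pi.basisFun R (Fin d) i))
    simp only [stdCoact_basis, map_sum, LinearMap.lTensor_tmul, Module.Basis.constr_basis,
      GLRing.comul_gen]⟩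

theorem column_basis (i j : Fin d) :
    (column R j).hom.hom (Pi.basisFun R (Fin d) i) = GLRing.gen R d i j := by
  have h : (Pi.basisFun R (Fin d)).constr R (fun i => GLRing.gen R d i j)
      (Pi.basisFun R (Fin d) i) = GLRing.gen R d i j := Module.Basis.constr_basis _ R _ i
  exact h

variable {R} {A : Rep R d} [MonObj A] [IsCommMonObj A]

/-- The linear map which underlies a morphism out of the regular comodule. -/
def toLinearMap (φ : regular R (GLRing R d) ⟶ A) : GLRing R d →ₗ[R] A.carrier := φ.hom.hom

theorem toLinearMap_one (φ : regular R (GLRing R d) ⟶ A) [IsMonHom φ] :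
    toLinearMap φ 1 = carrierOne A 1 := by
  have h : toLinearMap φ (algebraMap R (GLRing R d) 1) = carrierOne A 1 :=
    LinearMap.congr_fun (congrArg (fun k => k.hom.hom) (IsMonHom.one_hom φ)) (1 : R)
  rwa [map_one] at h

theorem toLinearMap_mul (φ : regular R (GLRing R d) ⟶ A) [IsMonHom φ] (x y : GLRing R d) :
    toLinearMap φ (x * y) = carrierMul A (toLinearMap φ x ⊗ₜ toLinearMap φ y) := by
  let z : GLRing R d ⊗[R] GLRing R d := x ⊗ₜ y
  exact LinearMap.congr_fun (congrArg (fun k => k.hom.hom) (IsMonHom.mul_hom φ)) z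

/-- The algebra map which underlies a morphism of algebras in comodules. -/
def toAlgHom (φ : regular R (GLRing R d) ⟶ A) [IsMonHom φ] :
    letI := carrierRing A
    letI := carrierAlgebra A
    GLRing R d →ₐ[R] A.carrier :=
  letI := carrierRing A
  letI := carrierAlgebra A
  AlgHom.ofLinearMap (toLinearMap φ) (toLinearMap_one φ) (toLinearMap_mul φ)

/-- The columns take the basis vectors to the generators `x_ij`, and an algebra map out of
`R[x_ij]_det` is determined on these. -/
theorem monHom_ext {φ ψ : regular R (GLRing R d) ⟶ A} [IsMonHom φ] [IsMonHom ψ]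
    (h : ∀ j, column R j ≫ φ = column R j ≫ ψ) : φ = ψ := by
  let := carrierRing A
  let := carrierAlgebra A
  have : toAlgHom φ = toAlgHom ψ := GLRing.algHom_ext fun i j => by
    have := LinearMap.congr_fun (congrArg (fun k => k.hom.hom) (h j)) (Pi.basisFun R (Fin d) i)
    rw [← column_basis]
    exact this
  exact hom_ext (ModuleCat.hom_ext (LinearMap.ext fun x => AlgHom.congr_fun this x))

/-- The values `f_j(e_k)` form a matrix with left inverse `g`, hence define an algebra map from
`R[x_ij]_det`. Its compatibility with the coactions is an equality of algebra maps, and on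
generators it says that each `f_j` is a comodule map. -/
theorem exists_monHom (f : Fin d → (std R d ⟶ A)) (g : Fin d → Fin d → A.carrier)
    (hfg : ∀ i j, ∑ k, carrierMul A (g i k ⊗ₜ (f j).hom.hom (Pi.basisFun R (Fin d) k)) =
      if i = j then carrierOne A 1 else 0) :
    ∃ φ : regular R (GLRing R d) ⟶ A, IsMonHom φ ∧ ∀ j, column R j ≫ φ = f j := by
  let := carrierRing A
  let := carrierAlgebra A
  let X : Matrix (Fin d) (Fin d) A.carrier :=
    Matrix.of fun k j => (f j).hom.hom (Pi.basisFun R (Fin d) k)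
  have hX : IsUnit X.det := by
    refine Matrix.isUnit_det_of_left_inverse (B := Matrix.of g) ?_
    ext i j
    rw [Matrix.mul_apply, Matrix.one_apply]
    exact hfg i j
  let a : GLRing R d →ₐ[R] A.carrier := GLRing.lift X hX
  have ha : ∀ i j, a (GLRing.gen R d i j) = (f j).hom.hom (Pi.basisFun R (Fin d) i) :=
    fun i j => GLRing.lift_gen X hX i j
  let Δ : A.carrier →ₐ[R] GLRing R d ⊗[R] A.carrier :=
    AlgHom.ofLinearMap A.coact coact_carrierOne fun x y =>
      (coact_carrierMul x y).trans (lTensor_carrierMul _ _)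
  have hΔ : Δ.comp a = (Algebra.TensorProduct.map (AlgHom.id R (GLRing R d)) a).comp
      (Bialgebra.comulAlgHom R (GLRing R d)) := by
    refine GLRing.algHom_ext fun i j => ?_
    rw [AlgHom.comp_apply, AlgHom.comp_apply, Bialgebra.comulAlgHom_apply, GLRing.comul_gen,
      map_sum, ha]
    have h := LinearMap.congr_fun (f j).comm (Pi.basisFun R (Fin d) i)
    refine (Eq.symm h).trans ?_
    let fj : (Fin d → R) →ₗ[R] A.carrier := (f j).hom.hom
    change fj.lTensor (GLRing R d) (stdCoact R d (Pi.basisFun R (Fin d) i)) = _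
    rw [stdCoact_basis, map_sum]
    refine Finset.sum_congr rfl fun k _ => ?_
    rw [Algebra.TensorProduct.map_tmul, ha, LinearMap.lTensor_tmul]
    rfl
  refine ⟨⟨ModuleCat.ofHom a.toLinearMap, ?_⟩, ⟨?_, ?_⟩, fun j => ?_⟩
  · exact LinearMap.ext fun x => (AlgHom.congr_fun hΔ x).symm
  · refine hom_ext (ModuleCat.hom_ext (LinearMap.ext_ring ?_))
    exact (congrArg a (map_one (algebraMap R (GLRing R d)))).trans (map_one a)
  · exact hom_ext (ModuleCat.MonoidalCategory.tensor_ext fun (x y : GLRing R d) => map_mul a x y)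
  · refine hom_ext (ModuleCat.hom_ext ((Pi.basisFun R (Fin d)).ext fun i => ?_))
    exact (congrArg a (column_basis R i j)).trans (ha i j)

end Universal

end Comod

open scoped Obj

/-! ### Algebra maps across a monoidal adjunction. -/

section MonoidalAdjunction

variable {D C : Type*} [Category* D] [MonoidalCategory D] [Category* C] [MonoidalCategory C]
  {F : D ⥤ C} {G : C ⥤ D} (adj : F ⊣ G) [G.LaxMonoidal]

section

variable [F.Monoidal] [adj.IsMonoidal]

theorem counit_one (A : C) [MonObj A] :
    F.map η[G.obj A] ≫ adj.counit.app A = Functor.OplaxMonoidal.η F ≫ η[A] := by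
  have h : F.map (G.map η[A]) ≫ adj.counit.app A = _ := adj.counit_naturality η[A]
  rw [Functor.obj.η_def, Functor.map_comp, Category.assoc, h,
    adj.map_ε_comp_counit_app_unit_assoc]

theorem counit_mul (A : C) [MonObj A] :
    F.map μ[G.obj A] ≫ adj.counit.app A = Functor.OplaxMonoidal.δ F _ _ ≫
      (adj.counit.app A ⊗ₘ adj.counit.app A) ≫ μ[A] := by
  have h : F.map (G.map μ[A]) ≫ adj.counit.app A = _ := adj.counit_naturality μ[A]
  rw [Functor.obj.μ_def, Functor.map_comp, Category.assoc, h,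
    adj.map_μ_comp_counit_app_tensor_assoc]

variable {A : C} [MonObj A]

theorem homEquiv_symm_mul {X Y : D} (f : X ⟶ G.obj A) (g : Y ⟶ G.obj A) :
    (adj.homEquiv _ _).symm ((f ⊗ₘ g) ≫ μ[G.obj A]) = Functor.OplaxMonoidal.δ F X Y ≫
      ((adj.homEquiv _ _).symm f ⊗ₘ (adj.homEquiv _ _).symm g) ≫ μ[A] := by
  rw [adj.homEquiv_counit, adj.homEquiv_counit, adj.homEquiv_counit, Functor.map_comp,
    Category.assoc, counit_mul, Functor.Monoidal.map_tensor, Category.assoc, Category.assoc,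
    Functor.Monoidal.μ_δ_assoc, tensorHom_comp_tensorHom_assoc]

/-- Together with the converse below, algebra maps `F H ⟶ A` correspond to algebra maps `H ⟶ G A`.
For comodules this moves questions about `F H` into `Rep(GL_d)`, where elements are available. -/
theorem isMonHom_homEquiv {H : D} [MonObj H] (b : F.obj H ⟶ A) [IsMonHom b] :
    IsMonHom (adj.homEquiv _ _ b) where
  one_hom := (adj.homEquiv _ _).symm.injective (by
    rw [adj.homEquiv_naturality_left_symm, Equiv.symm_apply_apply, adj.homEquiv_counit, counit_one,
      ← IsMonHom.one_hom b, Functor.obj.η_def, Category.assoc, Functor.Monoidal.η_ε_assoc])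
  mul_hom := (adj.homEquiv _ _).symm.injective (by
    rw [adj.homEquiv_naturality_left_symm, Equiv.symm_apply_apply, homEquiv_symm_mul,
      Equiv.symm_apply_apply, ← IsMonHom.mul_hom b, Functor.obj.μ_def, Category.assoc,
      Functor.Monoidal.δ_μ_assoc])

theorem isMonHom_homEquiv_symm {H : D} [MonObj H] (b : H ⟶ G.obj A) [IsMonHom b] :
    IsMonHom ((adj.homEquiv _ _).symm b) where
  one_hom := by
    rw [Functor.obj.η_def, Category.assoc, ← adj.homEquiv_naturality_left_symm, IsMonHom.one_hom,
      adj.homEquiv_counit, counit_one, Functor.Monoidal.ε_η_assoc]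
  mul_hom := by
    rw [Functor.obj.μ_def, Category.assoc, ← adj.homEquiv_naturality_left_symm, IsMonHom.mul_hom,
      homEquiv_symm_mul, Functor.Monoidal.μ_δ_assoc]

end

theorem isCommMonObj_rightAdjoint [BraidedCategory D] [BraidedCategory C] [F.Braided]
    [adj.IsMonoidal] (A : C) [MonObj A] [IsCommMonObj A] : IsCommMonObj (G.obj A) := by
  refine ⟨(adj.homEquiv _ _).symm.injective ?_⟩
  rw [adj.homEquiv_counit, adj.homEquiv_counit, Functor.map_comp, Category.assoc, counit_mul,
    F.map_braiding, Category.assoc, Category.assoc, Functor.Monoidal.μ_δ_assoc,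
    ← BraidedCategory.braiding_naturality_assoc]
  exact congrArg (fun k => Functor.OplaxMonoidal.δ F _ _ ≫ (adj.counit.app A ⊗ₘ adj.counit.app A) ≫ k)
    (IsCommMonObj.mul_comm A)

end MonoidalAdjunction

namespace Comod

section Sections

variable {R : Type u} [CommRing R] {d : ℕ} {A : Rep R d} [MonObj A]

theorem coevaluation_tensorHom_mul {V' : Rep R d} (t : (Fin d → R) ⊗[R] V'.carrier)
    (c : Fin d →₀ V'.carrier)
    (hc : (c.sum fun i n => Pi.basisFun R (Fin d) i ⊗ₜ[R] n) = t)
    (f : std R d ⟶ A) (g : V' ⟶ A) : ((f ⊗ₘ g) ≫ μ[A]).hom.hom t =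
      ∑ k, carrierMul A (f.hom.hom (Pi.basisFun R (Fin d) k) ⊗ₜ g.hom.hom (c k)) := by
  let m : (Fin d → R) ⊗[R] V'.carrier →ₗ[R] A.carrier := ((f ⊗ₘ g) ≫ μ[A]).hom.hom
  change m t = _
  rw [← hc, Finsupp.sum_fintype _ _ (by simp), map_sum]
  rfl

end Sections

section MapUniversal

variable {R : Type u} [CommRing R] {d : ℕ} {C : Type w} [Category.{u} C] [Preadditive C]
  [MonoidalCategory C] [SymmetricCategory C] (F : Rep R d ⥤ C) [F.Braided]
  [F.IsLeftAdjoint] {A : C} [MonObj A] [IsCommMonObj A]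

theorem map_monHom_ext {b b' : F.obj (regular R (GLRing R d)) ⟶ A} [IsMonHom b] [IsMonHom b']
    (h : ∀ j, F.map (column R j) ≫ b = F.map (column R j) ≫ b') : b = b' := by
  let adj := Adjunction.ofIsLeftAdjoint F
  let := adj.rightAdjointLaxMonoidal
  have := isCommMonObj_rightAdjoint adj A
  have := isMonHom_homEquiv adj b
  have := isMonHom_homEquiv adj b'
  refine (adj.homEquiv _ _).injective (monHom_ext fun j => ?_)
  rw [← adj.homEquiv_naturality_left, h, adj.homEquiv_naturality_left]

/-- After transposition this is `exists_monHom`. The inverse matrix has to be given by morphisms out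
of the dual `V'`, since a statement about elements makes no sense in `C`. -/
theorem exists_monHom_of_exactPairing [F.Additive] {V' : Rep R d} [ExactPairing (std R d) V']
    (f : Fin d → (F.obj (std R d) ⟶ A)) (g : Fin d → (F.obj V' ⟶ A))
    (hfg : ∀ i j, F.map (η_ (std R d) V') ≫ Functor.OplaxMonoidal.δ F _ _ ≫ (f j ⊗ₘ g i) ≫ μ[A] =
      if i = j then Functor.OplaxMonoidal.η F ≫ η[A] else 0) :
    ∃ b : F.obj (regular R (GLRing R d)) ⟶ A, IsMonHom b ∧ ∀ j, F.map (column R j) ≫ b = f j := by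
  let adj := Adjunction.ofIsLeftAdjoint F
  let := adj.rightAdjointLaxMonoidal
  have := isCommMonObj_rightAdjoint adj A
  let f' := fun j => adj.homEquiv _ _ (f j)
  let g' := fun j => adj.homEquiv _ _ (g j)
  have key : ∀ i j, η_ (std R d) V' ≫ (f' j ⊗ₘ g' i) ≫ μ[F.rightAdjoint.obj A] =
      if i = j then η[F.rightAdjoint.obj A] else 0 := by
    intro i j
    apply (adj.homEquiv _ _).symm.injective
    rw [adj.homEquiv_naturality_left_symm, homEquiv_symm_mul, Equiv.symm_apply_apply,
      Equiv.symm_apply_apply, hfg]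
    split_ifs
    · rw [adj.homEquiv_counit, counit_one]
    · rw [adj.homEquiv_counit, Functor.map_zero, zero_comp]
  let t : (Fin d → R) ⊗[R] V'.carrier := (η_ (std R d) V').hom.hom (1 : R)
  -- The coevaluation is `∑ e_k ⊗ c_k`; evaluating the row functionals on the `c_k` gives the
  -- entries of the inverse matrix.
  obtain ⟨c, hc⟩ := TensorProduct.eq_repr_basis_left (Pi.basisFun R (Fin d)) t
  obtain ⟨φ, hφ, h⟩ := exists_monHom f' (fun i k => (g' i).hom.hom (c k)) fun i j => by
    have h1 := LinearMap.congr_fun (congrArg (fun k => k.hom.hom) (key i j)) (1 : R)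
    have h2 := coevaluation_tensorHom_mul t c hc (f' j) (g' i)
    refine (Finset.sum_congr rfl fun k _ => carrierMul_comm _ _).trans
      ((h2.symm.trans h1).trans ?_)
    split_ifs <;> rfl
  exact ⟨(adj.homEquiv _ _).symm φ, isMonHom_homEquiv_symm adj φ, fun j => by
    rw [← adj.homEquiv_naturality_left_symm, h, Equiv.symm_apply_apply]⟩

theorem exists_monHom_map [F.Additive] (f : Fin d → (F.obj (std R d) ⟶ A))
    (c : Fin d → (𝟙_ C ⟶ A ⊗ F.obj (std R d)))
    (hfc : ∀ i j, c i ≫ A ◁ f j ≫ μ[A] = if i = j then η[A] else 0) :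
    ∃ b : F.obj (regular R (GLRing R d)) ⟶ A, IsMonHom b ∧ ∀ j, F.map (column R j) ≫ b = f j := by
  obtain ⟨V', ⟨hV⟩⟩ := exists_exactPairing (std R d) (Pi.basisFun R (Fin d))
  let := mapExactPairing F (std R d) V'
  -- Duality turns a section `𝟙 ⟶ A ⊗ F(std)` into a morphism `F V' ⟶ A`.
  let g : Fin d → (F.obj V' ⟶ A) := fun i => (ρ_ _).inv ≫
    (tensorLeftHomEquiv _ (F.obj (std R d)) (F.obj V') A).symm (c i ≫ (β_ _ _).hom)
  refine exists_monHom_of_exactPairing F f g fun i j => ?_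
  have h1 : η_ (F.obj (std R d)) (F.obj V') ≫ F.obj (std R d) ◁ g i = c i ≫ (β_ _ _).hom := by
    have h := (tensorLeftHomEquiv _ (F.obj (std R d)) (F.obj V') A).apply_symm_apply
      (c i ≫ (β_ _ _).hom)
    rw [← h]
    change _ = (λ_ _).inv ≫ η_ _ _ ▷ _ ≫ (α_ _ _ _).hom ≫ _ ◁ _
    rw [MonoidalCategory.whiskerLeft_comp, unitors_inv_equal, ← rightUnitor_inv_naturality_assoc,
      rightUnitor_tensor_inv, Category.assoc, Iso.inv_hom_id_assoc]
  rw [mapExactPairing_coevaluation, Category.assoc, Category.assoc] at h1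
  rw [← cancel_epi (ε F), tensorHom_def', Category.assoc, reassoc_of% h1,
    ← BraidedCategory.braiding_naturality_right_assoc, IsCommMonObj.mul_comm, hfc]
  split_ifs
  · rw [Functor.Monoidal.ε_η_assoc]
  · rw [comp_zero]

end MapUniversal

end Comod

open scoped Obj

section RightUnitor

variable {C : Type*} [Category* C] [MonoidalCategory C] {B : C} [MonObj B]

theorem freeUnitApp_tensorUnit : freeUnitApp B (𝟙_ C) = η[B] ≫ (ρ_ B).inv := by
  rw [freeUnitApp, unitors_inv_equal, rightUnitor_inv_naturality]

theorem freeActApp_tensorUnit :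
    freeActApp B (𝟙_ C) = B ◁ (ρ_ B).hom ≫ μ[B] ≫ (ρ_ B).inv := by
  rw [freeActApp, rightUnitor_inv_naturality, rightUnitor_tensor_inv, Category.assoc,
    ← MonoidalCategory.whiskerLeft_comp_assoc, Iso.hom_inv_id, MonoidalCategory.whiskerLeft_id,
    Category.id_comp]

theorem kl_rightUnitor {X Y : C} (c : X ⟶ B ⊗ Y) (f : Y ⟶ B) :
    kl B c (f ≫ (ρ_ B).inv) = (c ≫ B ◁ f ≫ μ[B]) ≫ (ρ_ B).inv := by
  rw [kl, freeActApp_tensorUnit, MonoidalCategory.whiskerLeft_comp, Category.assoc, Category.assoc,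
    Category.assoc, ← MonoidalCategory.whiskerLeft_comp_assoc B (ρ_ B).inv, Iso.inv_hom_id,
    MonoidalCategory.whiskerLeft_id, Category.id_comp]

end RightUnitor

/-! ### Frames of a free module and Kleisli isomorphisms with the standard object. -/

section PreadditiveKleisli

variable {C : Type*} [Category* C] [Preadditive C] [MonoidalCategory C] [MonoidalPreadditive C]
  {B : C} [MonObj B] {X Y Z : C}

theorem kl_sum_left {J : Type*} (s : Finset J) (f : J → (X ⟶ B ⊗ Y)) (g : Y ⟶ B ⊗ Z) :
    kl B (∑ j ∈ s, f j) g = ∑ j ∈ s, kl B (f j) g := by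
  simp only [kl, Preadditive.sum_comp]

theorem kl_sum_right {J : Type*} (s : Finset J) (f : X ⟶ B ⊗ Y) (g : J → (Y ⟶ B ⊗ Z)) :
    kl B f (∑ j ∈ s, g j) = ∑ j ∈ s, kl B f (g j) := by
  simp only [kl, whiskerLeft_sum, Preadditive.sum_comp, Preadditive.comp_sum]

/-- A basis of the free module `B ⊗ M`, given by the coordinate functions `f` and the basis
elements `c`. -/
structure IsFrame {M : C} {d : ℕ} (f : Fin d → (M ⟶ B)) (c : Fin d → (𝟙_ C ⟶ B ⊗ M)) : Prop where
  coord (i j : Fin d) : c i ≫ B ◁ f j ≫ μ[B] = if i = j then η[B] else 0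
  sum : ∑ j, kl B (f j ≫ (ρ_ B).inv) (c j) = freeUnitApp B M

theorem IsFrame.kl_coord {M : C} {d : ℕ} {f : Fin d → (M ⟶ B)} {c : Fin d → (𝟙_ C ⟶ B ⊗ M)}
    (h : IsFrame f c) (i j : Fin d) :
    kl B (c i) (f j ≫ (ρ_ B).inv) = if i = j then freeUnitApp B (𝟙_ C) else 0 := by
  rw [kl_rightUnitor, h.coord, freeUnitApp_tensorUnit]
  split_ifs
  · rfl
  · rw [zero_comp]

end PreadditiveKleisli

section Trivialization

variable {C : Type w} [Category.{u} C] [Preadditive C] [MonoidalCategory C]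
  [MonoidalPreadditive C] [HasColimits C] {B : C} [MonObj B] {d : ℕ} {M : C}

/-- Restriction of the two `B`-linear maps to generators: the coordinates are `e` along the unit `M
⟶ B ⊗ M`, and the basis elements are the images of the unit vectors under the inverse. -/
theorem exists_isFrame_of_iso (e : freeModule B M ≅ powModule B d) :
    ∃ (f : Fin d → (M ⟶ B)) (c : Fin d → (𝟙_ C ⟶ B ⊗ M)), IsFrame f c := by
  let p : B ⊗ M ⟶ ⨁ fun _ : Fin d => B := e.hom.hom
  let q : (⨁ fun _ : Fin d => B) ⟶ B ⊗ M := e.inv.hom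
  have hpq : p ≫ q = 𝟙 _ := congrArg Mod.Hom.hom e.hom_inv_id
  have hqp : q ≫ p = 𝟙 _ := congrArg Mod.Hom.hom e.inv_hom_id
  let s : B ⊗ (⨁ fun _ : Fin d => B) ⟶ ⨁ fun _ : Fin d => B :=
    biproduct.lift fun i => B ◁ biproduct.π (fun _ : Fin d => B) i ≫ μ[B]
  have hp : freeActApp B M ≫ p = B ◁ p ≫ s := IsModHom.smul_hom (A := B) (f := e.hom.hom)
  have hq : s ≫ q = B ◁ q ≫ freeActApp B M := IsModHom.smul_hom (A := B) (f := e.inv.hom)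
  have hs (i : Fin d) : s ≫ biproduct.π _ i = B ◁ biproduct.π _ i ≫ μ[B] := biproduct.lift_π _ _
  have hs' (i : Fin d) : B ◁ biproduct.ι (fun _ : Fin d => B) i ≫ s =
      μ[B] ≫ biproduct.ι (fun _ : Fin d => B) i := by
    refine biproduct.hom_ext _ _ fun j => ?_
    rw [Category.assoc, hs, Category.assoc, ← MonoidalCategory.whiskerLeft_comp_assoc]
    by_cases h : i = j
    · subst h
      simp
    · rw [biproduct.ι_π_ne _ h, comp_zero, MonoidalPreadditive.whiskerLeft_zero, zero_comp]
  refine ⟨fun j => freeUnitApp B M ≫ p ≫ biproduct.π _ j, fun j => η[B] ≫ biproduct.ι (fun _ : Fin d => B) j ≫ q,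
    fun i j => ?_, ?_⟩
  · have h : B ◁ (freeUnitApp B M ≫ p ≫ biproduct.π _ j) ≫ μ[B] = p ≫ biproduct.π _ j := by
      simp only [MonoidalCategory.whiskerLeft_comp, Category.assoc]
      rw [← hs, ← reassoc_of% hp, reassoc_of% whiskerLeft_freeUnitApp_freeActApp B M]
    rw [h, Category.assoc, Category.assoc, reassoc_of% hqp]
    split_ifs with hij
    · subst hij
      simp
    · rw [biproduct.ι_π_ne _ hij, comp_zero]
  · have h (j : Fin d) : kl B ((freeUnitApp B M ≫ p ≫ biproduct.π _ j) ≫ (ρ_ B).inv)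
        (η[B] ≫ biproduct.ι (fun _ : Fin d => B) j ≫ q) =
        freeUnitApp B M ≫ p ≫ (biproduct.π _ j ≫ biproduct.ι (fun _ : Fin d => B) j) ≫ q := by
      simp only [kl, MonoidalCategory.whiskerLeft_comp, Category.assoc]
      rw [← hq, reassoc_of% hs', MonObj.mul_one_assoc, Iso.inv_hom_id_assoc]
    rw [Finset.sum_congr rfl fun j _ => h j, ← Preadditive.comp_sum, ← Preadditive.comp_sum,
      ← Preadditive.sum_comp, biproduct.total, Category.id_comp, hpq, Category.comp_id]

theorem IsFrame.nonempty_iso {f : Fin d → (M ⟶ B)} {c : Fin d → (𝟙_ C ⟶ B ⊗ M)}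
    (h : IsFrame f c) : Nonempty (freeModule B M ≅ powModule B d) := by
  let s : B ⊗ (⨁ fun _ : Fin d => B) ⟶ ⨁ fun _ : Fin d => B :=
    biproduct.lift fun i => B ◁ biproduct.π (fun _ : Fin d => B) i ≫ μ[B]
  have hs (i : Fin d) : s ≫ biproduct.π _ i = B ◁ biproduct.π _ i ≫ μ[B] := biproduct.lift_π _ _
  let p : B ⊗ M ⟶ ⨁ fun _ : Fin d => B := biproduct.lift fun j => B ◁ f j ≫ μ[B]
  let q : (⨁ fun _ : Fin d => B) ⟶ B ⊗ M :=
    biproduct.desc fun j => (ρ_ B).inv ≫ B ◁ c j ≫ freeActApp B M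
  have hp (j : Fin d) : p ≫ biproduct.π _ j = B ◁ f j ≫ μ[B] := biproduct.lift_π _ _
  have hq (j : Fin d) : biproduct.ι _ j ≫ q = (ρ_ B).inv ≫ B ◁ c j ≫ freeActApp B M :=
    biproduct.ι_desc _ _
  have act (j : Fin d) : freeActApp B M ≫ B ◁ f j ≫ μ[B] = B ◁ (B ◁ f j ≫ μ[B]) ≫ μ[B] := by
    rw [← reassoc_of% freeActApp_naturality, MonoidalCategory.whiskerLeft_comp, Category.assoc,
      freeActApp, Category.assoc, MonObj.mul_assoc, Iso.inv_hom_id_assoc]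
  have hpm : freeActApp B M ≫ p = B ◁ p ≫ s := by
    refine biproduct.hom_ext _ _ fun j => ?_
    rw [Category.assoc, Category.assoc, hp, hs, act, ← MonoidalCategory.whiskerLeft_comp_assoc, hp]
  have hqp : q ≫ p = 𝟙 _ := by
    refine biproduct.hom_ext' _ _ fun i => biproduct.hom_ext _ _ fun j => ?_
    rw [Category.assoc, Category.assoc, reassoc_of% hq, hp, act,
      ← MonoidalCategory.whiskerLeft_comp_assoc, h.coord, Category.comp_id]
    split_ifs with hij
    · subst hij
      simp
    · rw [biproduct.ι_π_ne _ hij, MonoidalPreadditive.whiskerLeft_zero, zero_comp, comp_zero]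
  have hpq : p ≫ q = 𝟙 _ := by
    have hj (j : Fin d) : p ≫ (biproduct.π _ j ≫ biproduct.ι (fun _ : Fin d => B) j) ≫ q =
        B ◁ kl B (f j ≫ (ρ_ B).inv) (c j) ≫ freeActApp B M := by
      simp only [kl, MonoidalCategory.whiskerLeft_comp, Category.assoc]
      rw [← freeActApp_assoc, reassoc_of% freeActApp_naturality, freeActApp_tensorUnit, Category.assoc, Category.assoc,
        ← MonoidalCategory.whiskerLeft_comp_assoc B (ρ_ B).inv, Iso.inv_hom_id,
        MonoidalCategory.whiskerLeft_id, Category.id_comp, reassoc_of% hp, hq]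
    rw [← Category.id_comp q, ← biproduct.total, Preadditive.sum_comp, Preadditive.comp_sum,
      Finset.sum_congr rfl fun j _ => hj j, ← Preadditive.sum_comp, ← whiskerLeft_sum, h.sum,
      whiskerLeft_freeUnitApp_freeActApp]
  -- Linearity of `q` follows from that of its inverse `p`.
  have hqm : s ≫ q = B ◁ q ≫ freeActApp B M := by
    rw [← Category.comp_id (freeActApp B M), ← hpq, reassoc_of% hpm,
      ← MonoidalCategory.whiskerLeft_comp_assoc, hqp, MonoidalCategory.whiskerLeft_id,
      Category.id_comp]
  exact ⟨{ hom := Mod.Hom.mk' (M := freeModule B M) (N := powModule B d) p hpm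
           inv := Mod.Hom.mk' (M := powModule B d) (N := freeModule B M) q hqm
           hom_inv_id := Mod.hom_ext _ _ hpq
           inv_hom_id := Mod.hom_ext _ _ hqp }⟩

end Trivialization

section Standard

variable (R : Type u) [CommRing R] (C : Type w) [Category.{u} C] [Preadditive C] [Linear R C]
  [MonoidalCategory C] [BraidedCategory C] [MonoidalClosed C] [HasColimits C]
  [MonoidalPreadditive C] [MonoidalLinear R C] (d : ℕ)

/-- The direct sum of `d` copies of the unit. -/
abbrev freeStd : C := (free R C).obj (ModuleCat.of R (Fin d → R))

variable {d}

/-- The basis elements of the direct sum of copies of the unit. -/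
def stdElt (i : Fin d) : 𝟙_ C ⟶ freeStd R C d :=
  freeElt (W := ModuleCat.of R (Fin d → R)) (Pi.basisFun R (Fin d) i)

/-- The coordinates of the direct sum of copies of the unit. -/
def stdCoord (j : Fin d) : freeStd R C d ⟶ 𝟙_ C :=
  (free R C).map (ModuleCat.ofHom (Y := 𝟙_ (ModuleCat.{u} R)) (LinearMap.proj (R := R) j)) ≫
    Functor.OplaxMonoidal.η (free R C)

theorem stdElt_stdCoord (i j : Fin d) :
    stdElt R C i ≫ stdCoord R C j = if i = j then 𝟙 _ else 0 := by
  let W := ModuleCat.of R (Fin d → R)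
  let p : W ⟶ 𝟙_ (ModuleCat.{u} R) := ModuleCat.ofHom (Y := 𝟙_ (ModuleCat.{u} R)) (LinearMap.proj (R := R) j)
  let x : W := Pi.basisFun R (Fin d) i
  change freeElt x ≫ (free R C).map p ≫ Functor.OplaxMonoidal.η (free R C) = _
  have h : p.hom x = if i = j then (show 𝟙_ (ModuleCat.{u} R) from (1 : R)) else 0 := by
    change Pi.basisFun R (Fin d) i j = _
    rw [Pi.basisFun_apply, Pi.single_apply]
    exact if_congr eq_comm rfl rfl
  rw [← Category.assoc, freeElt_comp, h]
  split_ifs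
  · rw [freeElt_one, Functor.Monoidal.ε_η]
  · rw [freeElt, map_zero]
    exact zero_comp

theorem sum_stdCoord_stdElt : ∑ j, stdCoord R C j ≫ stdElt R C j = 𝟙 (freeStd R C d) := by
  let W := ModuleCat.of R (Fin d → R)
  let p (j : Fin d) : W ⟶ 𝟙_ (ModuleCat.{u} R) :=
    ModuleCat.ofHom (Y := 𝟙_ (ModuleCat.{u} R)) (LinearMap.proj (R := R) j)
  let x (j : Fin d) : W := Pi.basisFun R (Fin d) j
  have hx (j : Fin d) : (freeElt (x j) : 𝟙_ C ⟶ _) = ε (free R C) ≫ (free R C).map (elt (x j)) := by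
    rw [← freeElt_one, freeElt_comp]
    exact congrArg freeElt (one_smul R (x j)).symm
  have h : ∑ j, p j ≫ elt (x j) = 𝟙 W := by
    refine ModuleCat.hom_ext ((Pi.basisFun R (Fin d)).ext fun i => ?_)
    rw [ModuleCat.hom_sum, LinearMap.sum_apply]
    change ∑ j, (Pi.basisFun R (Fin d) i j) • Pi.basisFun R (Fin d) j = Pi.basisFun R (Fin d) i
    simp [Pi.single_apply]
  rw [← CategoryTheory.Functor.map_id, ← h, Functor.map_sum]
  refine Finset.sum_congr rfl fun j _ => ?_
  change ((free R C).map (p j) ≫ Functor.OplaxMonoidal.η (free R C)) ≫ freeElt (x j) = _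
  rw [hx, Category.assoc, Functor.Monoidal.η_ε_assoc, Functor.map_comp]

variable {R C}

theorem freeStd_hom_ext {Y : C} {f g : freeStd R C d ⟶ Y}
    (h : ∀ i, stdElt R C i ≫ f = stdElt R C i ≫ g) : f = g := by
  rw [← Category.id_comp f, ← Category.id_comp g, ← sum_stdCoord_stdElt, Preadditive.sum_comp,
    Preadditive.sum_comp]
  simp only [Category.assoc, h]

variable (R) {B : C} [MonObj B] {M : C}

/-- The morphism with given coordinates. -/
def row (f : Fin d → (M ⟶ B)) : M ⟶ B ⊗ freeStd R C d :=
  ∑ j, (f j ≫ (ρ_ B).inv) ≫ B ◁ stdElt R C j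

/-- The coordinates of a morphism. -/
def rowCoord (s : M ⟶ B ⊗ freeStd R C d) (j : Fin d) : M ⟶ B :=
  s ≫ B ◁ stdCoord R C j ≫ (ρ_ B).hom

theorem rowCoord_comp_inv (s : M ⟶ B ⊗ freeStd R C d) (j : Fin d) :
    rowCoord R s j ≫ (ρ_ B).inv = s ≫ B ◁ stdCoord R C j := by
  rw [rowCoord, Category.assoc, Category.assoc, Iso.hom_inv_id, Category.comp_id]

theorem row_rowCoord (s : M ⟶ B ⊗ freeStd R C d) : row R (rowCoord R s) = s := by
  simp only [row, rowCoord_comp_inv, Category.assoc]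
  rw [← Preadditive.comp_sum]
  simp only [← MonoidalCategory.whiskerLeft_comp]
  rw [← whiskerLeft_sum, sum_stdCoord_stdElt, MonoidalCategory.whiskerLeft_id, Category.comp_id]

/-- With `KlIso.exists_isFrame`, a frame of `B ⊗ M` is the same as a Kleisli isomorphism from `M` to
the free object on `R^d`. The basis elements assemble to the inverse. -/
theorem IsFrame.klIso_row {f : Fin d → (M ⟶ B)} {c : Fin d → (𝟙_ C ⟶ B ⊗ M)} (h : IsFrame f c) :
    KlIso (row R f) := by
  let g : freeStd R C d ⟶ B ⊗ M := ∑ j, stdCoord R C j ≫ c j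
  have hg (i : Fin d) : stdElt R C i ≫ g = c i := by
    rw [Preadditive.comp_sum, Finset.sum_eq_single i]
    · rw [← Category.assoc, stdElt_stdCoord, if_pos rfl, Category.id_comp]
    · intro j _ hj
      rw [← Category.assoc, stdElt_stdCoord, if_neg hj.symm, zero_comp]
    · simp
  refine ⟨g, ?_, freeStd_hom_ext fun i => ?_⟩
  · rw [row, kl_sum_left, ← h.sum]
    refine Finset.sum_congr rfl fun j _ => ?_
    rw [kl_comp_mid, hg]
  · rw [← comp_kl, hg, row, kl_sum_right, Finset.sum_eq_single i]
    · rw [kl_comp, h.kl_coord, if_pos rfl, freeUnitApp_naturality]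
    · intro j _ hj
      rw [kl_comp, h.kl_coord, if_neg hj.symm, zero_comp]
    · simp

theorem KlIso.exists_isFrame {s : M ⟶ B ⊗ freeStd R C d} (h : KlIso s) :
    ∃ c, IsFrame (rowCoord R s) c := by
  obtain ⟨g, h1, h2⟩ := h
  refine ⟨fun i => stdElt R C i ≫ g, fun i j => ?_, ?_⟩
  · rw [← cancel_mono (ρ_ B).inv, ← kl_rightUnitor, rowCoord_comp_inv, kl_comp, comp_kl, h2,
      Category.assoc, ← freeUnitApp_naturality, ← Category.assoc, stdElt_stdCoord]
    split_ifs
    · rw [Category.id_comp, freeUnitApp_tensorUnit]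
    · rw [zero_comp, zero_comp]
  · simp only [rowCoord_comp_inv, kl_comp_mid]
    rw [← kl_sum_right]
    simp only [← Category.assoc]
    rw [← Preadditive.sum_comp, sum_stdCoord_stdElt, Category.id_comp, h1]

end Standard

open scoped Obj

/-! ### Trivializations of the standard representation as points of `GL_d`. -/

section StandardCoaction

variable (R : Type u) [CommRing R] (d : ℕ)

/-- The inclusion of a coordinate line in the trivial comodule. -/
def trivialElt {H : Type u} [CommRing H] [Bialgebra R H] {W : ModuleCat.{u} R} (x : W) :
    𝟙_ (Comod R H) ⟶ (Comod.trivial R H).obj W :=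
  ε (Comod.trivial R H) ≫ (Comod.trivial R H).map (elt x)

/-- The basis vectors of the standard representation, in the underlying module. -/
def stdVec (j : Fin d) : ModuleCat.of R (Fin d → R) := Pi.basisFun R (Fin d) j

theorem coactHom_std : ((Comod.coactHom R (GLRing R d)).app (std R d) :
      std R d ⟶ Comod.regular R (GLRing R d) ⊗ (Comod.trivial R (GLRing R d)).obj
        (ModuleCat.of R (Fin d → R))) =
    ∑ j, (Comod.column R j ≫ (ρ_ (Comod.regular R (GLRing R d))).inv) ≫
      Comod.regular R (GLRing R d) ◁ trivialElt R (stdVec R d j) := by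
  refine Comod.hom_ext (ModuleCat.hom_ext ((Pi.basisFun R (Fin d)).ext fun i => ?_))
  let ev : (std R d ⟶ Comod.regular R (GLRing R d) ⊗ (Comod.trivial R (GLRing R d)).obj
        (ModuleCat.of R (Fin d → R))) →+ GLRing R d ⊗[R] (Fin d → R) :=
    { toFun := fun f => f.hom.hom (Pi.basisFun R (Fin d) i)
      map_zero' := rfl
      map_add' := fun _ _ => rfl }
  change stdCoact R d (Pi.basisFun R (Fin d) i) = ev (∑ j, _)
  rw [stdCoact_basis, map_sum]
  refine Finset.sum_congr rfl fun j _ => ?_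
  have h : GLRing.gen R d i j = (Comod.column R j).hom.hom (Pi.basisFun R (Fin d) i) :=
    (Comod.column_basis R i j).symm
  have h1 : (Pi.basisFun R (Fin d) j : Fin d → R) = (1 : R) • Pi.basisFun R (Fin d) j :=
    (one_smul R _).symm
  exact congrArg₂ (fun (a : GLRing R d) (v : Fin d → R) => a ⊗ₜ[R] v) h h1

end StandardCoaction

section RowCoord

variable (R : Type u) [CommRing R] {C : Type w} [Category.{u} C] [Preadditive C] [Linear R C]
  [MonoidalCategory C] [BraidedCategory C] [MonoidalClosed C] [HasColimits C]
  [MonoidalPreadditive C] [MonoidalLinear R C] {d : ℕ} {B : C} [MonObj B] {M : C}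

theorem rowCoord_row (f : Fin d → (M ⟶ B)) (j : Fin d) : rowCoord R (row R f) j = f j := by
  rw [← cancel_mono (ρ_ B).inv, rowCoord_comp_inv, row, Preadditive.sum_comp,
    Finset.sum_eq_single j]
  · rw [Category.assoc, ← MonoidalCategory.whiskerLeft_comp, stdElt_stdCoord, if_pos rfl,
      MonoidalCategory.whiskerLeft_id, Category.comp_id]
  · intro i _ hi
    rw [Category.assoc, ← MonoidalCategory.whiskerLeft_comp, stdElt_stdCoord, if_neg hi,
      MonoidalPreadditive.whiskerLeft_zero, comp_zero]
  · simp

end RowCoord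

section StandardTwist

variable {R : Type u} [CommRing R] {d : ℕ} {C : Type w} [Category.{u} C] [Preadditive C]
  [Linear R C] [MonoidalCategory C] [SymmetricCategory C] [MonoidalClosed C] [HasColimits C]
  [MonoidalPreadditive C] [MonoidalLinear R C] {A : C} [MonObj A]

/-- The coaction of the general linear group as a transformation from a functor `F` to the free
functor. -/
def glTwist (F : Rep R d ⥤ C) [F.Monoidal] (b : F.obj (Comod.regular R (GLRing R d)) ⟶ A)
    (υ : Comod.trivial R (GLRing R d) ⋙ F ⟶ free R C) :
    F ⟶ (Comod.forget R (GLRing R d) ⋙ free R C) ⋙ tensorLeft A :=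
  twist (Comod.coactHom R (GLRing R d)) F b υ

/-- The coaction on the image of the standard representation. -/
def stdTwist (F : Rep R d ⥤ C) [F.Monoidal] (b : F.obj (Comod.regular R (GLRing R d)) ⟶ A)
    (υ : Comod.trivial R (GLRing R d) ⋙ F ⟶ free R C) : F.obj (std R d) ⟶ A ⊗ freeStd R C d :=
  (glTwist F b υ).app (std R d)

variable (F : Rep R d ⥤ C) [F.Braided] (b : F.obj (Comod.regular R (GLRing R d)) ⟶ A)
  (υ : Comod.trivial R (GLRing R d) ⋙ F ⟶ free R C) [NatTrans.IsMonoidal υ]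

theorem map_trivialElt (j : Fin d) :
    ε F ≫ F.map (trivialElt R (stdVec R d j)) ≫ υ.app (ModuleCat.of R (Fin d → R)) =
      stdElt R C j := by
  have h1 : F.map ((Comod.trivial R (GLRing R d)).map (elt (stdVec R d j))) ≫
      υ.app (ModuleCat.of R (Fin d → R)) = υ.app (𝟙_ _) ≫ (free R C).map (elt (stdVec R d j)) :=
    υ.naturality _
  have h2 : (ε F ≫ F.map (ε (Comod.trivial R (GLRing R d)))) ≫ υ.app (𝟙_ _) = ε (free R C) :=
    NatTrans.IsMonoidal.unit (τ := υ)
  rw [Category.assoc] at h2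
  rw [trivialElt, Functor.map_comp, Category.assoc, h1, reassoc_of% h2, ← freeElt_one, freeElt_comp]
  exact congrArg freeElt (one_smul R (stdVec R d j))

theorem mapKl_sum_column [F.Additive] :
    mapKl F b (∑ j, (Comod.column R j ≫ (ρ_ (Comod.regular R (GLRing R d))).inv) ≫
      Comod.regular R (GLRing R d) ◁ trivialElt R (stdVec R d j)) ≫
        A ◁ υ.app (ModuleCat.of R (Fin d → R)) =
      row R (fun j => F.map (Comod.column R j) ≫ b) := by
  have hs (s : Fin d → (std R d ⟶ Comod.regular R (GLRing R d) ⊗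
      (Comod.trivial R (GLRing R d)).obj (ModuleCat.of R (Fin d → R)))) :
      mapKl F b (∑ j, s j) = ∑ j, mapKl F b (s j) := by
    simp only [mapKl, Functor.map_sum, Preadditive.sum_comp]
  rw [row, hs, Preadditive.sum_comp]
  refine Finset.sum_congr rfl fun j _ => ?_
  rw [mapKl_comp_whiskerLeft, mapKl, Functor.map_comp, Functor.Monoidal.map_rightUnitor_inv,
    ← map_trivialElt F υ j]
  simp only [Category.assoc, Functor.Monoidal.μ_δ_assoc, MonoidalCategory.whiskerLeft_comp]
  rw [whisker_exchange_assoc, ← rightUnitor_inv_naturality_assoc]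

/-- The coaction `e_i ↦ ∑ x_ij ⊗ e_j` is the sum over the columns of the generic matrix; applying
`F` and `b` gives the columns of the point `b`. -/
theorem stdTwist_eq_row [F.Additive] :
    stdTwist F b υ = row R (fun j => F.map (Comod.column R j) ≫ b) :=
  (congrArg (mapKl F b · ≫ A ◁ υ.app (ModuleCat.of R (Fin d → R))) (coactHom_std R d)).trans
    (mapKl_sum_column F b υ)

variable {b υ}

theorem glTwist_ext [IsCommMonObj A] [F.Additive] [F.IsLeftAdjoint]
    {b b' : F.obj (Comod.regular R (GLRing R d)) ⟶ A} [IsMonHom b] [IsMonHom b']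
    (h : stdTwist F b υ = stdTwist F b' υ) : b = b' := by
  refine Comod.map_monHom_ext F fun j => ?_
  rw [stdTwist_eq_row, stdTwist_eq_row] at h
  rw [← rowCoord_row R (fun j => F.map (Comod.column R j) ≫ b) j, h, rowCoord_row]

/-- Together with `glTwist_ext`: algebra maps `F H ⟶ A` correspond bijectively to trivializations of
`F(std)` over `A`. The coordinates of `s` are the prescribed columns, and a frame completing them
supplies the inverse matrix. -/
theorem exists_glTwist [IsCommMonObj A] [F.Additive] [F.IsLeftAdjoint]
    {s : F.obj (std R d) ⟶ A ⊗ freeStd R C d} (h : KlIso s) :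
    ∃ b : F.obj (Comod.regular R (GLRing R d)) ⟶ A, IsMonHom b ∧ stdTwist F b υ = s := by
  obtain ⟨c, hc⟩ := h.exists_isFrame
  obtain ⟨b, hb, hb'⟩ := Comod.exists_monHom_map F (rowCoord R s) c hc.coord
  refine ⟨b, hb, ?_⟩
  rw [stdTwist_eq_row, funext hb', row_rowCoord]

end StandardTwist

open scoped Obj

instance {R : Type u} [CommRing R] {H : Type u} [CommRing H] [Bialgebra R H] :
    (Comod.forget R H).Braided where
  braided X Y := by
    change 𝟙 _ ≫ (β_ X.carrier Y.carrier).hom = (β_ X.carrier Y.carrier).hom ≫ 𝟙 _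
    rw [Category.comp_id, Category.id_comp]

theorem isMonHom_mul {C : Type*} [Category* C] [MonoidalCategory C] [BraidedCategory C] (B : C)
    [MonObj B] [IsCommMonObj B] : IsMonHom μ[B] where
  one_hom := by
    rw [MonObj.tensorObj.one_def, Category.assoc, MonObj.one_mul_hom, Iso.inv_hom_id_assoc]
  mul_hom := by
    rw [MonObj.tensorObj.mul_def, Category.assoc, MonObj.mul_mul_mul_comm]

/-! ### The fiber functor and the descent datum of a trivialized object. -/

section Fiber

variable (R : Type u) [CommRing R] (d : ℕ) (C : Type w) [Category.{u} C] [Preadditive C]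
  [Linear R C] [MonoidalCategory C] [SymmetricCategory C] [MonoidalClosed C] [HasColimits C]
  [MonoidalPreadditive C] [MonoidalLinear R C]

/-- The forgetful functor, with values in free objects of `C`. -/
abbrev fiber : Rep R d ⥤ C := Comod.forget R (GLRing R d) ⋙ free R C

/-- The restriction of the fiber functor to trivial representations. -/
def fiberTrivial : Comod.trivial R (GLRing R d) ⋙ fiber R d C ⟶ free R C :=
  retract (Comod.trivialForget R (GLRing R d)) (free R C)

instance : NatTrans.IsMonoidal (fiberTrivial R d C) := by
  unfold fiberTrivial
  infer_instance

variable {R d C} {A : C} [MonObj A]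

/-- The transformation `fiber ⟶ A ⊗ fiber` which is given by a point of the general linear
group. -/
def pointTwist (c : (fiber R d C).obj (Comod.regular R (GLRing R d)) ⟶ A) :
    fiber R d C ⟶ fiber R d C ⋙ tensorLeft A :=
  glTwist (fiber R d C) c (fiberTrivial R d C)

/-- The matrix of a point of the general linear group. -/
def pointMatrix (c : (fiber R d C).obj (Comod.regular R (GLRing R d)) ⟶ A) :
    freeStd R C d ⟶ A ⊗ freeStd R C d :=
  stdTwist (fiber R d C) c (fiberTrivial R d C)

instance (c : (fiber R d C).obj (Comod.regular R (GLRing R d)) ⟶ A) [IsMonHom c] :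
    NatTrans.IsMonoidal (pointTwist c) :=
  isMonoidal_twist (Comod.coactHom R (GLRing R d)) (fiber R d C) c (fiberTrivial R d C)

section

variable (F : Rep R d ⥤ C) [F.Braided] [F.Additive] [F.IsLeftAdjoint]
  (b : F.obj (Comod.regular R (GLRing R d)) ⟶ A)
  (υ : Comod.trivial R (GLRing R d) ⋙ F ⟶ free R C) [NatTrans.IsMonoidal υ]

instance [IsMonHom b] : NatTrans.IsMonoidal (glTwist F b υ) :=
  isMonoidal_twist (Comod.coactHom R (GLRing R d)) F b υ

theorem glTwist_app_hom {A' : C} [MonObj A'] (h : A ⟶ A') (W : Rep R d) :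
    (glTwist F b υ).app W ≫ h ▷ (fiber R d C).obj W = (glTwist F (b ≫ h) υ).app W :=
  twist_app_hom _ _ _ _ h W

theorem stdTwist_hom {A' : C} [MonObj A'] (h : A ⟶ A') :
    stdTwist F b υ ≫ h ▷ freeStd R C d = stdTwist F (b ≫ h) υ :=
  twist_app_hom _ _ _ _ h (std R d)

theorem klIso_glTwist [IsMonHom b] [IsIso υ] (W : Rep R d) :
    KlIso (A := A) (Y := (fiber R d C).obj W) ((glTwist F b υ).app W) :=
  klIso_twist (Comod.coactHom R (GLRing R d)) F b υ W (Comod.klIso_coactHom W)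

variable [IsCommMonObj A]

/-- A matrix identity on the standard representation propagates to all `W`: the composite is the
twist by the convolution of `b` and `c`, and a point is determined by its matrix. -/
theorem kl_glTwist {b₂ : F.obj (Comod.regular R (GLRing R d)) ⟶ A} [IsMonHom b] [IsMonHom b₂]
    (c : (fiber R d C).obj (Comod.regular R (GLRing R d)) ⟶ A) [IsMonHom c]
    (h : kl A (stdTwist F b υ) (pointMatrix c) = stdTwist F b₂ υ) (W : Rep R d) :
    kl A (Y := (fiber R d C).obj W) (Z := (fiber R d C).obj W) ((glTwist F b υ).app W)
      ((pointTwist c).app W) = (glTwist F b₂ υ).app W := by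
  let b' : F.obj (Comod.regular R (GLRing R d)) ⟶ A :=
    (glTwist F b υ).app (Comod.regular R (GLRing R d)) ≫ A ◁ c ≫ μ[A]
  have hb' : IsMonHom b' := isMonHom_conv (L := fiber R d C) (glTwist F b υ) c
  have key (W : Rep R d) : kl A (Y := (fiber R d C).obj W) (Z := (fiber R d C).obj W)
      ((glTwist F b υ).app W) ((pointTwist c).app W) = (glTwist F b' υ).app W :=
    twist_comp_retract (Comod.coactHom R (GLRing R d)) (Comod.trivialForget R (GLRing R d)) F
      (free R C) b υ c W (Comod.coactHom_coassoc W)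
  have : b' = b₂ := glTwist_ext F (υ := υ) ((key (std R d)).symm.trans h)
  rw [key, this]

end

/-- By `kl_glTwist` the twist is idempotent for Kleisli composition; it is also invertible, hence
the identity. -/
theorem pointTwist_eq_unit [IsCommMonObj A]
    (c : (fiber R d C).obj (Comod.regular R (GLRing R d)) ⟶ A) [IsMonHom c]
    (h : pointMatrix c = freeUnitApp A (freeStd R C d)) (W : Rep R d) :
    (pointTwist c).app W = freeUnitApp A ((fiber R d C).obj W) := by
  have : IsIso (fiberTrivial R d C) := by
    have : IsIso (Comod.trivialForget R (GLRing R d)) := inferInstanceAs (IsIso (𝟙 (𝟭 _)))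
    unfold fiberTrivial retract
    infer_instance
  obtain ⟨g, h1, h2⟩ := klIso_glTwist (fiber R d C) c (fiberTrivial R d C) W
  have key : kl A ((pointTwist c).app W) ((pointTwist c).app W) = (pointTwist c).app W :=
    kl_glTwist (fiber R d C) c (fiberTrivial R d C) (b₂ := c) c
      ((congrArg (kl A · (pointMatrix c)) h).trans (unit_kl _)) W
  have := congrArg (kl A g) key
  rw [← kl_assoc] at this
  change kl A (kl A g ((glTwist (fiber R d C) c (fiberTrivial R d C)).app W)) _ =
    kl A g ((glTwist (fiber R d C) c (fiberTrivial R d C)).app W) at this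
  rw [h2, unit_kl] at this
  exact this

variable {B : C} [MonObj B] [IsCommMonObj B] {M : C} {σ : M ⟶ B ⊗ freeStd R C d}

/-- The transition matrix of a trivialization. -/
theorem exists_transition (hσ : KlIso σ) :
    ∃ c : (fiber R d C).obj (Comod.regular R (GLRing R d)) ⟶ B ⊗ B, IsMonHom c ∧
      kl (B ⊗ B) (σ ≫ inl B B ▷ _) (pointMatrix c) = σ ≫ inr B B ▷ _ := by
  have h0 := hσ.hom (inl B B)
  obtain ⟨g, h1, h2⟩ := h0
  have h3 : kl (B ⊗ B) (σ ≫ inl B B ▷ _) (kl (B ⊗ B) g (σ ≫ inr B B ▷ _)) = σ ≫ inr B B ▷ _ := by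
    rw [← kl_assoc, h1, unit_kl]
  obtain ⟨c, hc, h⟩ := exists_glTwist (fiber R d C) (υ := fiberTrivial R d C)
    (s := kl (B ⊗ B) g (σ ≫ inr B B ▷ _)) (KlIso.kl ⟨_, h2, h1⟩ (hσ.hom (inr B B)))
  exact ⟨c, hc, (congrArg (kl (B ⊗ B) (σ ≫ inl B B ▷ freeStd R C d)) h).trans h3⟩

/-- Both conditions are identities between points of `GL_d`, so their matrices suffice. There `c` is
the transition from one pullback of `σ` to the other: it becomes trivial along the multiplication,
and the transitions compose over the triple tensor product. -/
theorem isDescentDatum_pointTwist (hσ : KlIso σ)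
    (c : (fiber R d C).obj (Comod.regular R (GLRing R d)) ⟶ B ⊗ B) [IsMonHom c]
    (h : kl (B ⊗ B) (σ ≫ inl B B ▷ _) (pointMatrix c) = σ ≫ inr B B ▷ _) :
    IsDescentDatum (pointTwist c) where
  norm W := by
    have := isMonHom_mul B
    have h1 : pointMatrix c ≫ μ[B] ▷ freeStd R C d = freeUnitApp B (freeStd R C d) := by
      have h2 := congrArg (· ≫ μ[B] ▷ freeStd R C d) h
      simp only [kl_hom, Category.assoc, ← comp_whiskerRight, inl_comp_mul, inr_comp_mul,
        id_whiskerRight, Category.comp_id] at h2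
      obtain ⟨g, hg, hg'⟩ := hσ
      have h3 := congrArg (kl B g) h2
      rwa [← kl_assoc, hg', unit_kl] at h3
    refine (glTwist_app_hom _ _ _ μ[B] W).trans ?_
    exact pointTwist_eq_unit (c ≫ μ[B]) ((stdTwist_hom _ _ _ μ[B]).symm.trans h1) W
  cocycle W := by
    have h1 : kl (B ⊗ (B ⊗ B)) (pointMatrix c ≫ (B ◁ inl B B) ▷ freeStd R C d)
        (pointMatrix c ≫ inr B (B ⊗ B) ▷ freeStd R C d) =
          pointMatrix c ≫ (B ◁ inr B B) ▷ freeStd R C d := by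
      -- The cosimplicial identities: the six composites `B ⟶ B ⊗ (B ⊗ B)` are pairwise equal,
      -- leaving three pullbacks of `σ`.
      have e1 : inl B B ≫ B ◁ inl B B = inl B B ≫ B ◁ inr B B := by
        have h1 : η[B] ≫ inl B B = η[B] ≫ inr B B :=
          (IsMonHom.one_hom _).trans (IsMonHom.one_hom _).symm
        simp only [inl, Category.assoc, ← MonoidalCategory.whiskerLeft_comp] at h1 ⊢
        rw [h1]
      have e2 : inr B B ≫ B ◁ inl B B = inl B B ≫ inr B (B ⊗ B) :=
        (freeUnitApp_naturality B (inl B B)).symm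
      have e3 : inr B B ≫ B ◁ inr B B = inr B B ≫ inr B (B ⊗ B) :=
        (freeUnitApp_naturality B (inr B B)).symm
      have kp := congrArg (· ≫ (B ◁ inl B B) ▷ freeStd R C d) h
      have kq := congrArg (· ≫ inr B (B ⊗ B) ▷ freeStd R C d) h
      have kr := congrArg (· ≫ (B ◁ inr B B) ▷ freeStd R C d) h
      simp only [kl_hom, Category.assoc, ← comp_whiskerRight] at kp kq kr
      rw [e2] at kp
      rw [← kp, kl_assoc, e1] at kq
      rw [e3, ← kq] at kr
      obtain ⟨g, hg, hg'⟩ := hσ.hom (inl B B ≫ B ◁ inr B B)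
      have h3 := congrArg (kl _ g) kr
      rw [← kl_assoc, ← kl_assoc, hg', unit_kl, unit_kl] at h3
      exact h3.symm
    have hp := glTwist_app_hom _ c (fiberTrivial R d C) (B ◁ inl B B) W
    have hq := glTwist_app_hom _ c (fiberTrivial R d C) (inr B (B ⊗ B)) W
    have hr := glTwist_app_hom _ c (fiberTrivial R d C) (B ◁ inr B B) W
    refine (congrArg₂ (kl _) hp hq).trans (Eq.trans ?_ hr.symm)
    refine kl_glTwist (fiber R d C) (c ≫ B ◁ inl B B) (fiberTrivial R d C) (c ≫ inr B (B ⊗ B)) ?_ W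
    have hp := stdTwist_hom _ c (fiberTrivial R d C) (B ◁ inl B B)
    have hq := stdTwist_hom _ c (fiberTrivial R d C) (inr B (B ⊗ B))
    have hr := stdTwist_hom _ c (fiberTrivial R d C) (B ◁ inr B B)
    exact (congrArg₂ (kl _) hp hq).symm.trans (h1.trans hr)

end Fiber

open scoped Obj

/-! ### Uniqueness of morphisms and construction of tensor functors. -/

section DescendedFunctor

variable {R : Type u} [CommRing R] {d : ℕ} {C : Type w} [Category.{u} C] [Preadditive C]
  [Linear R C] [MonoidalCategory C] [SymmetricCategory C] [MonoidalClosed C] [HasColimits C]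
  [MonoidalPreadditive C] [MonoidalLinear R C]

theorem isMonoidal_inv {D E : Type*} [Category* D] [MonoidalCategory D] [Category* E]
    [MonoidalCategory E] {F G : D ⥤ E} [F.LaxMonoidal] [G.LaxMonoidal] (τ : F ⟶ G) [IsIso τ]
    [NatTrans.IsMonoidal τ] : NatTrans.IsMonoidal (inv τ) := by
  have : NatTrans.IsMonoidal (asIso τ).hom := inferInstanceAs (NatTrans.IsMonoidal τ)
  exact inferInstanceAs (NatTrans.IsMonoidal (asIso τ).inv)

theorem isIso_freeTo_trivial (F : Rep R d ⥤ C) [F.Braided] [F.Additive] [F.Linear R]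
    [F.IsLeftAdjoint] : IsIso (freeTo (Comod.trivial R (GLRing R d) ⋙ F)) := by
  let G := Comod.trivial R (GLRing R d) ⋙ F
  have hG : G.IsLeftAdjoint := inferInstance
  have := (Adjunction.ofIsLeftAdjoint G).leftAdjoint_preservesColimits
  exact isIso_freeTo G

/-- The identification of the values on trivial representations with free objects. -/
theorem exists_trivial_iso (F : Rep R d ⥤ C) [F.Braided] [F.Additive] [F.Linear R]
    [F.IsLeftAdjoint] : ∃ υ : Comod.trivial R (GLRing R d) ⋙ F ⟶ free R C,
      NatTrans.IsMonoidal υ ∧ IsIso υ := by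
  have := isIso_freeTo_trivial F
  exact ⟨inv (freeTo _), isMonoidal_inv (freeTo _), inferInstance⟩

/-- If `x` and `y` agree after the unit, then `B ◁ x = B ◁ y`. So the equalizer of `x` and `y`
becomes invertible after `B ⊗ -`, hence was invertible. -/
theorem mono_freeUnitApp [HasEqualizers C] {B : C} [MonObj B] (hB : IsFaithfullyFlat B) (X : C) :
    Mono (freeUnitApp B X) where
  right_cancellation {Z} x y h := by
    have := hB.preservesFiniteLimits
    have := hB.reflectsIsomorphisms
    have h1 : B ◁ x = B ◁ y := by
      have h2 := congrArg (fun k => B ◁ k ≫ freeActApp B X) h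
      simpa only [MonoidalCategory.whiskerLeft_comp, Category.assoc,
        whiskerLeft_freeUnitApp_freeActApp, Category.comp_id] using h2
    have : IsIso ((tensorLeft B).map (equalizer.ι x y)) :=
      isIso_limit_cone_parallelPair_of_eq (f := (tensorLeft B).map x) (g := (tensorLeft B).map y) h1
        (isLimitForkMapOfIsLimit (tensorLeft B) (equalizer.condition x y)
          (equalizerIsEqualizer x y))
    have := isIso_of_reflects_iso (equalizer.ι x y) (tensorLeft B)
    rw [← cancel_epi (equalizer.ι x y), equalizer.condition]

theorem KlIso.mono [HasEqualizers C] {B : C} [MonObj B] (hB : IsFaithfullyFlat B) {X Y : C}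
    {f : X ⟶ B ⊗ Y} (hf : KlIso f) : Mono f where
  right_cancellation {Z} x y h := by
    obtain ⟨g, h1, -⟩ := hf
    have := mono_freeUnitApp hB X
    rw [← cancel_mono (freeUnitApp B X), ← h1, ← comp_kl, ← comp_kl, h]

section Uniqueness

variable {D E : Type*} [Category* D] [MonoidalCategory D] [Category* E] [MonoidalCategory E]

theorem isMonHom_app {F G : D ⥤ E} [F.LaxMonoidal] [G.LaxMonoidal] (α : F ⟶ G)
    [NatTrans.IsMonoidal α] (H : D) [MonObj H] : IsMonHom (α.app H) where
  one_hom := by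
    rw [Functor.obj.η_def, Functor.obj.η_def, Category.assoc, α.naturality,
      NatTrans.IsMonoidal.unit_assoc]
  mul_hom := by
    rw [Functor.obj.μ_def, Functor.obj.μ_def, Category.assoc, α.naturality,
      NatTrans.IsMonoidal.tensor_assoc]

variable {F G : Rep R d ⥤ C} [F.Braided] [F.Additive] [F.Linear R] [F.IsLeftAdjoint] [G.Braided]
  (α α' : F ⟶ G) [NatTrans.IsMonoidal α] [NatTrans.IsMonoidal α']

/-- The value of `F` at a trivial comodule is a free object, generated by the sections coming from
elements of `N`. Where a monoidal transformation sends these is forced by the unit. -/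
theorem app_trivial (N : ModuleCat.{u} R) : α.app ((Comod.trivial R (GLRing R d)).obj N) =
    α'.app ((Comod.trivial R (GLRing R d)).obj N) := by
  let T := Comod.trivial R (GLRing R d)
  have := isIso_freeTo_trivial F
  have key (α : F ⟶ G) [NatTrans.IsMonoidal α] (x : N) :
      freeElt x ≫ (freeTo (T ⋙ F)).app N ≫ α.app (T.obj N) =
        ε G ≫ G.map (ε T ≫ T.map (elt x)) := by
    have h1 : freeElt x ≫ (freeTo (T ⋙ F)).app N =
        (ε F ≫ F.map (ε T)) ≫ F.map (T.map (elt x)) := freeElt_freeTo (T ⋙ F) x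
    rw [reassoc_of% h1, ← Functor.map_comp_assoc, α.naturality,
      NatTrans.IsMonoidal.unit_assoc]
  rw [← cancel_epi ((freeTo (T ⋙ F)).app N)]
  exact free_hom_ext fun x => (key α x).trans (key α' x).symm

theorem app_regular (h : α.app (std R d) = α'.app (std R d)) :
    α.app (Comod.regular R (GLRing R d)) = α'.app (Comod.regular R (GLRing R d)) := by
  have := isMonHom_app α (Comod.regular R (GLRing R d))
  have := isMonHom_app α' (Comod.regular R (GLRing R d))
  exact Comod.map_monHom_ext F fun j => by rw [α.naturality, α'.naturality, h]

/-- The coaction embeds `W` in `H ⊗ W₀`, and `G` keeps this embedding mono because `G H` is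
faithfully flat. On `H ⊗ W₀` a monoidal transformation is determined by its components at `H` and
`W₀`. -/
theorem natTrans_ext [G.IsLeftAdjoint] [HasEqualizers C] [AB5 C]
    (h : α.app (std R d) = α'.app (std R d)) : α = α' := by
  refine NatTrans.ext (funext fun W => ?_)
  let H := Comod.regular R (GLRing R d)
  let Y := (Comod.trivial R (GLRing R d)).obj ((Comod.forget R (GLRing R d)).obj W)
  let r : W ⟶ H ⊗ Y := (Comod.coactHom R (GLRing R d)).app W
  have hG : IsFaithfullyFlat (G.obj H) := isFaithfullyFlat_map_regular G
  have hm : Mono (mapKl G (𝟙 (G.obj H)) r) :=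
    KlIso.mono hG (KlIso.mapKl G (𝟙 _) (Comod.klIso_coactHom W))
  have hm' : Mono (G.map r) := @mono_of_mono _ _ _ _ _ (G.map r) _ hm
  have key (α : F ⟶ G) [NatTrans.IsMonoidal α] : α.app (H ⊗ Y) =
      Functor.OplaxMonoidal.δ F H Y ≫ (α.app H ⊗ₘ α.app Y) ≫ Functor.LaxMonoidal.μ G H Y := by
    rw [← NatTrans.IsMonoidal.tensor, Functor.Monoidal.δ_μ_assoc]
  rw [← cancel_mono (G.map r), ← α.naturality, ← α'.naturality, key α, key α',
    app_regular α α' h, app_trivial α α']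

end Uniqueness

/-- Two morphisms of tensor functors agree if they agree on the standard representation. -/
theorem tensorFunctor_hom_ext [HasEqualizers C] [AB5 C] {F G : TensorFunctor R (Rep R d) C}
    {α α' : F ⟶ G} (h : α.hom.app (std R d) = α'.hom.app (std R d)) : α = α' :=
  TensorFunctor.Hom.ext (natTrans_ext α.hom α'.hom h)

variable {B : C} [MonObj B] [IsCommMonObj B] {M : C} {σ : M ⟶ B ⊗ freeStd R C d}

/-- The equalizer `E` is universal among tensor functors whose value at the standard representation
is identified with `M`. The second clause gives fullness as well, since any two such functors are
compared through `E`. -/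
theorem exists_tensorFunctor [HasEqualizers C] (hB : IsFaithfullyFlat B) (hσ : KlIso σ) :
    ∃ (E : TensorFunctor R (Rep R d) C) (e : E.functor.obj (std R d) ≅ M),
      ∀ (F : TensorFunctor R (Rep R d) C) (h : F.functor.obj (std R d) ≅ M),
        ∃ α : F ≅ E, α.hom.hom.app (std R d) = h.hom ≫ e.inv := by
  have := hB.reflectsIsomorphisms
  obtain ⟨c, hc, hcσ⟩ := exists_transition hσ
  have ht := isDescentDatum_pointTwist hσ c hcσ
  obtain ⟨E, hE, i, hi, hiso, hmono, hcond, hlift⟩ := ht.exists_braided hB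
  have hadd : E.Additive := additive_of_mono i
  have hlin : E.Linear R := linear_of_mono i R
  have hadj : E.IsLeftAdjoint := isLeftAdjoint_of_klIso hB i hiso
  -- By the choice of `c`, the trivialization `σ` itself lies in the equalizer. The lift is
  -- invertible because `σ` and `i` both are invertible over `B`.
  have hsol : σ ≫ (descent₀ B (fiber R d C)).app (std R d) =
      σ ≫ (descent₁ (pointTwist c)).app (std R d) := by
    rw [descent₁_app, descent₀_app]
    refine hcσ.symm.trans ?_
    rw [kl, Category.assoc]
    rfl
  obtain ⟨l, hl⟩ := hlift (std R d) M σ hsol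
  have hl' : IsIso l := (KlIso.of_comp (hiso (std R d)) (by rw [hl]; exact hσ)).isIso_of_reflects
  refine ⟨{ functor := E }, (asIso l).symm, fun F h => ?_⟩
  obtain ⟨υ, hυ, hυ'⟩ := exists_trivial_iso F.functor
  -- The trivialization of `F(std)` obtained from `σ` through `h` comes from an algebra map `b`, and
  -- `b` trivializes all of `F` over `B`. The images of `b` in `B ⊗ B` differ by `c`, so this
  -- trivialization lands in `E`.
  obtain ⟨b, hb, hbσ⟩ := exists_glTwist F.functor (υ := υ) (hσ.iso_comp h.hom)
  let θ : F.functor ⟶ fiber R d C ⋙ tensorLeft B := glTwist F.functor b υ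
  have hθ (W : Rep R d) : θ.app W ≫ (descent₀ B (fiber R d C)).app W =
      θ.app W ≫ (descent₁ (pointTwist c)).app W := by
    have h1 := glTwist_app_hom F.functor b υ (inl B B) W
    have h2 := glTwist_app_hom F.functor b υ (inr B B) W
    have h3 := kl_glTwist F.functor (b ≫ inl B B) υ (b₂ := b ≫ inr B B) c (by
      rw [← stdTwist_hom, ← stdTwist_hom, hbσ, Category.assoc, Category.assoc, comp_kl, hcσ]) W
    rw [descent₁_app, descent₀_app]
    refine h2.trans (h3.symm.trans ?_)
    rw [← h1, kl, Category.assoc]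
  choose α hα using fun W => hlift W _ (θ.app W) (hθ W)
  let τ : F.functor ⟶ E :=
    { app := α
      naturality := fun W W' f => by
        rw [← cancel_mono (i.app W'), Category.assoc, hα, θ.naturality, Category.assoc,
          i.naturality, ← Category.assoc, hα] }
  have hτi : τ ≫ i = θ := NatTrans.ext (funext hα)
  have hτm : NatTrans.IsMonoidal τ := by
    have : NatTrans.IsMonoidal (τ ≫ i) := by
      rw [hτi]
      infer_instance
    exact isMonoidal_of_comp_mono τ i
  have hτ (W : Rep R d) : IsIso (τ.app W) :=
    (KlIso.of_comp (hiso W) (by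
      have := klIso_glTwist F.functor b υ W
      change KlIso (α W ≫ i.app W)
      rw [hα]
      exact this)).isIso_of_reflects
  have hτiso : IsIso τ := NatIso.isIso_of_isIso_app τ
  have hτinv := isMonoidal_inv τ
  refine ⟨{ hom := ⟨τ⟩
            inv := ⟨inv τ⟩
            hom_inv_id := TensorFunctor.Hom.ext (IsIso.hom_inv_id τ)
            inv_hom_id := TensorFunctor.Hom.ext (IsIso.inv_hom_id τ) }, ?_⟩
  change α (std R d) = h.hom ≫ l
  rw [← cancel_mono (i.app (std R d)), hα, Category.assoc, hl]
  exact hbσ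

end DescendedFunctor

open scoped Obj

/-! ### Evaluation at the standard representation is an equivalence. -/

section Evaluation

variable {R : Type u} [CommRing R] {d : ℕ} {C : Type w} [Category.{u} C] [Preadditive C]
  [Linear R C] [MonoidalCategory C] [SymmetricCategory C] [MonoidalClosed C] [HasColimits C]
  [MonoidalPreadditive C] [MonoidalLinear R C]

theorem comp_row {B : C} [MonObj B] {M N : C} (h : N ⟶ M) (f : Fin d → (M ⟶ B)) :
    h ≫ row R f = row R (fun j => h ≫ f j) := by
  simp only [row, Preadditive.comp_sum, Category.assoc]

/-- The trivialization of the standard representation. -/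
def stdRow (F : Rep R d ⥤ C) :
    F.obj (std R d) ⟶ F.obj (Comod.regular R (GLRing R d)) ⊗ freeStd R C d :=
  row R fun j => F.map (Comod.column R j)

theorem klIso_row_map (F : Rep R d ⥤ C) [F.Braided] [F.Additive] [F.Linear R] [F.IsLeftAdjoint]
    {A : C} [MonObj A] (b : F.obj (Comod.regular R (GLRing R d)) ⟶ A) [IsMonHom b] :
    KlIso (row R fun j => F.map (Comod.column R j) ≫ b) := by
  obtain ⟨υ, hυ, hυ'⟩ := exists_trivial_iso F
  rw [← stdTwist_eq_row F b υ]
  exact klIso_glTwist F b υ (std R d)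

theorem klIso_stdRow (F : Rep R d ⥤ C) [F.Braided] [F.Additive] [F.Linear R] [F.IsLeftAdjoint] :
    KlIso (stdRow F) := by
  have := klIso_row_map F (𝟙 _)
  simp only [Category.comp_id] at this
  exact this

variable [AB5 C]

theorem isLocallyFree_std (F : TensorFunctor R (Rep R d) C) :
    IsLocallyFree d (F.functor.obj (std R d)) where
  hasDual := by
    obtain ⟨V', ⟨hV⟩⟩ := Comod.exists_exactPairing (std R d) (Pi.basisFun R (Fin d))
    exact ⟨_, ⟨mapExactPairing F.functor (std R d) V'⟩⟩
  locallyTrivial := by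
    obtain ⟨c, hc⟩ := (klIso_stdRow F.functor).exists_isFrame
    exact ⟨⟨F.functor.obj (Comod.regular R (GLRing R d))⟩, isFaithfullyFlat_map_regular F.functor,
      hc.nonempty_iso⟩

/-- Since `α` is an algebra map at `H`, the tautological trivialization of `F(std)` extends to one
over `G H`. By naturality this is `α` followed by the trivialization of `G(std)`, so `α` is
invertible over the faithfully flat `G H`. -/
theorem isIso_app_std {F G : TensorFunctor R (Rep R d) C} (α : F ⟶ G) :
    IsIso (α.hom.app (std R d)) := by
  let H := Comod.regular R (GLRing R d)
  have := (isFaithfullyFlat_map_regular G.functor).reflectsIsomorphisms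
  have := isMonHom_app α.hom H
  have h : α.hom.app (std R d) ≫ stdRow G.functor =
      row R fun j => F.functor.map (Comod.column R j) ≫ α.hom.app H := by
    rw [stdRow, comp_row]
    exact congrArg (row R) (funext fun j => (α.hom.naturality _).symm)
  exact (KlIso.of_comp (klIso_stdRow G.functor)
    (h ▸ klIso_row_map F.functor (α.hom.app H))).isIso_of_reflects

variable (R d C)

/-- Evaluation of tensor functors at the standard representation. -/
def evalStd : TensorFunctor R (Rep R d) C ⥤ LFIso C d where
  obj F := ⟨⟨F.functor.obj (std R d), isLocallyFree_std F⟩⟩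
  map α :=
    haveI := isIso_app_std α
    ⟨ObjectProperty.isoMk _ (asIso (α.hom.app (std R d)))⟩
  map_id _ := Core.hom_ext rfl
  map_comp _ _ := Core.hom_ext rfl

theorem evalStd_incl : evalStd R d C ⋙ LFIso.incl C d = TensorFunctor.eval (std R d) := rfl

theorem isEquivalence_evalStd [HasEqualizers C] : (evalStd R d C).IsEquivalence where
  faithful :=
    { map_injective := fun {F G α α'} h =>
        tensorFunctor_hom_ext (congrArg (fun k => k.iso.hom.hom) h) }
  full :=
    { map_surjective := fun {F G} f => by
        let f' : F.functor.obj (std R d) ≅ G.functor.obj (std R d) :=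
          (ObjectProperty.ι _).mapIso f.iso
        -- Both functors are compared with the `E` built from `M = G(std)`: `F` through the given
        -- isomorphism, `G` through the identity. The isomorphism `e` then cancels.
        obtain ⟨E, e, he⟩ := exists_tensorFunctor (isFaithfullyFlat_map_regular G.functor)
          (klIso_stdRow G.functor)
        obtain ⟨α, hα⟩ := he F f'
        obtain ⟨α', hα'⟩ := he G (Iso.refl _)
        refine ⟨α.hom ≫ α'.inv, Core.hom_ext (ObjectProperty.hom_ext _ ?_)⟩
        change α.hom.hom.app (std R d) ≫ α'.inv.hom.app (std R d) = f'.hom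
        have h : α'.hom.hom.app (std R d) ≫ α'.inv.hom.app (std R d) = 𝟙 _ :=
          congrArg (fun k => k.hom.app (std R d)) α'.hom_inv_id
        rw [hα', Iso.refl_hom, Category.id_comp] at h
        rw [hα, Category.assoc, h, Category.comp_id] }
  essSurj :=
    { mem_essImage := fun X => by
        obtain ⟨B, hB, ⟨e⟩⟩ := X.of.property.locallyTrivial
        obtain ⟨f, c, hfc⟩ := exists_isFrame_of_iso e
        obtain ⟨E, e', -⟩ := exists_tensorFunctor (R := R) hB (hfc.klIso_row (R := R))
        exact ⟨E, ⟨Core.isoMk (ObjectProperty.isoMk _ e')⟩⟩ }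

end Evaluation

end

end RepGL

theorem mainTheorem8 (R : Type u) [CommRing R] (d : ℕ)
    (C : Type w) [Category.{u} C] [Preadditive C] [Linear R C]
    [MonoidalCategory C] [SymmetricCategory C] [MonoidalPreadditive C] [MonoidalLinear R C]
    [MonoidalClosed C] [HasColimits C] [HasEqualizers C] [AB5 C] :
    ∃ Φ : RepGL.TensorFunctor R (RepGL.Rep R d) C ⥤ RepGL.LFIso C d,
      Φ ⋙ RepGL.LFIso.incl C d = RepGL.TensorFunctor.eval (RepGL.std R d) ∧
      Φ.IsEquivalence :=
  ⟨RepGL.evalStd R d C, RepGL.evalStd_incl R d C, RepGL.isEquivalence_evalStd R d C⟩
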